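/- Write $\log_1 x=\max\{\log x,1\}$ and $\log_2 x=\log_1(\log_1 x)$. Let $(a_n)_{n\ge 1}$ be a sequence of real numbers with the following properties. (i) $a_{mn}=a_ma_n$ for all coprime positive integers $m,n$. (ii) For every prime $p$ we have $a_p\in[-2,2]$, and the angles $\vartheta_p\in[0,\pi]$ defined by $a_p=2\cos\vartheta_p$ satisfy, for every $\alpha\in[0,\pi)$, $$\frac{\#\{p\le x:\ p\text{ prime},\ \vartheta_p\in[0,\alpha]\}}{\pi(x)}\to\frac2\pi\int_0^\alpha\sin^2\vartheta\,d\vartheta\qquad(x\to\infty),$$ where $\pi(x)$ is the number of primes $p\le x$. (iii) There is a constant $\varrho>0$ such that $|a_{p^k}|\le p^{(k-1)/2-\varrho}$ for every prime $p$ and every integer $k\ge 2$. Assume in addition: (A1) There are constants $C>0$ and $c_0>0$ such that $|a_{p^k}|\ge c_0\,p^{-Ck}$ for every prime $p$ with $a_p\ne 0$ and every integer $k\ge 1$. (A2) For every fixed $A>0$, $$\frac{\#\{p\le x:\ p\text{ prime},\ \vartheta_p\in[\alpha,\beta]\}}{\pi(x)}=\frac2\pi\int_\alpha^\beta\sin^2\vartheta\,d\vartheta+O\bigl((\log_2x)^{-A}\bigr)$$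 as $x\to\infty$, uniformly in $0\le\alpha\le\beta\le\pi$, where the implied constant may depend on $A$. Let $\mathcal N(x)=\{n\in[1,x]:\ a_n\ne 0\}$ and $c=\frac12+\frac{\pi^2}{12}$. Then for every fixed $v\in\mathbb R$, $$\lim_{x\to\infty}\frac1{\#\mathcal N(x)}\cdot\#\Bigl\{n\in\mathcal N(x):\ \frac{\log|a_n|+\frac12\log_2 n}{\sqrt{c\log_2 n}}\ge v\Bigr\}=\int_v^\infty e^{-u^2/2}\,\frac{du}{\sqrt{2\pi}}.$$ -/

import Mathlib

open Filter Topology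

/-- `log₁ x = max (log x) 1`. -/
noncomputable def log₁ (x : ℝ) : ℝ := max (Real.log x) 1

/-- `log₂ x = log₁ (log₁ x)`, a twice iterated natural logarithm (not the logarithm to base 2). -/
noncomputable def log₂ (x : ℝ) : ℝ := log₁ (log₁ x)

/-- The angle `ϑ_n ∈ [0, π]` with `a_n = 2 cos ϑ_n`; it is used only at primes,
where `a_p ∈ [-2, 2]`. -/
noncomputable def angle (a : ℕ → ℝ) (n : ℕ) : ℝ := Real.arccos (a n / 2)

/-- The proportion of the primes `p ≤ x` whose angle `ϑ_p` lies in `[α, β]`. -/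
noncomputable def angleProportion (a : ℕ → ℝ) (x α β : ℝ) : ℝ :=
  (((Finset.Icc 1 ⌊x⌋₊).filter
      (fun p => p.Prime ∧ α ≤ angle a p ∧ angle a p ≤ β)).card : ℝ)
    / (Nat.primeCounting ⌊x⌋₊ : ℝ)

/-- The Sato–Tate mass of the interval `[α, β]`. -/
noncomputable def satoTateMass (α β : ℝ) : ℝ :=
  2 / Real.pi * ∫ t in α..β, Real.sin t ^ 2

/-- The class of real sequences `(a_n)_{n ≥ 1}` that are multiplicative, Sato–Tate distributed
at the primes, and of restricted growth on higher prime powers. The value `a 0` plays no role. -/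
structure SatoTateClass (a : ℕ → ℝ) : Prop where
  multiplicative : ∀ m n : ℕ, 0 < m → 0 < n → Nat.Coprime m n → a (m * n) = a m * a n
  mem_Icc : ∀ p : ℕ, p.Prime → a p ∈ Set.Icc (-2 : ℝ) 2
  equidistributed : ∀ α : ℝ, 0 ≤ α → α < Real.pi →
    Tendsto (fun x : ℝ => angleProportion a x 0 α) atTop (𝓝 (satoTateMass 0 α))
  growth : ∃ ϱ : ℝ, 0 < ϱ ∧ ∀ k : ℕ, 2 ≤ k → ∀ p : ℕ, p.Prime →
    |a (p ^ k)| ≤ (p : ℝ) ^ (((k : ℝ) - 1) / 2 - ϱ)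

/-- If `a_p ≠ 0` then `|a_{p^k}| ≫ p^{-Ck}` for all `k ≥ 1`, with a constant `C > 0` and an
implied constant that depend neither on `p` nor on `k`. -/
def AssumptionA1 (a : ℕ → ℝ) : Prop :=
  ∃ C : ℝ, 0 < C ∧ ∃ c₀ : ℝ, 0 < c₀ ∧ ∀ p : ℕ, p.Prime → a p ≠ 0 → ∀ k : ℕ, 1 ≤ k →
    c₀ * (p : ℝ) ^ (-(C * (k : ℝ))) ≤ |a (p ^ k)|

/-- For every fixed `A > 0`, the Sato–Tate law with error `O((log₂ x)^{-A})` as `x → ∞`,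
uniformly in `0 ≤ α ≤ β ≤ π`. -/
def AssumptionA2 (a : ℕ → ℝ) : Prop :=
  ∀ A : ℝ, 0 < A → ∃ K : ℝ, ∃ x₀ : ℝ, ∀ x : ℝ, x₀ ≤ x →
    ∀ α β : ℝ, 0 ≤ α → α ≤ β → β ≤ Real.pi →
      |angleProportion a x α β - satoTateMass α β| ≤ K * (log₂ x) ^ (-A)

/-- `𝒩(x) = {n ∈ [1, x] : a_n ≠ 0}`. -/
noncomputable def nonvanishing (a : ℕ → ℝ) (x : ℝ) : Finset ℕ :=
  (Finset.Icc 1 ⌊x⌋₊).filter (fun n => a n ≠ 0)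

/-- Abel summation on `(m, N]`. -/
theorem sum_Ioc_mul_eq_abel (b w : ℕ → ℝ) {m N : ℕ} (hmN : m ≤ N) :
    ∑ n ∈ Finset.Ioc m N, b n * w n =
      (∑ n ∈ Finset.Ioc m N, b n) * w N +
        ∑ k ∈ Finset.Ico m N, (∑ n ∈ Finset.Ioc m k, b n) * (w k - w (k + 1)) := by
  induction N, hmN using Nat.le_induction with
  | base => simp
  | succ N h ih =>
    rw [Finset.sum_Ioc_succ_top (by omega), Finset.sum_Ioc_succ_top (by omega),
      Finset.sum_Ico_succ_top h, ih]
    ring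

theorem abs_sum_Ioc_mul_le_of_antitone (b w : ℕ → ℝ) {m N : ℕ} (hmN : m ≤ N) {R : ℝ}
    (hw : ∀ k, m ≤ k → k < N → w (k + 1) ≤ w k) (hw0 : 0 ≤ w N)
    (hb : ∀ k, m ≤ k → k ≤ N → |∑ n ∈ Finset.Ioc m k, b n| ≤ R) :
    |∑ n ∈ Finset.Ioc m N, b n * w n| ≤ R * w m := by
  have htel : ∑ k ∈ Finset.Ico m N, (w k - w (k + 1)) = w m - w N := by
    rw [← neg_inj, ← Finset.sum_neg_distrib]
    simp only [neg_sub]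
    exact Finset.sum_Ico_sub w hmN
  rw [sum_Ioc_mul_eq_abel b w hmN]
  calc _ ≤ |(∑ n ∈ Finset.Ioc m N, b n) * w N| +
        ∑ k ∈ Finset.Ico m N, |(∑ n ∈ Finset.Ioc m k, b n) * (w k - w (k + 1))| :=
        (abs_add_le _ _).trans (by gcongr; exact Finset.abs_sum_le_sum_abs _ _)
    _ ≤ R * w N + ∑ k ∈ Finset.Ico m N, R * (w k - w (k + 1)) := by
        gcongr with k hk
        · rw [abs_mul, abs_of_nonneg hw0]
          gcongr
          exact hb N hmN le_rfl
        · rw [Finset.mem_Ico] at hk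
          have := hw k hk.1 hk.2
          rw [abs_mul, abs_of_nonneg (sub_nonneg.2 this)]
          exact mul_le_mul_of_nonneg_right (hb k hk.1 hk.2.le) (sub_nonneg.2 this)
    _ = R * w m := by rw [← Finset.mul_sum, htel]; ring

/-- The primes in `(m, N]`. -/
def primesIoc (m N : ℕ) : Finset ℕ := (Finset.Ioc m N).filter Nat.Prime

theorem mem_primesIoc {m N p : ℕ} : p ∈ primesIoc m N ↔ (m < p ∧ p ≤ N) ∧ p.Prime := by
  simp [primesIoc]

theorem primesIoc_union {l m n : ℕ} (hlm : l ≤ m) (hmn : m ≤ n) (f : ℕ → ℝ) :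
    ∑ p ∈ primesIoc l n, f p = ∑ p ∈ primesIoc l m, f p + ∑ p ∈ primesIoc m n, f p := by
  simp only [primesIoc, Finset.sum_filter]
  rw [Finset.sum_Ioc_consecutive _ hlm hmn]

theorem card_primesIoc_zero (n : ℕ) : (primesIoc 0 n).card = n.primeCounting := by
  rw [← Nat.primesLE_card_eq_primeCounting]
  congr 1
  ext p
  simp only [mem_primesIoc, Nat.mem_primesLE]
  exact ⟨fun h => ⟨h.1.2, h.2⟩, fun h => ⟨⟨h.2.pos, h.1⟩, h.2⟩⟩

theorem sum_log_primesIoc_le (N : ℕ) :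
    ∑ p ∈ primesIoc 0 N, Real.log p ≤ Real.log 4 * N := by
  have h := Chebyshev.theta_le_log4_mul_x (Nat.cast_nonneg (α := ℝ) N)
  rw [Chebyshev.theta_eq_sum_Icc] at h
  simp only [Nat.floor_natCast] at h
  refine le_trans (Finset.sum_le_sum_of_subset_of_nonneg ?_ ?_) h
  · intro p hp
    rw [mem_primesIoc] at hp
    simp [hp.1.2, hp.2]
  · intro p _ _
    exact Real.log_natCast_nonneg p

/-- Chebyshev's upper bound. -/
theorem exists_primeCounting_le :
    ∃ C : ℝ, 0 < C ∧ ∀ n : ℕ, 2 ≤ n → (n.primeCounting : ℝ) ≤ C * (n / Real.log n) := by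
  refine ⟨2 * Real.log 4 + 2, by positivity, fun n hn => ?_⟩
  have hn1 : (1 : ℝ) < n := by exact_mod_cast hn
  have h := Chebyshev.pi_le_log4_mul_div hn1
  rw [Nat.floor_natCast] at h
  have hl : 0 < Real.log n := Real.log_pos hn1
  have hs : Real.log √(n:ℝ) = Real.log n / 2 := Real.log_sqrt (by linarith)
  rw [hs] at h
  have hsq : √(n:ℝ) * Real.log n ≤ 2 * n := by
    have h1 : Real.log √(n:ℝ) ≤ √(n:ℝ) := (Real.log_le_sub_one_of_pos (by positivity)).trans (by linarith)
    rw [hs] at h1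
    have h2 : √(n:ℝ) * √(n:ℝ) = n := Real.mul_self_sqrt (by linarith)
    nlinarith [Real.sqrt_nonneg (n:ℝ)]
  refine h.trans ?_
  have : √(n:ℝ) ≤ 2 * (n / Real.log n) := by
    rw [← mul_div_assoc, le_div_iff₀ hl]; exact hsq
  calc _ ≤ Real.log 4 * n / (Real.log n / 2) + 2 * (n / Real.log n) := by gcongr
    _ = _ := by field_simp

theorem log_factorial_eq_sum (N : ℕ) :
    Real.log (N.factorial) =
      ∑ p ∈ primesIoc 0 N, (N.factorial.factorization p : ℝ) * Real.log p := by
  have h0 : N.factorial ≠ 0 := N.factorial_ne_zero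
  conv_lhs => rw [← Nat.prod_factorization_pow_eq_self h0]
  rw [Finsupp.prod, Nat.cast_prod, Real.log_prod]
  · have hsub : N.factorial.factorization.support ⊆ primesIoc 0 N := by
      intro p hp
      rw [Nat.support_factorization, Nat.mem_primeFactors] at hp
      rw [mem_primesIoc]
      exact ⟨⟨hp.1.pos, (hp.1.dvd_factorial).1 hp.2.1⟩, hp.1⟩
    rw [← Finset.sum_subset hsub]
    · simp
    · intro p _ hp
      rw [Finsupp.notMem_support_iff] at hp
      simp [hp]
  · intro p hp
    rw [Nat.support_factorization, Nat.mem_primeFactors] at hp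
    have := hp.1.pos
    positivity

theorem div_le_factorization_factorial {N p : ℕ} (hp : p.Prime) :
    (N : ℝ) / p - 1 ≤ (N.factorial.factorization p : ℝ) := by
  have h1 : N / p ≤ N.factorial.factorization p := by
    rw [Nat.factorization_factorial hp (show Nat.log p N < Nat.log p N + 2 by omega)]
    have := Finset.single_le_sum (f := fun i => N / p ^ i) (fun i _ => Nat.zero_le _)
      (show 1 ∈ Finset.Ico 1 (Nat.log p N + 2) by simp)
    simpa using this
  have h2 : (N : ℝ) / p < (N / p : ℕ) + 1 := by
    have := Nat.lt_floor_add_one ((N : ℝ) / p)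
    rwa [Nat.floor_div_eq_div] at this
  have h3 : ((N / p : ℕ) : ℝ) ≤ (N.factorial.factorization p : ℝ) := by exact_mod_cast h1
  linarith

theorem factorization_factorial_le_div {N p : ℕ} (hp : p.Prime) :
    (N.factorial.factorization p : ℝ) ≤ (N : ℝ) / (p - 1) := by
  have : Fact p.Prime := ⟨hp⟩
  have h := sub_one_mul_padicValNat_factorial (p := p) N
  rw [← Nat.factorization_def _ hp] at h
  have hp1 : (1 : ℝ) < p := by exact_mod_cast hp.one_lt
  rw [le_div_iff₀ (by linarith)]
  have h2 : (p - 1) * N.factorial.factorization p ≤ N := h ▸ Nat.sub_le _ _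
  have h3 : (((p - 1) * N.factorial.factorization p : ℕ) : ℝ) ≤ N := by exact_mod_cast h2
  rw [Nat.cast_mul, Nat.cast_sub hp.one_lt.le] at h3
  push_cast at h3
  linarith

theorem exists_sum_log_div_primes_bound :
    ∃ C : ℝ, ∀ N : ℕ, ∑ p ∈ primesIoc 0 N, (Real.log p / (p - 1) - Real.log p / p) ≤ C := by
  have hs : Summable (fun n : ℕ => 4 * (1 / (n : ℝ) ^ (3 / 2 : ℝ))) :=
    (Real.summable_one_div_nat_rpow.2 (by norm_num)).mul_left _
  refine ⟨∑' n : ℕ, 4 * (1 / (n : ℝ) ^ (3 / 2 : ℝ)), fun N => ?_⟩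
  refine le_trans (Finset.sum_le_sum fun p hp => ?_)
    (hs.sum_le_tsum (primesIoc 0 N) fun n _ => by positivity)
  rw [mem_primesIoc] at hp
  have hp2 : (2 : ℝ) ≤ p := by exact_mod_cast hp.2.two_le
  have hl : Real.log p ≤ 2 * (p : ℝ) ^ (1 / 2 : ℝ) := by
    have := Real.log_le_rpow_div (x := p) (by linarith) (ε := 1 / 2) (by norm_num)
    linarith
  have e : (p : ℝ) ^ (3 / 2 : ℝ) * (p : ℝ) ^ (1 / 2 : ℝ) = p ^ 2 := by
    rw [← Real.rpow_add (by linarith)]; norm_num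
  have h2 : Real.log p / (p - 1) - Real.log p / p = Real.log p / ((p - 1) * p) := by
    field_simp [show (p : ℝ) - 1 ≠ 0 by linarith]; ring
  rw [h2, mul_one_div, div_le_div_iff₀ (by nlinarith) (by positivity)]
  have hpos : 0 < (p : ℝ) ^ (3 / 2 : ℝ) := by positivity
  nlinarith [mul_le_mul_of_nonneg_right hl hpos.le]

/-- Mertens' first theorem. -/
theorem exists_mertens_first :
    ∃ C : ℝ, ∀ N : ℕ, 1 ≤ N → |∑ p ∈ primesIoc 0 N, Real.log p / p - Real.log N| ≤ C := by
  obtain ⟨C, hC⟩ := exists_sum_log_div_primes_bound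
  refine ⟨max (Real.log 4) (1 + C), fun N hN => ?_⟩
  have hN0 : (0 : ℝ) < N := by exact_mod_cast hN
  have hup : Real.log (N.factorial) ≤ N * Real.log N := by
    rw [← Real.log_pow]
    apply Real.log_le_log (by positivity)
    exact_mod_cast Nat.factorial_le_pow N
  have hlo : N * Real.log N - N ≤ Real.log (N.factorial) := by
    have h := Real.pow_div_factorial_le_exp (N : ℝ) (by positivity) N
    have h2 := Real.log_le_log (by positivity) h
    rw [Real.log_div (by positivity) (by positivity), Real.log_pow, Real.log_exp] at h2
    linarith
  have h1 : N * ∑ p ∈ primesIoc 0 N, Real.log p / p - Real.log 4 * N ≤ Real.log N.factorial := by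
    rw [log_factorial_eq_sum]
    have : N * ∑ p ∈ primesIoc 0 N, Real.log p / p - ∑ p ∈ primesIoc 0 N, Real.log p ≤
        ∑ p ∈ primesIoc 0 N, (N.factorial.factorization p : ℝ) * Real.log p := by
      rw [Finset.mul_sum, ← Finset.sum_sub_distrib]
      apply Finset.sum_le_sum
      intro p hp
      rw [mem_primesIoc] at hp
      have := mul_le_mul_of_nonneg_right (div_le_factorization_factorial (N := N) hp.2)
        (Real.log_natCast_nonneg p)
      calc _ = ((N : ℝ) / p - 1) * Real.log p := by ring
        _ ≤ _ := this
    linarith [sum_log_primesIoc_le N]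
  have h2 : Real.log N.factorial ≤ N * (∑ p ∈ primesIoc 0 N, Real.log p / p + C) := by
    rw [log_factorial_eq_sum]
    calc _ ≤ ∑ p ∈ primesIoc 0 N, N * (Real.log p / (p - 1)) := by
          apply Finset.sum_le_sum
          intro p hp
          rw [mem_primesIoc] at hp
          calc _ ≤ (N : ℝ) / (p - 1) * Real.log p := by
                gcongr
                exact factorization_factorial_le_div hp.2
            _ = _ := by ring
      _ ≤ _ := by
          rw [← Finset.mul_sum]
          gcongr
          have := hC N
          rw [Finset.sum_sub_distrib] at this
          linarith
  rw [abs_le]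
  have h3 : N * ∑ p ∈ primesIoc 0 N, Real.log p / p ≤ N * (Real.log N + Real.log 4) := by linarith
  have h4 : N * (Real.log N - (1 + C)) ≤ N * ∑ p ∈ primesIoc 0 N, Real.log p / p := by linarith
  have h5 := le_of_mul_le_mul_left h3 hN0
  have h6 := le_of_mul_le_mul_left h4 hN0
  constructor
  · linarith [le_max_right (Real.log 4) (1 + C)]
  · linarith [le_max_left (Real.log 4) (1 + C)]

/-- Mertens' second theorem. -/
theorem exists_mertens_second :
    ∃ C : ℝ, 0 ≤ C ∧ ∀ N : ℕ, 2 ≤ N →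
      |∑ p ∈ primesIoc 0 N, 1 / (p : ℝ) - Real.log (Real.log N)| ≤ C := by
  obtain ⟨R, hR⟩ := exists_mertens_first
  have hR0 : 0 ≤ R := (abs_nonneg _).trans (hR 1 le_rfl)
  have hl2 : 0 < Real.log 2 := Real.log_pos (by norm_num)
  set b : ℕ → ℝ := fun n =>
    (if n.Prime then Real.log n / n else 0) - (Real.log n - Real.log (n - 1 : ℕ)) with hb
  have hbsum : ∀ k, 2 ≤ k → ∑ n ∈ Finset.Ioc 2 k, b n =
      (∑ p ∈ primesIoc 0 k, Real.log p / p - Real.log k) -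
        (∑ p ∈ primesIoc 0 2, Real.log p / p - Real.log (2 : ℕ)) := by
    intro k hk
    rw [primesIoc_union (Nat.zero_le 2) hk]
    have : ∑ n ∈ Finset.Ioc 2 k, (Real.log n - Real.log (n - 1 : ℕ)) =
        Real.log k - Real.log (2 : ℕ) := by
      induction k, hk using Nat.le_induction with
      | base => simp
      | succ k h ih => rw [Finset.sum_Ioc_succ_top (by omega), ih]; simp
    rw [hb, Finset.sum_sub_distrib, this, primesIoc, primesIoc, Finset.sum_filter,
      Finset.sum_filter]
    ring
  have hlogpos : ∀ n : ℕ, 2 ≤ n → 0 < Real.log n := fun n hn =>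
    Real.log_pos (by exact_mod_cast hn)
  have key1 : ∀ N : ℕ, 2 ≤ N →
      |∑ n ∈ Finset.Ioc 2 N, b n * (1 / Real.log n)| ≤ 2 * R * (1 / Real.log (2 : ℕ)) := by
    intro N hN
    refine abs_sum_Ioc_mul_le_of_antitone b (fun n => 1 / Real.log n) hN ?_ ?_ ?_
    · intro k hk _
      apply one_div_le_one_div_of_le (hlogpos k hk)
      apply Real.log_le_log (by positivity)
      push_cast; linarith
    · have := hlogpos N hN; positivity
    · intro k hk _
      rw [hbsum k hk]
      refine (abs_sub _ _).trans ?_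
      linarith [hR k (by omega), hR 2 (by omega)]
  have key2 : ∀ N : ℕ, 2 ≤ N →
      |Real.log (Real.log N) - Real.log (Real.log (2 : ℕ)) -
        ∑ n ∈ Finset.Ioc 2 N, (Real.log n - Real.log (n - 1 : ℕ)) * (1 / Real.log n)| ≤
        1 / Real.log (2 : ℕ) - 1 / Real.log N := by
    intro N hN
    induction N, hN using Nat.le_induction with
    | base => simp
    | succ k h ih =>
      rw [Finset.sum_Ioc_succ_top (by omega)]
      simp only [Nat.add_sub_cancel]
      have hx := hlogpos k h
      have hy := hlogpos (k + 1) (by omega)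
      have hxy : Real.log k ≤ Real.log (k + 1 : ℕ) := by
        apply Real.log_le_log (by positivity); push_cast; linarith
      have hd : Real.log (k + 1 : ℕ) - Real.log k ≤ 1 := by
        have hk0 : (2 : ℝ) ≤ k := by exact_mod_cast h
        rw [← Real.log_div (by positivity) (by positivity)]
        refine (Real.log_le_sub_one_of_pos (by positivity)).trans ?_
        rw [sub_le_iff_le_add, div_le_iff₀ (by positivity)]
        push_cast; linarith
      set x := Real.log k
      set y := Real.log (k + 1 : ℕ)
      have hlo : (y - x) * (1 / y) ≤ Real.log y - Real.log x := by
        have := Real.log_le_sub_one_of_pos (show 0 < x / y by positivity)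
        rw [Real.log_div hx.ne' hy.ne'] at this
        have e : (y - x) * (1 / y) = 1 - x / y := by field_simp
        linarith
      have hup : Real.log y - Real.log x ≤ (y - x) * (1 / x) := by
        have := Real.log_le_sub_one_of_pos (show 0 < y / x by positivity)
        rw [Real.log_div hy.ne' hx.ne'] at this
        have e : (y - x) * (1 / x) = y / x - 1 := by field_simp
        linarith
      have h1 : 1 / y ≤ 1 / x := one_div_le_one_div_of_le hx hxy
      have h2 : (y - x) * (1 / x - 1 / y) ≤ 1 * (1 / x - 1 / y) :=
        mul_le_mul_of_nonneg_right hd (by linarith)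
      rw [abs_le] at ih ⊢
      constructor <;> nlinarith [ih.1, ih.2]
  refine ⟨2 * R * (1 / Real.log (2 : ℕ)) + 1 / Real.log (2 : ℕ) + 1 / 2 +
    |Real.log (Real.log (2 : ℕ))|, by positivity, fun N hN => ?_⟩
  have e1 : ∑ n ∈ Finset.Ioc 2 N, b n * (1 / Real.log n) = ∑ p ∈ primesIoc 2 N, 1 / (p : ℝ) -
      ∑ n ∈ Finset.Ioc 2 N, (Real.log n - Real.log (n - 1 : ℕ)) * (1 / Real.log n) := by
    simp only [hb, sub_mul _ (Real.log _ - _), Finset.sum_sub_distrib, primesIoc, Finset.sum_filter]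
    congr 1
    apply Finset.sum_congr rfl
    intro n hn
    rw [Finset.mem_Ioc] at hn
    have := hlogpos n (by omega)
    split_ifs
    · field_simp
    · simp
  have e2 : ∑ p ∈ primesIoc 0 2, 1 / (p : ℝ) = 1 / 2 := by
    have : primesIoc 0 2 = {2} := by decide
    rw [this]; simp
  have h1 := key1 N hN
  have h2 := key2 N hN
  have h3 : 0 ≤ 1 / Real.log N := by have := hlogpos N hN; positivity
  rw [primesIoc_union (Nat.zero_le 2) hN, e2]
  rw [e1] at h1
  have h4 := abs_le.1 (le_refl |Real.log (Real.log (2 : ℕ))|)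
  have h5 : 0 ≤ 1 / Real.log (2 : ℕ) := by have := hlogpos 2 le_rfl; positivity
  rw [abs_le] at h1 h2 ⊢
  generalize 2 * R * (1 / Real.log (2 : ℕ)) = A at *
  generalize 1 / Real.log (2 : ℕ) = B at *
  generalize Real.log (Real.log (2 : ℕ)) = D at *
  obtain ⟨h1l, h1u⟩ := h1
  obtain ⟨h2l, h2u⟩ := h2
  obtain ⟨h4l, h4u⟩ := h4
  constructor <;> linarith

theorem log_log_pos {n : ℕ} (hn : 16 ≤ n) : 0 < Real.log (Real.log n) := by
  have h2 : (16 : ℝ) ≤ n := by exact_mod_cast hn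
  apply Real.log_pos
  rw [Real.lt_log_iff_exp_lt (by linarith)]
  linarith [Real.exp_one_lt_d9]

theorem sum_inv_mul_log_le {m N : ℕ} (hm : 16 ≤ m) (hmN : m ≤ N) :
    ∑ k ∈ Finset.Ioc m N, 1 / (k * Real.log k * Real.log (Real.log k) ^ 2) ≤
      1 / Real.log (Real.log m) - 1 / Real.log (Real.log N) := by
  induction N, hmN using Nat.le_induction with
  | base => simp
  | succ k h ih =>
    rw [Finset.sum_Ioc_succ_top (by omega)]
    have hk : (16 : ℝ) ≤ k := by exact_mod_cast hm.trans h
    have hu := log_log_pos (hm.trans h)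
    have hv := log_log_pos (show 16 ≤ k + 1 by omega)
    have hx : 0 < Real.log k := Real.log_pos (by linarith)
    have hy : 0 < Real.log (k + 1 : ℕ) := Real.log_pos (by push_cast; linarith)
    have hd : 1 / ((k + 1 : ℕ) : ℝ) ≤ Real.log (k + 1 : ℕ) - Real.log k := by
      have := Real.log_le_sub_one_of_pos (show 0 < (k : ℝ) / (k + 1 : ℕ) by positivity)
      rw [Real.log_div (by positivity) (by positivity)] at this
      have e : 1 / ((k + 1 : ℕ) : ℝ) = 1 - (k : ℝ) / (k + 1 : ℕ) := by
        field_simp; push_cast; ring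
      linarith
    have hd2 : (Real.log (k + 1 : ℕ) - Real.log k) / Real.log (k + 1 : ℕ) ≤
        Real.log (Real.log (k + 1 : ℕ)) - Real.log (Real.log k) := by
      have := Real.log_le_sub_one_of_pos (show 0 < Real.log k / Real.log (k + 1 : ℕ) by positivity)
      rw [Real.log_div hx.ne' hy.ne'] at this
      rw [sub_div, div_self hy.ne']
      linarith
    set u := Real.log (Real.log k)
    set v := Real.log (Real.log (k + 1 : ℕ))
    have h1 : 1 / (((k + 1 : ℕ) : ℝ) * Real.log (k + 1 : ℕ)) ≤ v - u := by
      refine le_trans ?_ hd2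
      rw [← div_div]
      gcongr
    have huv : u ≤ v := by
      have : 0 ≤ 1 / (((k + 1 : ℕ) : ℝ) * Real.log (k + 1 : ℕ)) := by positivity
      linarith
    have h2 : 1 / (((k + 1 : ℕ) : ℝ) * Real.log (k + 1 : ℕ) * v ^ 2) ≤ 1 / u - 1 / v := by
      rw [← div_div]
      calc _ ≤ (v - u) / v ^ 2 := by gcongr
        _ ≤ (v - u) / (u * v) := by
          apply div_le_div_of_nonneg_left (by linarith) (by positivity)
          nlinarith
        _ = _ := by field_simp
    linarith

/-- If the partial sums of `c` are `O(n / (log n (log log n)²))` then the tails of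
`∑ c_n / n` are uniformly `O(1 / log log m)`. -/
theorem abs_sum_Ioc_div_le (c : ℕ → ℝ) {K : ℝ} (hK : 0 ≤ K) {m N : ℕ} (hm : 16 ≤ m) (hmN : m ≤ N)
    (hc : ∀ k, m ≤ k → |∑ n ∈ Finset.Ioc 0 k, c n| ≤
      K * (k / (Real.log k * Real.log (Real.log k) ^ 2))) :
    |∑ n ∈ Finset.Ioc m N, c n / n| ≤
      K * (3 / (Real.log m * Real.log (Real.log m) ^ 2) + 1 / Real.log (Real.log m)) := by
  set E : ℕ → ℝ := fun k => ∑ n ∈ Finset.Ioc 0 k, c n with hE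
  set h : ℕ → ℝ := fun k => 1 / (Real.log k * Real.log (Real.log k) ^ 2) with hh
  have hpos : ∀ k, m ≤ k → 0 < Real.log k ∧ 0 < Real.log (Real.log k) ∧ (0 : ℝ) < k := by
    intro k hk
    have h16 : (16 : ℝ) ≤ k := by exact_mod_cast hm.trans hk
    exact ⟨Real.log_pos (by linarith), log_log_pos (hm.trans hk), by linarith⟩
  have hEk : ∀ k, m ≤ k → |E k| * (1 / k) ≤ K * h k := by
    intro k hk
    obtain ⟨h1, h2, h3⟩ := hpos k hk
    calc _ ≤ K * (k / (Real.log k * Real.log (Real.log k) ^ 2)) * (1 / k) := by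
          gcongr; exact hc k hk
      _ = _ := by rw [hh]; field_simp
  have hmono : h N ≤ h m := by
    obtain ⟨h1, h2, h3⟩ := hpos m le_rfl
    have hle : Real.log m ≤ Real.log N := Real.log_le_log h3 (by exact_mod_cast hmN)
    have hle2 := Real.log_le_log h1 hle
    rw [hh]
    apply one_div_le_one_div_of_le (by positivity)
    gcongr
  have hB : ∀ k, m ≤ k → ∑ n ∈ Finset.Ioc m k, c n = E k - E m := by
    intro k hk
    rw [hE]
    simp only
    rw [← Finset.sum_Ioc_consecutive _ (Nat.zero_le m) hk]
    ring
  have habel : ∑ n ∈ Finset.Ioc m N, c n / n = E N * (1 / N) - E m * (1 / m) +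
      ∑ k ∈ Finset.Ico m N, E k * (1 / (k : ℝ) - 1 / (k + 1 : ℕ)) := by
    have htel : ∑ k ∈ Finset.Ico m N, (1 / (k : ℝ) - 1 / (k + 1 : ℕ)) = 1 / (m : ℝ) - 1 / N := by
      rw [← neg_inj, ← Finset.sum_neg_distrib]
      simp only [neg_sub]
      exact Finset.sum_Ico_sub (fun k : ℕ => 1 / (k : ℝ)) hmN
    have := sum_Ioc_mul_eq_abel c (fun n => 1 / (n : ℝ)) hmN
    simp only [mul_one_div] at this
    rw [this, hB N hmN]
    have h2 : ∑ k ∈ Finset.Ico m N, (∑ n ∈ Finset.Ioc m k, c n) * (1 / (k : ℝ) - 1 / (k + 1 : ℕ)) =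
        ∑ k ∈ Finset.Ico m N, E k * (1 / (k : ℝ) - 1 / (k + 1 : ℕ)) -
          E m * (1 / (m : ℝ) - 1 / N) := by
      rw [← htel, Finset.mul_sum, ← Finset.sum_sub_distrib]
      apply Finset.sum_congr rfl
      intro k hk
      rw [hB k (Finset.mem_Ico.1 hk).1]
      ring
    rw [h2]
    ring
  have hterm : ∀ k ∈ Finset.Ico m N, |E k * (1 / (k : ℝ) - 1 / (k + 1 : ℕ))| ≤
      K * (1 / (k * Real.log k * Real.log (Real.log k) ^ 2)) := by
    intro k hk
    obtain ⟨h1, h2, h3⟩ := hpos k (Finset.mem_Ico.1 hk).1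
    have h4 : 1 / (k : ℝ) - 1 / (k + 1 : ℕ) = 1 / k * (1 / (k + 1)) := by
      push_cast; field_simp; ring
    rw [h4, abs_mul, abs_of_pos (by positivity : 0 < 1 / (k : ℝ) * (1 / (k + 1))), ← mul_assoc]
    calc _ ≤ K * h k * (1 / k) := by
          have := hEk k (Finset.mem_Ico.1 hk).1
          gcongr
          linarith
      _ = _ := by rw [hh]; field_simp
  have hsum : ∑ k ∈ Finset.Ico m N, |E k * (1 / (k : ℝ) - 1 / (k + 1 : ℕ))| ≤
      K * (h m + 1 / Real.log (Real.log m)) := by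
    refine (Finset.sum_le_sum hterm).trans ?_
    rw [← Finset.mul_sum]
    gcongr
    have hsub : Finset.Ico m N ⊆ insert m (Finset.Ioc m N) := by
      intro k hk
      simp only [Finset.mem_Ico, Finset.mem_insert, Finset.mem_Ioc] at *
      omega
    refine (Finset.sum_le_sum_of_subset_of_nonneg hsub ?_).trans ?_
    · intro k hk _
      obtain ⟨h1, h2, h3⟩ := hpos k (by
        simp only [Finset.mem_insert, Finset.mem_Ioc] at hk; omega)
      positivity
    rw [Finset.sum_insert (by simp)]
    obtain ⟨h1, h2, h3⟩ := hpos m le_rfl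
    obtain ⟨-, h2', -⟩ := hpos N hmN
    have := sum_inv_mul_log_le hm hmN
    have h5 : 0 ≤ 1 / Real.log (Real.log N) := by positivity
    have h6 : 1 / (m * Real.log m * Real.log (Real.log m) ^ 2) ≤ h m := by
      rw [hh]
      apply one_div_le_one_div_of_le (by positivity)
      have : (1 : ℝ) ≤ m := by exact_mod_cast (by omega : 1 ≤ m)
      nlinarith [mul_pos h1 (pow_pos h2 2)]
    linarith
  rw [habel]
  calc _ ≤ |E N| * (1 / N) + |E m| * (1 / m) +
        ∑ k ∈ Finset.Ico m N, |E k * (1 / (k : ℝ) - 1 / (k + 1 : ℕ))| := by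
        refine (abs_add_le _ _).trans ?_
        gcongr
        · refine (abs_sub _ _).trans ?_
          rw [abs_mul, abs_mul, abs_of_nonneg (by positivity : 0 ≤ 1 / (N : ℝ)),
            abs_of_nonneg (by positivity : 0 ≤ 1 / (m : ℝ))]
        · exact Finset.abs_sum_le_sum_abs _ _
    _ ≤ K * h m + K * h m + K * (h m + 1 / Real.log (Real.log m)) := by
        have := mul_le_mul_of_nonneg_left hmono hK
        linarith [hEk N hmN, hEk m le_rfl]
    _ = _ := by rw [hh]; ring

theorem norm_exp_mul_I_sub_sum_le (m : ℕ) (x : ℝ) :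
    ‖Complex.exp (x * Complex.I) - ∑ j ∈ Finset.range m, (x * Complex.I) ^ j / (j.factorial : ℂ)‖ ≤
      |x| ^ m / m.factorial := by
  suffices h : ∀ m : ℕ, ∀ t ∈ Set.Icc (0 : ℝ) 1,
      ‖Complex.exp ((t : ℂ) * (x * Complex.I)) -
        ∑ j ∈ Finset.range m, ((t : ℂ) * (x * Complex.I)) ^ j / (j.factorial : ℂ)‖ ≤
      |x| ^ m * t ^ m / m.factorial by
    simpa using h m 1 (by simp)
  intro m
  induction m with
  | zero =>
    intro t _
    have : (t : ℂ) * (x * Complex.I) = ((t * x : ℝ) : ℂ) * Complex.I := by push_cast; ring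
    rw [this]
    simp [-Complex.ofReal_mul, Complex.norm_exp_ofReal_mul_I]
  | succ m ih =>
    set z : ℂ := x * Complex.I with hz
    have hzn : ‖z‖ = |x| := by simp [hz]
    have hder : ∀ t : ℝ, HasDerivAt (fun t : ℝ => Complex.exp ((t : ℂ) * z) -
        ∑ j ∈ Finset.range (m + 1), ((t : ℂ) * z) ^ j / (j.factorial : ℂ))
        (z * (Complex.exp ((t : ℂ) * z) -
          ∑ j ∈ Finset.range m, ((t : ℂ) * z) ^ j / (j.factorial : ℂ))) t := by
      intro t
      have h1 : HasDerivAt (fun t : ℝ => (t : ℂ) * z) z t := by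
        simpa using (Complex.ofRealCLM.hasDerivAt (x := t)).mul_const z
      have h2 : HasDerivAt (fun t : ℝ => ∑ j ∈ Finset.range (m + 1),
          ((t : ℂ) * z) ^ j / (j.factorial : ℂ))
          (∑ j ∈ Finset.range (m + 1), ((j : ℂ) * ((t : ℂ) * z) ^ (j - 1) * z) /
            (j.factorial : ℂ)) t := by
        apply HasDerivAt.fun_sum
        intro j _
        exact (h1.pow j).div_const _
      refine (h1.cexp.sub h2).congr_deriv ?_
      rw [Finset.sum_range_succ', mul_sub, Finset.mul_sum]
      simp only [Nat.cast_zero, zero_mul, zero_div, add_zero, Nat.add_sub_cancel]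
      congr 1
      · ring
      · apply Finset.sum_congr rfl
        intro j _
        rw [Nat.factorial_succ]
        have : (j.factorial : ℂ) ≠ 0 := by exact_mod_cast j.factorial_ne_zero
        have h3 : ((j : ℂ) + 1) ≠ 0 := by exact_mod_cast j.succ_ne_zero
        push_cast
        field_simp
    have hB : ∀ t : ℝ, HasDerivAt (fun t : ℝ => |x| ^ (m + 1) * t ^ (m + 1) / (m + 1).factorial)
        (|x| ^ (m + 1) * t ^ m / m.factorial) t := by
      intro t
      refine (((hasDerivAt_pow (m + 1) t).const_mul _).div_const _).congr_deriv ?_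
      rw [Nat.factorial_succ]
      have : (m.factorial : ℝ) ≠ 0 := by exact_mod_cast m.factorial_ne_zero
      push_cast
      field_simp
    intro t ht
    refine image_norm_le_of_norm_deriv_right_le_deriv_boundary (a := 0) (b := 1)
      (f' := fun t => (z * (Complex.exp ((t : ℂ) * z) -
          ∑ j ∈ Finset.range m, ((t : ℂ) * z) ^ j / (j.factorial : ℂ))))
      (B' := fun t => |x| ^ (m + 1) * t ^ m / m.factorial)
      (fun t _ => (hder t).continuousAt.continuousWithinAt)
      (fun t _ => (hder t).hasDerivWithinAt) ?_ hB ?_ ht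
    · simp [Finset.sum_range_succ']
    · intro t ht
      rw [norm_mul, hzn]
      calc _ ≤ |x| * (|x| ^ m * t ^ m / m.factorial) := by
            gcongr; exact ih t ⟨ht.1, ht.2.le⟩
        _ = _ := by ring

theorem sum_powerset_prod_mul_prod {R : Type*} [CommRing R] (P : Finset ℕ) (q f : ℕ → R) :
    ∑ A ∈ P.powerset, ((∏ p ∈ A, q p) * ∏ p ∈ P \ A, (1 - q p)) * ∏ p ∈ A, f p =
      ∏ p ∈ P, (1 + q p * (f p - 1)) := by
  have := Finset.prod_add (fun p => q p * f p) (fun p => 1 - q p) P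
  rw [show (∏ p ∈ P, (1 + q p * (f p - 1))) = ∏ p ∈ P, (q p * f p + (1 - q p)) from
    Finset.prod_congr rfl fun p _ => by ring, this]
  apply Finset.sum_congr rfl
  intro A _
  rw [Finset.prod_mul_distrib]
  ring

/-- The probability of the set `A` when each `p ∈ P` is included independently with
probability `1 / p`. -/
noncomputable def inclusionWeight (P A : Finset ℕ) : ℝ :=
  (∏ p ∈ A, 1 / (p : ℝ)) * ∏ p ∈ P \ A, (1 - 1 / (p : ℝ))

theorem inclusionWeight_nonneg (P A : Finset ℕ) : 0 ≤ inclusionWeight P A := by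
  apply mul_nonneg
  · exact Finset.prod_nonneg fun p _ => by positivity
  · refine Finset.prod_nonneg fun p _ => ?_
    rcases Nat.eq_zero_or_pos p with rfl | hp
    · simp
    · rw [sub_nonneg, div_le_one (by positivity)]
      exact_mod_cast hp

theorem sum_inclusionWeight_mul_prod (P : Finset ℕ) (f : ℕ → ℝ) :
    ∑ A ∈ P.powerset, inclusionWeight P A * ∏ p ∈ A, f p =
      ∏ p ∈ P, (1 + 1 / (p : ℝ) * (f p - 1)) :=
  sum_powerset_prod_mul_prod P (fun p => 1 / (p : ℝ)) f

theorem sum_inclusionWeight_mul_prod_complex (P : Finset ℕ) (f : ℕ → ℂ) :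
    ∑ A ∈ P.powerset, (inclusionWeight P A : ℂ) * ∏ p ∈ A, f p =
      ∏ p ∈ P, (1 + 1 / (p : ℂ) * (f p - 1)) := by
  rw [← sum_powerset_prod_mul_prod P (fun p => 1 / (p : ℂ)) f]
  simp [inclusionWeight]

theorem sum_inclusionWeight_superset {P T : Finset ℕ} (hT : T ⊆ P) :
    ∑ A ∈ P.powerset, inclusionWeight P A * (if T ⊆ A then 1 else 0) = ∏ p ∈ T, 1 / (p : ℝ) := by
  have h := Finset.prod_add (fun p : ℕ => 1 / (p : ℝ))
    (fun p : ℕ => if p ∈ T then 0 else 1 - 1 / (p : ℝ)) P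
  have h1 : ∏ p ∈ P, (1 / (p : ℝ) + if p ∈ T then 0 else 1 - 1 / (p : ℝ)) =
      ∏ p ∈ T, 1 / (p : ℝ) := by
    rw [← Finset.prod_subset hT]
    · exact Finset.prod_congr rfl fun p hp => by simp [hp]
    · intro p _ hp
      simp [hp]
  rw [← h1, h]
  apply Finset.sum_congr rfl
  intro A hA
  rw [Finset.mem_powerset] at hA
  split_ifs with hTA
  · rw [mul_one, inclusionWeight]
    congr 1
    apply Finset.prod_congr rfl
    intro p hp
    rw [Finset.mem_sdiff] at hp
    rw [if_neg fun h => hp.2 (hTA h)]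
  · obtain ⟨p, hpT, hpA⟩ := Finset.not_subset.1 hTA
    rw [Finset.prod_eq_zero (i := p) (s := P \ A) (Finset.mem_sdiff.2 ⟨hT hpT, hpA⟩) (by simp [hpT])]
    simp

/-- The centred sum `∑_{p ∈ A ∩ P} g p - ∑_{p ∈ P} g p / p`. -/
noncomputable def centredSum (P : Finset ℕ) (g : ℕ → ℝ) (A : Finset ℕ) : ℝ :=
  ∑ p ∈ P, (if p ∈ A then g p else 0) - ∑ p ∈ P, g p / p

theorem abs_map_ite_pow_le (D : (Finset ℕ → ℝ) →ₗ[ℝ] ℝ) (P : Finset ℕ) {η : ℝ}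
    (hD : ∀ T ⊆ P, |D (fun A => if T ⊆ A then 1 else 0)| ≤ η) (g : ℕ → ℝ) (μ : ℝ) (k : ℕ) :
    ∀ T ⊆ P, |D (fun A => if T ⊆ A then (∑ p ∈ P, (if p ∈ A then g p else 0) - μ) ^ k else 0)| ≤
      (∑ p ∈ P, |g p| + |μ|) ^ k * η := by
  induction k with
  | zero => simpa using hD
  | succ k ih =>
    intro T hT
    set F : Finset ℕ → Finset ℕ → ℝ := fun T A =>
      if T ⊆ A then (∑ p ∈ P, (if p ∈ A then g p else 0) - μ) ^ k else 0 with hF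
    have hsplit : (fun A => if T ⊆ A then
        (∑ p ∈ P, (if p ∈ A then g p else 0) - μ) ^ (k + 1) else 0) =
        ∑ p ∈ P, g p • F (insert p T) - μ • F T := by
      funext A
      simp only [Pi.sub_apply, Finset.sum_apply, Pi.smul_apply, smul_eq_mul, hF,
        Finset.insert_subset_iff]
      split_ifs with h
      · simp only [h, and_true]
        rw [pow_succ, mul_sub, Finset.mul_sum]
        congr 1
        · apply Finset.sum_congr rfl
          intro p _
          split_ifs <;> ring
        · ring
      · simp [h]
    rw [hsplit, map_sub, map_sum, map_smul]
    refine (abs_sub _ _).trans ?_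
    have h1 : |∑ p ∈ P, D (g p • F (insert p T))| ≤
        ∑ p ∈ P, |g p| * ((∑ p ∈ P, |g p| + |μ|) ^ k * η) := by
      refine (Finset.abs_sum_le_sum_abs _ _).trans (Finset.sum_le_sum fun p hp => ?_)
      rw [map_smul, smul_eq_mul, abs_mul]
      gcongr
      exact ih _ (Finset.insert_subset hp hT)
    have h2 : |μ • D (F T)| ≤ |μ| * ((∑ p ∈ P, |g p| + |μ|) ^ k * η) := by
      rw [smul_eq_mul, abs_mul]
      gcongr
      exact ih T hT
    calc _ ≤ _ := add_le_add h1 h2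
      _ = _ := by rw [← Finset.sum_mul]; ring

theorem sum_inclusionWeight_exp_le (P : Finset ℕ) (g : ℕ → ℝ) (hP : ∀ p ∈ P, p.Prime)
    (s : ℝ) (hs : ∀ p ∈ P, |s * g p| ≤ 1) :
    ∑ A ∈ P.powerset, inclusionWeight P A * Real.exp (s * centredSum P g A) ≤
      Real.exp (s ^ 2 * ∑ p ∈ P, g p ^ 2 / p) := by
  have h1 : ∀ A ∈ P.powerset, inclusionWeight P A * Real.exp (s * centredSum P g A) =
      Real.exp (-(s * ∑ p ∈ P, g p / p)) *
        (inclusionWeight P A * ∏ p ∈ A, Real.exp (s * g p)) := by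
    intro A hA
    rw [Finset.mem_powerset] at hA
    rw [← Real.exp_sum, centredSum, Finset.sum_ite_mem, Finset.inter_eq_right.2 hA, mul_sub,
      sub_eq_add_neg, Real.exp_add, Finset.mul_sum]
    ring
  rw [Finset.sum_congr rfl h1, ← Finset.mul_sum, sum_inclusionWeight_mul_prod]
  have h2 : ∏ p ∈ P, (1 + 1 / (p : ℝ) * (Real.exp (s * g p) - 1)) ≤
      ∏ p ∈ P, Real.exp (s * (g p / p) + s ^ 2 * (g p ^ 2 / p)) := by
    apply Finset.prod_le_prod
    · intro p hp
      have hp1 : (1 : ℝ) ≤ p := by exact_mod_cast (hP p hp).one_lt.le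
      have : 1 / (p : ℝ) ≤ 1 := by rw [div_le_one (by linarith)]; exact hp1
      have h3 := Real.exp_pos (s * g p)
      have h4 : 0 ≤ 1 / (p : ℝ) := by positivity
      nlinarith
    · intro p hp
      have h3 := Real.abs_exp_sub_one_sub_id_le (hs p hp)
      have h4 := (abs_le.1 h3).2
      have hp1 : (0 : ℝ) < p := by exact_mod_cast (hP p hp).pos
      refine le_trans ?_ (Real.add_one_le_exp _)
      have : 1 / (p : ℝ) * (Real.exp (s * g p) - 1) ≤ 1 / p * (s * g p + (s * g p) ^ 2) := by
        gcongr; linarith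
      calc _ ≤ 1 + 1 / p * (s * g p + (s * g p) ^ 2) := by linarith
        _ = _ := by ring
  calc _ ≤ Real.exp (-(s * ∑ p ∈ P, g p / p)) *
        ∏ p ∈ P, Real.exp (s * (g p / p) + s ^ 2 * (g p ^ 2 / p)) := by gcongr
    _ = _ := by
      rw [← Real.exp_sum, ← Real.exp_add, Finset.sum_add_distrib, ← Finset.mul_sum,
        ← Finset.mul_sum]
      congr 1
      ring

theorem sum_inclusionWeight_pow_le (P : Finset ℕ) (g : ℕ → ℝ) (hP : ∀ p ∈ P, p.Prime)
    (t : ℝ) (ht : ∀ p ∈ P, |2 * t * g p| ≤ 1) (m : ℕ) :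
    ∑ A ∈ P.powerset, inclusionWeight P A * (|t * centredSum P g A| ^ m / m.factorial) ≤
      (1 / 2) ^ m * (2 * Real.exp ((2 * t) ^ 2 * ∑ p ∈ P, g p ^ 2 / p)) := by
  have h1 := sum_inclusionWeight_exp_le P g hP (2 * t) ht
  have h2 := sum_inclusionWeight_exp_le P g hP (-(2 * t)) (by simpa using ht)
  rw [neg_sq] at h2
  calc _ ≤ ∑ A ∈ P.powerset, (1 / 2) ^ m * (inclusionWeight P A *
        Real.exp (2 * t * centredSum P g A) + inclusionWeight P A *
        Real.exp (-(2 * t) * centredSum P g A)) := by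
        apply Finset.sum_le_sum
        intro A _
        have hw := inclusionWeight_nonneg P A
        set X := centredSum P g A
        have h3 := Real.pow_div_factorial_le_exp |2 * t * X| (abs_nonneg _) m
        have h4 : Real.exp |2 * t * X| ≤ Real.exp (2 * t * X) + Real.exp (-(2 * t) * X) := by
          rcases abs_cases (2 * t * X) with h | h <;> rw [h.1]
          · linarith [Real.exp_pos (-(2 * t) * X)]
          · rw [show -(2 * t * X) = -(2 * t) * X by ring]
            linarith [Real.exp_pos (2 * t * X)]
        have h5 : |t * X| ^ m / m.factorial = (1 / 2) ^ m * (|2 * t * X| ^ m / m.factorial) := by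
          rw [mul_assoc 2 t X, abs_mul 2, mul_pow, ← mul_div_assoc, ← mul_assoc, ← mul_pow]
          norm_num
        rw [h5, ← mul_add, mul_left_comm]
        gcongr
        linarith
    _ ≤ _ := by
      rw [← Finset.mul_sum, Finset.sum_add_distrib]
      gcongr
      linarith

theorem norm_prod_sub_prod_le_sum {ι : Type*} (s : Finset ι) (a b : ι → ℂ)
    (ha : ∀ i ∈ s, ‖a i‖ ≤ 1) (hb : ∀ i ∈ s, ‖b i‖ ≤ 1) :
    ‖∏ i ∈ s, a i - ∏ i ∈ s, b i‖ ≤ ∑ i ∈ s, ‖a i - b i‖ := by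
  classical
  induction s using Finset.induction_on with
  | empty => simp
  | insert i s hi ih =>
    rw [Finset.prod_insert hi, Finset.prod_insert hi, Finset.sum_insert hi]
    have h1 : ‖∏ i ∈ s, b i‖ ≤ 1 := by
      rw [norm_prod]
      exact Finset.prod_le_one (fun _ _ => norm_nonneg _)
        fun j hj => hb j (Finset.mem_insert_of_mem hj)
    have h2 := ih (fun j hj => ha j (Finset.mem_insert_of_mem hj))
      (fun j hj => hb j (Finset.mem_insert_of_mem hj))
    have h3 := ha i (Finset.mem_insert_self i s)
    calc _ = ‖a i * (∏ i ∈ s, a i - ∏ i ∈ s, b i) + (a i - b i) * ∏ i ∈ s, b i‖ := by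
          congr 1; ring
      _ ≤ ‖a i‖ * ‖∏ i ∈ s, a i - ∏ i ∈ s, b i‖ + ‖a i - b i‖ * ‖∏ i ∈ s, b i‖ := by
          refine (norm_add_le _ _).trans ?_
          rw [norm_mul, norm_mul]
      _ ≤ 1 * ‖∏ i ∈ s, a i - ∏ i ∈ s, b i‖ + ‖a i - b i‖ * 1 := by gcongr
      _ ≤ _ := by linarith

theorem norm_one_add_exp_factor_sub_le {p : ℕ} (hp : p.Prime) {u : ℝ} (hu : |u| ≤ 1) :
    ‖(1 + 1 / (p : ℂ) * (Complex.exp (u * Complex.I) - 1)) * Complex.exp (-(u / p * Complex.I)) -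
      Complex.exp ((-(u ^ 2 / (2 * p)) : ℝ))‖ ≤ 4 * u ^ 2 / p ^ 2 + 2 * |u| ^ 3 / p := by
  have hp2 : (2 : ℝ) ≤ p := by exact_mod_cast hp.two_le
  have hpc : (p : ℂ) ≠ 0 := by exact_mod_cast hp.ne_zero
  have hpn : ‖(p : ℂ)‖ = p := by simp
  have huI : ‖(u : ℂ) * Complex.I‖ = |u| := by simp
  set e := Complex.exp (u * Complex.I) with he
  set w : ℂ := (e - 1) / p with hw
  set v : ℂ := (u : ℂ) / p * Complex.I with hv
  have hv1 : ‖Complex.exp (-v)‖ = 1 := by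
    have : -v = ((-(u / p) : ℝ) : ℂ) * Complex.I := by rw [hv]; push_cast; ring
    rw [this, Complex.norm_exp_ofReal_mul_I]
  have hwn : ‖w‖ ≤ 2 * |u| / p := by
    rw [hw, norm_div, hpn]
    gcongr
    rw [he, ← huI]
    exact Complex.norm_exp_sub_one_le (by rwa [huI])
  have hw1 : ‖w‖ ≤ 1 := by
    refine hwn.trans ?_
    rw [div_le_one (by linarith)]
    linarith
  have h1 : ‖1 + w - Complex.exp w‖ ≤ 4 * u ^ 2 / p ^ 2 := by
    have := Complex.norm_exp_sub_one_sub_id_le hw1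
    rw [norm_sub_rev, ← sub_sub]
    refine this.trans ?_
    calc ‖w‖ ^ 2 ≤ (2 * |u| / p) ^ 2 := by gcongr
      _ = _ := by rw [div_pow, mul_pow, sq_abs]; norm_num
  set z' : ℂ := ((-(u ^ 2 / (2 * p)) : ℝ) : ℂ) with hz'
  have h3 : ‖w - v - z'‖ ≤ |u| ^ 3 / p := by
    have hT := norm_exp_mul_I_sub_sum_le 3 u
    have e1 : w - v - z' = (e - ∑ j ∈ Finset.range 3,
        ((u : ℂ) * Complex.I) ^ j / (j.factorial : ℂ)) / p := by
      simp only [Finset.sum_range_succ, Finset.sum_range_zero, hw, hv, hz', mul_pow,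
        Complex.I_sq, Nat.factorial]
      push_cast
      field_simp
      ring
    rw [e1, norm_div, hpn]
    gcongr
    refine hT.trans ?_
    apply div_le_self (by positivity)
    norm_num [Nat.factorial]
  have h3' : ‖w - v - z'‖ ≤ 1 := by
    refine h3.trans ?_
    rw [div_le_one (by linarith)]
    have : |u| ^ 3 ≤ 1 := pow_le_one₀ (abs_nonneg _) hu
    linarith
  have hz1 : ‖Complex.exp z'‖ ≤ 1 := by
    rw [Complex.norm_exp, hz', Complex.ofReal_re]
    apply Real.exp_le_one_iff.2
    have : 0 ≤ u ^ 2 / (2 * p) := by positivity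
    linarith
  have h2 : ‖Complex.exp (w - v) - Complex.exp z'‖ ≤ 2 * (|u| ^ 3 / p) := by
    have e1 : Complex.exp (w - v) - Complex.exp z' =
        Complex.exp z' * (Complex.exp (w - v - z') - 1) := by
      rw [mul_sub, ← Complex.exp_add]; ring_nf
    rw [e1, norm_mul]
    calc _ ≤ 1 * (2 * ‖w - v - z'‖) := by
          gcongr
          exact Complex.norm_exp_sub_one_le h3'
      _ ≤ _ := by linarith
  have e0 : (1 + 1 / (p : ℂ) * (e - 1)) * Complex.exp (-v) - Complex.exp z' =
      Complex.exp (-v) * (1 + w - Complex.exp w) + (Complex.exp (w - v) - Complex.exp z') := by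
    rw [sub_eq_add_neg w v, Complex.exp_add, hw]
    ring
  rw [e0]
  refine (norm_add_le _ _).trans ?_
  rw [norm_mul, hv1, one_mul]
  calc _ ≤ _ := add_le_add h1 h2
    _ = _ := by ring

/-- The characteristic function of the centred sum in the independent model is close to that of
a Gaussian. -/
theorem norm_sum_inclusionWeight_cexp_sub_le (P : Finset ℕ) (g : ℕ → ℝ)
    (hP : ∀ p ∈ P, p.Prime) (t : ℝ) {ε : ℝ} (hε : ε ≤ 1) (ht : ∀ p ∈ P, |t * g p| ≤ ε) :
    ‖∑ A ∈ P.powerset, (inclusionWeight P A : ℂ) *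
        Complex.exp ((t * centredSum P g A : ℝ) * Complex.I) -
      Complex.exp ((-(t ^ 2 / 2 * ∑ p ∈ P, g p ^ 2 / p) : ℝ))‖ ≤
      4 * ε ^ 2 * ∑' n : ℕ, 1 / (n : ℝ) ^ 2 + 2 * ε * (t ^ 2 * ∑ p ∈ P, g p ^ 2 / p) := by
  have h1 : ∀ A ∈ P.powerset, (inclusionWeight P A : ℂ) *
      Complex.exp ((t * centredSum P g A : ℝ) * Complex.I) =
        (∏ p ∈ P, Complex.exp (-((t * g p : ℝ) / p * Complex.I))) *
        ((inclusionWeight P A : ℂ) * ∏ p ∈ A, Complex.exp ((t * g p : ℝ) * Complex.I)) := by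
    intro A hA
    rw [Finset.mem_powerset] at hA
    rw [← Complex.exp_sum, ← Complex.exp_sum, centredSum, Finset.sum_ite_mem,
      Finset.inter_eq_right.2 hA, mul_left_comm, ← Complex.exp_add]
    congr 2
    push_cast
    rw [Finset.sum_neg_distrib, ← Finset.sum_mul, ← Finset.sum_mul, mul_sub, Finset.mul_sum,
      Finset.mul_sum, Finset.sum_congr rfl fun p _ => mul_div_assoc (t : ℂ) (g p : ℂ) (p : ℂ)]
    ring
  rw [Finset.sum_congr rfl h1, ← Finset.mul_sum, sum_inclusionWeight_mul_prod_complex,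
    ← Finset.prod_mul_distrib]
  have h2 : Complex.exp ((-(t ^ 2 / 2 * ∑ p ∈ P, g p ^ 2 / p) : ℝ)) =
      ∏ p ∈ P, Complex.exp ((-((t * g p) ^ 2 / (2 * p)) : ℝ)) := by
    rw [← Complex.exp_sum, ← Complex.ofReal_sum, Finset.sum_neg_distrib, Finset.mul_sum]
    congr 2
    refine congrArg Neg.neg (Finset.sum_congr rfl fun p _ => ?_)
    ring
  rw [h2]
  refine (norm_prod_sub_prod_le_sum P _ _ ?_ ?_).trans ?_
  · intro p hp
    have hp1 : (1 : ℝ) ≤ p := by exact_mod_cast (hP p hp).one_lt.le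
    have e1 : -(((t * g p : ℝ) : ℂ) / p * Complex.I) =
        ((-(t * g p / p) : ℝ) : ℂ) * Complex.I := by push_cast; ring
    rw [norm_mul, e1, Complex.norm_exp_ofReal_mul_I, one_mul]
    have h3 : 1 / (p : ℝ) ≤ 1 := by rw [div_le_one (by linarith)]; exact hp1
    have e2 : 1 + 1 / (p : ℂ) * (Complex.exp ((t * g p : ℝ) * Complex.I) - 1) =
        ((1 - 1 / (p : ℝ) : ℝ) : ℂ) + ((1 / (p : ℝ) : ℝ) : ℂ) *
          Complex.exp ((t * g p : ℝ) * Complex.I) := by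
      push_cast; ring
    rw [e2]
    refine (norm_add_le _ _).trans ?_
    rw [norm_mul, Complex.norm_exp_ofReal_mul_I, Complex.norm_real, Complex.norm_real,
      Real.norm_of_nonneg (by linarith), Real.norm_of_nonneg (by positivity)]
    linarith
  · intro p hp
    rw [Complex.norm_exp, Complex.ofReal_re]
    apply Real.exp_le_one_iff.2
    have : 0 ≤ (t * g p) ^ 2 / (2 * p) := by positivity
    linarith
  calc _ ≤ ∑ p ∈ P, (4 * ε ^ 2 * (1 / (p : ℝ) ^ 2) + 2 * ε * (t ^ 2 * (g p ^ 2 / p))) := by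
        apply Finset.sum_le_sum
        intro p hp
        rw [mul_comm (Complex.exp _)]
        refine (norm_one_add_exp_factor_sub_le (hP p hp) ((ht p hp).trans hε)).trans ?_
        have h4 : (t * g p) ^ 2 ≤ ε ^ 2 := by rw [← sq_abs]; gcongr; exact ht p hp
        have h5 : |t * g p| ^ 3 ≤ ε * (t * g p) ^ 2 := by
          rw [pow_succ, sq_abs, mul_comm]; gcongr; exact ht p hp
        calc _ ≤ 4 * ε ^ 2 / (p : ℝ) ^ 2 + 2 * (ε * (t * g p) ^ 2) / p := by gcongr
          _ = _ := by ring
    _ ≤ _ := by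
        rw [Finset.sum_add_distrib, ← Finset.mul_sum, ← Finset.mul_sum, ← Finset.mul_sum]
        gcongr
        exact Summable.sum_le_tsum (f := fun n : ℕ => 1 / (n : ℝ) ^ 2) P (fun n _ => by positivity)
          (Real.summable_one_div_nat_pow.2 (by norm_num))

/-- Comparison of the characteristic function of an empirical average with that of the
independent model. -/
theorem norm_average_cexp_sub_le (P Ω : Finset ℕ) (S : ℕ → Finset ℕ) (g : ℕ → ℝ)
    (hP : ∀ p ∈ P, p.Prime) {η : ℝ}
    (hη : ∀ T ⊆ P, |1 / (Ω.card : ℝ) * (∑ n ∈ Ω, if T ⊆ S n then (1 : ℝ) else 0) -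
      ∏ p ∈ T, 1 / (p : ℝ)| ≤ η) (t : ℝ) (ht : ∀ p ∈ P, |2 * t * g p| ≤ 1) {m : ℕ}
    (hm : Even m) :
    ‖1 / (Ω.card : ℂ) * ∑ n ∈ Ω, Complex.exp ((t * centredSum P g (S n) : ℝ) * Complex.I) -
      ∑ A ∈ P.powerset, (inclusionWeight P A : ℂ) *
        Complex.exp ((t * centredSum P g A : ℝ) * Complex.I)‖ ≤
      ∑ j ∈ Finset.range (m + 1), |t| ^ j / j.factorial * ((2 * ∑ p ∈ P, |g p|) ^ j * η) +
        4 * ((1 / 2) ^ m * Real.exp ((2 * t) ^ 2 * ∑ p ∈ P, g p ^ 2 / p)) := by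
  set D : (Finset ℕ → ℝ) →ₗ[ℝ] ℝ := (1 / (Ω.card : ℝ)) • ∑ n ∈ Ω, LinearMap.proj (S n) -
    ∑ A ∈ P.powerset, inclusionWeight P A • LinearMap.proj A with hD
  have hDa : ∀ F, D F = 1 / (Ω.card : ℝ) * ∑ n ∈ Ω, F (S n) -
      ∑ A ∈ P.powerset, inclusionWeight P A * F A := by
    intro F
    simp [hD, LinearMap.sub_apply]
  have hη' : ∀ T ⊆ P, |D (fun A => if T ⊆ A then 1 else 0)| ≤ η := by
    intro T hT
    rw [hDa, sum_inclusionWeight_superset hT]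
    exact hη T hT
  have hη0 : 0 ≤ η := (abs_nonneg _).trans (hη ∅ (Finset.empty_subset _))
  have hmom : ∀ j, |D (fun A => centredSum P g A ^ j)| ≤ (2 * ∑ p ∈ P, |g p|) ^ j * η := by
    intro j
    have := abs_map_ite_pow_le D P hη' g (∑ p ∈ P, g p / p) j ∅ (Finset.empty_subset _)
    simp only [Finset.empty_subset, if_true] at this
    refine this.trans ?_
    gcongr
    have h1 : |∑ p ∈ P, g p / p| ≤ ∑ p ∈ P, |g p| := by
      refine (Finset.abs_sum_le_sum_abs _ _).trans (Finset.sum_le_sum fun p hp => ?_)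
      rw [abs_div, Nat.abs_cast]
      exact div_le_self (abs_nonneg _) (by exact_mod_cast (hP p hp).one_lt.le)
    linarith
  set X : Finset ℕ → ℝ := centredSum P g with hX
  set R : Finset ℕ → ℂ := fun A => Complex.exp ((t * X A : ℝ) * Complex.I) -
    ∑ j ∈ Finset.range m, (((t * X A : ℝ) : ℂ) * Complex.I) ^ j / (j.factorial : ℂ) with hR
  have hRn : ∀ A, ‖R A‖ ≤ |t| ^ m / m.factorial * X A ^ m := by
    intro A
    refine (norm_exp_mul_I_sub_sum_le m (t * X A)).trans (le_of_eq ?_)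
    rw [abs_mul, mul_pow, hm.pow_abs (X A)]
    ring
  have hsplit : ∀ A, Complex.exp ((t * X A : ℝ) * Complex.I) =
      ∑ j ∈ Finset.range m, ((t : ℂ) * Complex.I) ^ j / (j.factorial : ℂ) *
        ((X A ^ j : ℝ) : ℂ) + R A := by
    intro A
    rw [hR]
    simp only
    rw [add_comm, sub_add_eq_add_sub, eq_comm, sub_eq_iff_eq_add]
    congr 1
    apply Finset.sum_congr rfl
    intro j _
    push_cast
    ring
  have hwt : ∀ A, 0 ≤ inclusionWeight P A := inclusionWeight_nonneg P
  have e1 : 1 / (Ω.card : ℂ) * ∑ n ∈ Ω, Complex.exp ((t * X (S n) : ℝ) * Complex.I) -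
      ∑ A ∈ P.powerset, (inclusionWeight P A : ℂ) * Complex.exp ((t * X A : ℝ) * Complex.I) =
      ∑ j ∈ Finset.range m, ((t : ℂ) * Complex.I) ^ j / (j.factorial : ℂ) *
        ((D (fun A => X A ^ j) : ℝ) : ℂ) +
      (1 / (Ω.card : ℂ) * ∑ n ∈ Ω, R (S n) -
        ∑ A ∈ P.powerset, (inclusionWeight P A : ℂ) * R A) := by
    simp only [hsplit, hDa]
    push_cast
    simp only [Finset.sum_add_distrib, mul_add, mul_sub, Finset.sum_sub_distrib, Finset.mul_sum]
    rw [Finset.sum_comm (s := Ω), Finset.sum_comm (s := P.powerset)]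
    have c1 : ∀ j, ∀ n, 1 / (Ω.card : ℂ) * (((t : ℂ) * Complex.I) ^ j / (j.factorial : ℂ) *
        (X (S n) : ℂ) ^ j) = ((t : ℂ) * Complex.I) ^ j / (j.factorial : ℂ) *
        (1 / (Ω.card : ℂ) * (X (S n) : ℂ) ^ j) := fun j n => by ring
    have c2 : ∀ j, ∀ A, (inclusionWeight P A : ℂ) * (((t : ℂ) * Complex.I) ^ j /
        (j.factorial : ℂ) * (X A : ℂ) ^ j) = ((t : ℂ) * Complex.I) ^ j / (j.factorial : ℂ) *
        ((inclusionWeight P A : ℂ) * (X A : ℂ) ^ j) := fun j n => by ring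
    simp only [c1, c2]
    ring
  set q := ∑ A ∈ P.powerset, inclusionWeight P A * X A ^ m with hq
  have hq2 : |t| ^ m / m.factorial * q ≤
      (1 / 2) ^ m * (2 * Real.exp ((2 * t) ^ 2 * ∑ p ∈ P, g p ^ 2 / p)) := by
    refine le_trans (le_of_eq ?_) (sum_inclusionWeight_pow_le P g hP t ht m)
    rw [hq, Finset.mul_sum]
    apply Finset.sum_congr rfl
    intro A _
    rw [abs_mul, mul_pow, hm.pow_abs (centredSum P g A)]
    ring
  have e2 : ‖1 / (Ω.card : ℂ) * ∑ n ∈ Ω, R (S n) -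
        ∑ A ∈ P.powerset, (inclusionWeight P A : ℂ) * R A‖ ≤
      |t| ^ m / m.factorial * (D (fun A => X A ^ m) + 2 * q) := by
    have b1 : ‖1 / (Ω.card : ℂ) * ∑ n ∈ Ω, R (S n)‖ ≤
        |t| ^ m / m.factorial * (1 / (Ω.card : ℝ) * ∑ n ∈ Ω, X (S n) ^ m) := by
      rw [norm_mul]
      have : ‖1 / (Ω.card : ℂ)‖ = 1 / (Ω.card : ℝ) := by
        rw [norm_div, norm_one, Complex.norm_natCast]
      rw [this]
      have h4 : ‖∑ n ∈ Ω, R (S n)‖ ≤ ∑ n ∈ Ω, |t| ^ m / m.factorial * X (S n) ^ m :=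
        (norm_sum_le _ _).trans (Finset.sum_le_sum fun n _ => hRn _)
      rw [← Finset.mul_sum] at h4
      calc _ ≤ 1 / (Ω.card : ℝ) * (|t| ^ m / m.factorial * ∑ n ∈ Ω, X (S n) ^ m) := 
            mul_le_mul_of_nonneg_left h4 (one_div_nonneg.2 (Nat.cast_nonneg _))
        _ = _ := by ring
    have b2 : ‖∑ A ∈ P.powerset, (inclusionWeight P A : ℂ) * R A‖ ≤
        |t| ^ m / m.factorial * q := by
      refine (norm_sum_le _ _).trans ?_
      rw [hq, Finset.mul_sum]
      apply Finset.sum_le_sum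
      intro A _
      rw [norm_mul, Complex.norm_real, Real.norm_of_nonneg (hwt A), mul_left_comm]
      gcongr
      · exact hwt A
      · exact hRn A
    refine (norm_sub_le _ _).trans ((add_le_add b1 b2).trans (le_of_eq ?_))
    rw [hDa]
    ring
  rw [e1]
  refine (norm_add_le _ _).trans ?_
  rw [Finset.sum_range_succ]
  have h6 : ‖∑ j ∈ Finset.range m, ((t : ℂ) * Complex.I) ^ j / (j.factorial : ℂ) *
        ((D (fun A => X A ^ j) : ℝ) : ℂ)‖ ≤
      ∑ j ∈ Finset.range m, |t| ^ j / j.factorial * ((2 * ∑ p ∈ P, |g p|) ^ j * η) := by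
    refine (norm_sum_le _ _).trans (Finset.sum_le_sum fun j _ => ?_)
    rw [norm_mul, norm_div, norm_pow, norm_mul, Complex.norm_I, mul_one, Complex.norm_real,
      Complex.norm_real, Complex.norm_natCast, Real.norm_eq_abs, Real.norm_eq_abs]
    gcongr
    exact hmom j
  have h7 : |t| ^ m / m.factorial * (D (fun A => X A ^ m) + 2 * q) ≤
      |t| ^ m / m.factorial * ((2 * ∑ p ∈ P, |g p|) ^ m * η) +
        4 * ((1 / 2) ^ m * Real.exp ((2 * t) ^ 2 * ∑ p ∈ P, g p ^ 2 / p)) := by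
    rw [mul_add]
    have := (le_abs_self _).trans (hmom m)
    have h8 : |t| ^ m / m.factorial * D (fun A => X A ^ m) ≤
        |t| ^ m / m.factorial * ((2 * ∑ p ∈ P, |g p|) ^ m * η) := by gcongr
    linarith
  linarith

/-- Lévy's continuity theorem for uniform distributions on finite sets. -/
theorem tendsto_card_filter_div_of_tendsto_charFun (Ω : ℕ → Finset ℕ) (X : ℕ → ℕ → ℝ)
    (hΩ : ∀ᶠ N in atTop, (Ω N).Nonempty)
    (h : ∀ t : ℝ, Tendsto (fun N => 1 / ((Ω N).card : ℂ) *
      ∑ n ∈ Ω N, Complex.exp ((t * X N n : ℝ) * Complex.I)) atTop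
      (𝓝 (Complex.exp ((-(t ^ 2 / 2) : ℝ))))) (w : ℝ) :
    Tendsto (fun N => (((Ω N).filter (fun n => w ≤ X N n)).card : ℝ) / (Ω N).card) atTop
      (𝓝 (∫ u in Set.Ioi w, Real.exp (-u ^ 2 / 2) / Real.sqrt (2 * Real.pi))) := by
  classical
  open MeasureTheory ProbabilityTheory in
  set ν : ℕ → Measure ℝ := fun N => if (Ω N).Nonempty then
    ENNReal.ofReal (1 / (Ω N).card) • ∑ n ∈ Ω N, Measure.dirac (X N n) else Measure.dirac 0 with hν
  have hνprob : ∀ N, IsProbabilityMeasure (ν N) := by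
    intro N
    rw [hν]
    by_cases hN : (Ω N).Nonempty
    · simp only [hN, if_true]
      constructor
      have hc : (0 : ℝ) < (Ω N).card := by exact_mod_cast hN.card_pos
      rw [Measure.smul_apply, Measure.finsetSum_apply]
      simp only [measure_univ, Finset.sum_const, smul_eq_mul, nsmul_eq_mul, mul_one]
      rw [← ENNReal.ofReal_natCast, ← ENNReal.ofReal_mul (by positivity), one_div_mul_cancel hc.ne',
        ENNReal.ofReal_one]
    · simp only [hN, if_false]
      infer_instance
  set μs : ℕ → ProbabilityMeasure ℝ := fun N => ⟨ν N, hνprob N⟩ with hμs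
  set γ : ProbabilityMeasure ℝ := ⟨gaussianReal 0 1, inferInstance⟩ with hγ
  have hlim : Tendsto μs atTop (𝓝 γ) := by
    rw [ProbabilityMeasure.tendsto_iff_tendsto_charFun]
    intro t
    have e : charFun (γ : Measure ℝ) t = Complex.exp ((-(t ^ 2 / 2) : ℝ)) := by
      rw [hγ, ProbabilityMeasure.coe_mk, charFun_gaussianReal]
      congr 1
      push_cast
      simp
    rw [e]
    refine (h t).congr' ?_
    filter_upwards [hΩ] with N hN
    rw [hμs]
    simp only [ProbabilityMeasure.coe_mk]
    rw [hν, charFun_apply_real]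
    simp only [hN, if_true]
    rw [integral_smul_measure, integral_finsetSum_measure]
    · rw [ENNReal.toReal_ofReal (by positivity)]
      simp only [integral_dirac, Complex.real_smul]
      push_cast
      rfl
    · intro n _
      exact integrable_dirac (by simp [enorm_lt_top])
  have hport := ProbabilityMeasure.tendsto_measure_of_null_frontier_of_tendsto' hlim
    (E := Set.Ici w) (by
      rw [frontier_Ici, hγ, ProbabilityMeasure.coe_mk]
      exact (nullSingletonClass_gaussianReal one_ne_zero).measure_singleton w)
  have hreal := (ENNReal.tendsto_toReal (measure_ne_top (γ : Measure ℝ) (Set.Ici w))).comp hport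
  have eγ : ((γ : Measure ℝ) (Set.Ici w)).toReal =
      ∫ u in Set.Ioi w, Real.exp (-u ^ 2 / 2) / Real.sqrt (2 * Real.pi) := by
    rw [hγ, ProbabilityMeasure.coe_mk, gaussianReal_apply_eq_integral 0 one_ne_zero,
      ENNReal.toReal_ofReal (integral_nonneg fun u => gaussianPDFReal_nonneg _ _ _),
      integral_Ici_eq_integral_Ioi]
    congr 1
    funext u
    rw [gaussianPDFReal]
    simp only [NNReal.coe_one, mul_one, sub_zero]
    exact (div_eq_inv_mul _ _).symm
  rw [← eγ]
  refine hreal.congr' ?_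
  filter_upwards [hΩ] with N hN
  simp only [Function.comp, hμs, ProbabilityMeasure.coe_mk, hν, hN, if_true]
  rw [Measure.smul_apply, Measure.finsetSum_apply, smul_eq_mul, ENNReal.toReal_mul,
    ENNReal.toReal_ofReal (by positivity), ENNReal.toReal_sum (fun n _ => measure_ne_top _ _),
    Finset.card_filter, div_mul_eq_mul_div, one_mul]
  congr 1
  push_cast
  apply Finset.sum_congr rfl
  intro n _
  rw [Measure.dirac_apply' _ measurableSet_Ici, Set.indicator_apply]
  split_ifs with h1 h2 h2 <;> simp_all

theorem card_filter_periodic_bounds (Q : ℕ) (hQ : 0 < Q) (W : ℕ → Prop) [DecidablePred W]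
    (hW : Function.Periodic W Q) (X : ℕ) :
    |(((Finset.Icc 1 X).filter W).card : ℝ) - (Q.count W : ℝ) * X / Q| ≤ Q := by
  have hmul : ∀ k : ℕ, ((Finset.Ico 1 (1 + k * Q)).filter W).card = k * Q.count W := by
    intro k
    induction k with
    | zero => simp
    | succ k ih =>
      have hd : Finset.Ico 1 (1 + (k + 1) * Q) =
          Finset.Ico 1 (1 + k * Q) ∪ Finset.Ico (1 + k * Q) (1 + k * Q + Q) := by
        rw [Finset.Ico_union_Ico_eq_Ico (by omega) (by omega)]
        congr 1; ring
      rw [hd, Finset.filter_union, Finset.card_union_of_disjoint, ih,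
        Nat.filter_Ico_card_eq_of_periodic _ _ _ hW]
      · ring
      · exact Finset.disjoint_filter_filter (Finset.Ico_disjoint_Ico_consecutive _ _ _)
  have hcQ : Q.count W ≤ Q := Nat.count_le W
  have hdm := Nat.div_add_mod X Q
  have hr := Nat.mod_lt X hQ
  set k := X / Q
  have h1 : k * Q.count W ≤ ((Finset.Icc 1 X).filter W).card := by
    rw [← hmul k]
    apply Finset.card_le_card
    apply Finset.filter_subset_filter
    intro n hn
    simp only [Finset.mem_Ico, Finset.mem_Icc] at *
    have : Q * k = k * Q := mul_comm _ _
    omega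
  have h2 : ((Finset.Icc 1 X).filter W).card ≤ (k + 1) * Q.count W := by
    rw [← hmul (k + 1)]
    apply Finset.card_le_card
    apply Finset.filter_subset_filter
    intro n hn
    simp only [Finset.mem_Ico, Finset.mem_Icc] at *
    have : (k + 1) * Q = Q * k + Q := by ring
    omega
  have hQ' : (0 : ℝ) < Q := by exact_mod_cast hQ
  have h1' : (k : ℝ) * Q.count W ≤ ((Finset.Icc 1 X).filter W).card := by exact_mod_cast h1
  have h2' : (((Finset.Icc 1 X).filter W).card : ℝ) ≤ (k + 1) * Q.count W := by exact_mod_cast h2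
  have hc' : (Q.count W : ℝ) ≤ Q := by exact_mod_cast hcQ
  have hc0 : (0 : ℝ) ≤ Q.count W := by positivity
  have hX1 : (k : ℝ) ≤ (X : ℝ) / Q := by
    rw [le_div_iff₀ hQ']
    have : k * Q ≤ X := by rw [mul_comm]; omega
    exact_mod_cast this
  have hX2 : (X : ℝ) / Q ≤ k + 1 := by
    rw [div_le_iff₀ hQ']
    have : X ≤ (k + 1) * Q := by
      have : (k + 1) * Q = Q * k + Q := by ring
      omega
    exact_mod_cast this
  rw [mul_div_assoc, abs_le]
  constructor <;> nlinarith

theorem count_periodic_mul_left (Q : ℕ) (W : ℕ → Prop) [DecidablePred W]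
    (hW : Function.Periodic W Q) {d : ℕ} (hd : d.Coprime Q) :
    Q.count (fun m => W (d * m)) = Q.count W := by
  rcases Nat.eq_zero_or_pos Q with rfl | hQ
  · simp
  rw [Nat.count_eq_card_filter_range, Nat.count_eq_card_filter_range]
  have hinj : Set.InjOn (fun m => d * m % Q) (Finset.range Q : Set ℕ) := by
    intro m hm m' hm' h
    have h2 : m ≡ m' [MOD Q] := Nat.ModEq.cancel_left_of_coprime (by rwa [Nat.gcd_comm]) h
    have hm1 : m < Q := by simpa using hm
    have hm2 : m' < Q := by simpa using hm'
    exact Nat.ModEq.eq_of_lt_of_lt h2 hm1 hm2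
  have himg : (Finset.range Q).image (fun m => d * m % Q) = Finset.range Q := by
    apply Finset.eq_of_subset_of_card_le
    · intro x hx
      obtain ⟨m, _, rfl⟩ := Finset.mem_image.1 hx
      exact Finset.mem_range.2 (Nat.mod_lt _ hQ)
    · rw [Finset.card_image_of_injOn hinj]
  conv_rhs => rw [← himg, Finset.filter_image]
  rw [Finset.card_image_of_injOn]
  · congr 1
    apply Finset.filter_congr
    intro m _
    rw [hW.map_mod_nat]
  · intro m hm m' hm'
    simp only [Finset.coe_filter, Set.mem_ofPred_eq] at hm hm'
    exact hinj (by simpa using hm.1) (by simpa using hm'.1)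

/-- The density of the multiples of `d` in a periodic set of period coprime to `d`. -/
theorem abs_card_filter_dvd_sub_le (Q : ℕ) (hQ : 0 < Q) (W : ℕ → Prop) [DecidablePred W]
    (hW : Function.Periodic W Q) {d : ℕ} (hd : d.Coprime Q) (hd0 : 0 < d) (N : ℕ) :
    |(((Finset.Icc 1 N).filter (fun n => W n ∧ d ∣ n)).card : ℝ) -
      (((Finset.Icc 1 N).filter W).card : ℝ) / d| ≤ 3 * Q := by
  have hper : Function.Periodic (fun m => W (d * m)) Q := by
    intro m
    simp only
    rw [mul_add]
    exact hW.nat_mul d (d * m)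
  have hcard : ((Finset.Icc 1 N).filter (fun n => W n ∧ d ∣ n)).card =
      ((Finset.Icc 1 (N / d)).filter (fun m => W (d * m))).card := by
    symm
    apply Finset.card_bij (fun m _ => d * m)
    · intro m hm
      simp only [Finset.mem_filter, Finset.mem_Icc] at hm ⊢
      refine ⟨⟨by nlinarith, ?_⟩, hm.2, dvd_mul_right _ _⟩
      rw [mul_comm]
      exact (Nat.le_div_iff_mul_le hd0).1 hm.1.2
    · intro m _ m' _ h
      exact Nat.eq_of_mul_eq_mul_left hd0 h
    · intro n hn
      simp only [Finset.mem_filter, Finset.mem_Icc] at hn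
      obtain ⟨m, rfl⟩ := hn.2.2
      refine ⟨m, ?_, rfl⟩
      simp only [Finset.mem_filter, Finset.mem_Icc]
      refine ⟨⟨Nat.pos_of_ne_zero (by rintro rfl; omega), ?_⟩, hn.2.1⟩
      rw [Nat.le_div_iff_mul_le hd0, mul_comm]
      exact hn.1.2
  have h1 := card_filter_periodic_bounds Q hQ _ hper (N / d)
  have h2 := card_filter_periodic_bounds Q hQ W hW N
  rw [count_periodic_mul_left Q W hW hd] at h1
  rw [hcard]
  have hQ' : (0 : ℝ) < Q := by exact_mod_cast hQ
  have hd' : (1 : ℝ) ≤ d := by exact_mod_cast hd0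
  have hc' : (Q.count W : ℝ) ≤ Q := by exact_mod_cast (Nat.count_le W : Q.count W ≤ Q)
  have hfl : |((N / d : ℕ) : ℝ) - (N : ℝ) / d| ≤ 1 := by
    have a1 := Nat.lt_floor_add_one ((N : ℝ) / d)
    have a2 := Nat.floor_le (show 0 ≤ (N : ℝ) / d by positivity)
    rw [Nat.floor_div_eq_div] at a1 a2
    rw [abs_le]; constructor <;> linarith
  have h3 : |(Q.count W : ℝ) * (N / d : ℕ) / Q - (Q.count W : ℝ) * N / Q / d| ≤ 1 := by
    have e : (Q.count W : ℝ) * (N / d : ℕ) / Q - (Q.count W : ℝ) * N / Q / d =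
        (Q.count W : ℝ) / Q * (((N / d : ℕ) : ℝ) - (N : ℝ) / d) := by ring
    rw [e, abs_mul, abs_of_nonneg (by positivity)]
    have : (Q.count W : ℝ) / Q ≤ 1 := by rwa [div_le_one hQ']
    calc _ ≤ (1 : ℝ) * 1 := by gcongr
      _ = 1 := one_mul 1
  have h4 : |(((Finset.Icc 1 N).filter W).card : ℝ) / d - (Q.count W : ℝ) * N / Q / d| ≤ Q := by
    rw [← sub_div, abs_div, Nat.abs_cast]
    exact (div_le_self (abs_nonneg _) hd').trans h2
  have hQ1 : (1 : ℝ) ≤ Q := by exact_mod_cast hQ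
  rw [abs_le] at *
  constructor <;> linarith [h1.1, h1.2, h3.1, h3.2, h4.1, h4.2]

theorem prod_primes_dvd_iff {T : Finset ℕ} (hT : ∀ p ∈ T, p.Prime) (n : ℕ) :
    ∏ p ∈ T, p ∣ n ↔ ∀ p ∈ T, p ∣ n :=
  ⟨fun h _ hp => (Finset.dvd_prod_of_mem _ hp).trans h,
    fun h => Finset.prod_primes_dvd n (fun p hp => (hT p hp).prime) h⟩

/-- A Turán–Kubilius type central limit theorem for strongly additive functions on a periodic
set of integers. -/
theorem tendsto_card_filter_centredSum (Q : ℕ) (hQ : 0 < Q) (W : ℕ → Prop) [DecidablePred W]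
    (hW : Function.Periodic W Q) (hW1 : ∃ r, W r) (P : ℕ → Finset ℕ) (g : ℕ → ℕ → ℝ)
    (hP : ∀ N, ∀ p ∈ P N, p.Prime ∧ p.Coprime Q)
    (hB : ∀ k : ℕ, Tendsto (fun N : ℕ => (∑ p ∈ P N, |g N p|) ^ k / N) atTop (𝓝 0))
    (hsmall : ∀ ε : ℝ, 0 < ε → ∀ᶠ N in atTop, ∀ p ∈ P N, |g N p| ≤ ε)
    (hvar : Tendsto (fun N => ∑ p ∈ P N, g N p ^ 2 / p) atTop (𝓝 1)) (w : ℝ) :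
    Tendsto (fun N : ℕ => (((Finset.Icc 1 N).filter (fun n => W n ∧
        w ≤ centredSum (P N) (g N) ((P N).filter (· ∣ n)))).card : ℝ) /
        ((Finset.Icc 1 N).filter W).card) atTop
      (𝓝 (∫ u in Set.Ioi w, Real.exp (-u ^ 2 / 2) / Real.sqrt (2 * Real.pi))) := by
  classical
  set Ω : ℕ → Finset ℕ := fun N => (Finset.Icc 1 N).filter W with hΩ
  have hQ' : (0 : ℝ) < Q := by exact_mod_cast hQ
  have hcpos : 0 < Q.count W := by
    obtain ⟨r, hr⟩ := hW1
    rw [Nat.count_eq_card_filter_range, Finset.card_pos]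
    refine ⟨r % Q, ?_⟩
    rw [Finset.mem_filter, Finset.mem_range, hW.map_mod_nat]
    exact ⟨Nat.mod_lt _ hQ, hr⟩
  set ρ : ℝ := (Q.count W : ℝ) / Q with hρ
  have hρ0 : 0 < ρ := by have : (0 : ℝ) < Q.count W := by exact_mod_cast hcpos
                         positivity
  have hΩlow : ∀ᶠ N : ℕ in atTop, ρ / 2 * N ≤ (Ω N).card := by
    filter_upwards [(tendsto_natCast_atTop_atTop (R := ℝ)).eventually_ge_atTop (2 * Q / ρ)] with N hN
    have h1 := (abs_le.1 (card_filter_periodic_bounds Q hQ W hW N)).1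
    rw [div_le_iff₀ hρ0] at hN
    have e : (Q.count W : ℝ) * N / Q = ρ * N := by rw [hρ]; ring
    rw [e] at h1
    simp only [hΩ]
    linarith
  have hΩne : ∀ᶠ N in atTop, (Ω N).Nonempty := by
    filter_upwards [hΩlow, eventually_gt_atTop 0] with N hN hN0
    rw [← Finset.card_pos]
    have : (0 : ℝ) < N := by exact_mod_cast hN0
    have : (0 : ℝ) < (Ω N).card := lt_of_lt_of_le (by positivity) hN
    exact_mod_cast this
  have main := tendsto_card_filter_div_of_tendsto_charFun Ω
    (fun N n => centredSum (P N) (g N) ((P N).filter (· ∣ n))) hΩne ?_ w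
  · refine main.congr fun N => ?_
    simp only [hΩ, Finset.filter_filter]
  intro t
  have hηbound : ∀ N, (Ω N).Nonempty → ∀ T ⊆ P N,
      |1 / ((Ω N).card : ℝ) * (∑ n ∈ Ω N, if T ⊆ (P N).filter (· ∣ n) then (1 : ℝ) else 0) -
        ∏ p ∈ T, 1 / (p : ℝ)| ≤ 3 * Q / (Ω N).card := by
    intro N hN T hT
    have hTp : ∀ p ∈ T, p.Prime := fun p hp => (hP N p (hT hp)).1
    have hTc : (∏ p ∈ T, p).Coprime Q := Nat.Coprime.prod_left fun p hp => (hP N p (hT hp)).2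
    have hT0 : 0 < ∏ p ∈ T, p := Finset.prod_pos fun p hp => (hTp p hp).pos
    have hc : (0 : ℝ) < (Ω N).card := by exact_mod_cast hN.card_pos
    have h1 := abs_card_filter_dvd_sub_le Q hQ W hW hTc hT0 N
    have e1 : (∑ n ∈ Ω N, if T ⊆ (P N).filter (· ∣ n) then (1 : ℝ) else 0) =
        ((Finset.Icc 1 N).filter (fun n => W n ∧ ∏ p ∈ T, p ∣ n)).card := by
      rw [← Finset.filter_filter, Finset.card_filter]
      push_cast
      apply Finset.sum_congr rfl
      intro n _
      congr 1
      rw [prod_primes_dvd_iff hTp, eq_iff_iff]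
      constructor
      · intro h p hp
        exact (Finset.mem_filter.1 (h hp)).2
      · intro h p hp
        exact Finset.mem_filter.2 ⟨hT hp, h p hp⟩
    have e2 : ∏ p ∈ T, 1 / (p : ℝ) = 1 / ((∏ p ∈ T, p : ℕ) : ℝ) := by
      push_cast
      rw [Finset.prod_div_distrib, Finset.prod_const_one]
    rw [e1, e2, le_div_iff₀ hc, ← abs_of_pos hc, ← abs_mul, abs_of_pos hc]
    refine le_trans (le_of_eq ?_) h1
    congr 1
    have : ((∏ p ∈ T, p : ℕ) : ℝ) ≠ 0 := by exact_mod_cast hT0.ne'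
    simp only [hΩ]
    simp only [hΩ] at hc
    field_simp
  rw [Metric.tendsto_atTop]
  intro δ hδ
  set C : ℝ := Real.exp ((2 * t) ^ 2 * 2) with hC
  obtain ⟨m₀, hm₀⟩ := exists_pow_lt_of_lt_one (show 0 < δ / (16 * C) by positivity)
    (show (1 / 2 : ℝ) < 1 by norm_num)
  set m := 2 * m₀ with hm
  have hmE : Even m := even_two_mul m₀
  have hmδ : 4 * ((1 / 2 : ℝ) ^ m * C) < δ / 4 := by
    have : (1 / 2 : ℝ) ^ m ≤ (1 / 2) ^ m₀ := pow_le_pow_of_le_one (by norm_num) (by norm_num) (by omega)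
    have h2 := lt_of_le_of_lt this hm₀
    rw [lt_div_iff₀ (by positivity)] at h2
    nlinarith
  have hterm : Tendsto (fun N : ℕ => ∑ j ∈ Finset.range (m + 1), |t| ^ j / j.factorial *
      ((2 * ∑ p ∈ P N, |g N p|) ^ j * (6 * Q / ρ / N))) atTop (𝓝 0) := by
    have : Tendsto (fun N : ℕ => ∑ j ∈ Finset.range (m + 1), |t| ^ j / j.factorial *
      (2 ^ j * (6 * Q / ρ)) * ((∑ p ∈ P N, |g N p|) ^ j / N)) atTop
      (𝓝 (∑ j ∈ Finset.range (m + 1), |t| ^ j / j.factorial * (2 ^ j * (6 * Q / ρ)) * 0)) :=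
      tendsto_finsetSum _ fun j _ => (hB j).const_mul _
    simp only [mul_zero, Finset.sum_const_zero] at this
    refine this.congr fun N => Finset.sum_congr rfl fun j _ => ?_
    rw [mul_pow]; ring
  set Z : ℝ := ∑' n : ℕ, 1 / (n : ℝ) ^ 2 with hZ
  have hZ0 : 0 ≤ Z := tsum_nonneg fun n => by positivity
  have hε : ∃ ε : ℝ, 0 < ε ∧ ε ≤ 1 ∧ 4 * ε ^ 2 * Z + 2 * ε * (t ^ 2 * 2) < δ / 4 := by
    set A := 4 * Z + 4 * t ^ 2 + 1 with hA
    have hA1 : 0 < A := by positivity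
    refine ⟨min 1 (δ / (8 * A)), by positivity, min_le_left _ _, ?_⟩
    set ε := min 1 (δ / (8 * A)) with hε
    have h0 : 0 < ε := by positivity
    have h1 : ε ≤ 1 := min_le_left _ _
    have h2 : ε * (8 * A) ≤ δ := by
      rw [← le_div_iff₀ (by positivity)]; exact min_le_right _ _
    have h3 : ε ^ 2 * Z ≤ ε * Z := by gcongr; nlinarith
    nlinarith [mul_nonneg h0.le hZ0, sq_nonneg t, mul_nonneg h0.le (sq_nonneg t)]
  obtain ⟨ε, hε0, hε1, hεδ⟩ := hε
  have hexp : Tendsto (fun N => Complex.exp ((-(t ^ 2 / 2 * ∑ p ∈ P N, g N p ^ 2 / p) : ℝ))) atTop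
      (𝓝 (Complex.exp ((-(t ^ 2 / 2) : ℝ)))) := by
    have h1 : Tendsto (fun N => (-(t ^ 2 / 2 * ∑ p ∈ P N, g N p ^ 2 / p) : ℝ)) atTop
        (𝓝 (-(t ^ 2 / 2))) := by
      have := (hvar.const_mul (t ^ 2 / 2)).neg
      rwa [mul_one] at this
    exact (Complex.continuous_exp.tendsto _).comp
      ((Complex.continuous_ofReal.tendsto _).comp h1)
  rw [Metric.tendsto_atTop] at hexp
  obtain ⟨N₁, hN₁⟩ := hexp (δ / 4) (by positivity)
  have hvar2 : ∀ᶠ N in atTop, ∑ p ∈ P N, g N p ^ 2 / p ≤ 2 :=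
    hvar.eventually_le_const (by norm_num)
  have hsm := hsmall (ε / (2 * |t| + 1)) (by positivity)
  have hterm' := hterm.eventually_lt_const (show 0 < δ / 4 by positivity)
  obtain ⟨N₀, hN₀⟩ := eventually_atTop.1
    (((hΩlow.and hΩne).and (hvar2.and hsm)).and (hterm'.and (eventually_gt_atTop 0)))
  refine ⟨max N₀ N₁, fun N hN => ?_⟩
  obtain ⟨⟨⟨hlow, hne⟩, hv2, hs⟩, hter, hNpos⟩ := hN₀ N (le_of_max_le_left hN)
  have hNR : (0 : ℝ) < N := by exact_mod_cast hNpos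
  have hPp : ∀ p ∈ P N, p.Prime := fun p hp => (hP N p hp).1
  have hts : ∀ p ∈ P N, |2 * t * g N p| ≤ ε := by
    intro p hp
    have := hs p hp
    rw [le_div_iff₀ (by positivity)] at this
    rw [abs_mul, abs_mul, abs_two]
    nlinarith [abs_nonneg (g N p)]
  have hts' : ∀ p ∈ P N, |t * g N p| ≤ ε := by
    intro p hp
    have := hts p hp
    rw [mul_assoc, abs_mul, abs_two] at this
    linarith [abs_nonneg (t * g N p)]
  have c1 := norm_average_cexp_sub_le (P N) (Ω N) (fun n => (P N).filter (· ∣ n)) (g N) hPp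
    (hηbound N hne) t (fun p hp => (hts p hp).trans hε1) hmE
  have c2 := norm_sum_inclusionWeight_cexp_sub_le (P N) (g N) hPp t hε1 hts'
  have c3 := hN₁ N (le_of_max_le_right hN)
  rw [dist_eq_norm] at c3 ⊢
  have c1' : ∑ j ∈ Finset.range (m + 1), |t| ^ j / j.factorial *
      ((2 * ∑ p ∈ P N, |g N p|) ^ j * (3 * Q / (Ω N).card)) +
        4 * ((1 / 2) ^ m * Real.exp ((2 * t) ^ 2 * ∑ p ∈ P N, g N p ^ 2 / p)) < δ / 2 := by
    have a1 : ∑ j ∈ Finset.range (m + 1), |t| ^ j / j.factorial *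
      ((2 * ∑ p ∈ P N, |g N p|) ^ j * (3 * Q / (Ω N).card)) ≤
      ∑ j ∈ Finset.range (m + 1), |t| ^ j / j.factorial *
      ((2 * ∑ p ∈ P N, |g N p|) ^ j * (6 * Q / ρ / N)) := by
      have a0 : 3 * Q / ((Ω N).card : ℝ) ≤ 6 * Q / ρ / N := by
        rw [div_div, div_le_div_iff₀ (lt_of_lt_of_le (by positivity) hlow) (by positivity)]
        nlinarith
      exact Finset.sum_le_sum fun j _ => mul_le_mul_of_nonneg_left
        (mul_le_mul_of_nonneg_left a0 (by positivity)) (by positivity)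
    have a2 : 4 * ((1 / 2 : ℝ) ^ m * Real.exp ((2 * t) ^ 2 * ∑ p ∈ P N, g N p ^ 2 / p)) ≤
        4 * ((1 / 2) ^ m * C) := by
      rw [hC]; gcongr
    linarith
  have c2' : 4 * ε ^ 2 * Z + 2 * ε * (t ^ 2 * ∑ p ∈ P N, g N p ^ 2 / p) < δ / 4 := by
    refine lt_of_le_of_lt ?_ hεδ
    gcongr
  set a₁ := 1 / ((Ω N).card : ℂ) * ∑ n ∈ Ω N,
    Complex.exp ((t * centredSum (P N) (g N) ((P N).filter (· ∣ n)) : ℝ) * Complex.I)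
  set a₂ := ∑ A ∈ (P N).powerset, (inclusionWeight (P N) A : ℂ) *
    Complex.exp ((t * centredSum (P N) (g N) A : ℝ) * Complex.I)
  set a₃ := Complex.exp ((-(t ^ 2 / 2 * ∑ p ∈ P N, g N p ^ 2 / p) : ℝ))
  calc _ ≤ ‖a₁ - a₂‖ + ‖a₂ - a₃‖ + ‖a₃ - Complex.exp ((-(t ^ 2 / 2) : ℝ))‖ := by
        refine le_trans (le_of_eq ?_) ((norm_add_le (a₁ - a₂ + (a₂ - a₃)) _).trans
          (add_le_add_left (norm_add_le _ _) _))
        congr 1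
        ring
    _ < δ := by linarith

/-- Mean value of a holomorphic function against the weight `1 - cos φ`. -/
theorem integral_circleMap_mul_one_sub_cos {f : ℂ → ℂ}
    (hf : DifferentiableOn ℂ f (Metric.ball 0 1)) {r : ℝ} (hr0 : 0 < r) (hr1 : r < 1) :
    ∫ φ in (0 : ℝ)..(2 * Real.pi), f (circleMap 0 r φ) * ((1 - Real.cos φ : ℝ) : ℂ) =
      2 * Real.pi * (f 0 - r * deriv f 0 / 2) := by
  have hsub : Metric.closedBall (0 : ℂ) r ⊆ Metric.ball 0 1 := Metric.closedBall_subset_ball hr1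
  have hd : DiffContOnCl ℂ f (Metric.ball 0 r) := by
    apply DifferentiableOn.diffContOnCl
    rw [closure_ball 0 hr0.ne']
    exact hf.mono hsub
  have h0 : (0 : ℂ) ∈ Metric.ball (0 : ℂ) r := by simpa using hr0
  have hrc : (r : ℂ) ≠ 0 := by exact_mod_cast hr0.ne'
  have c1 := hd.circleIntegral_sub_inv_smul h0
  have c2 : (∮ z in C(0, r), f z) = 0 := hd.circleIntegral_eq_zero hr0.le
  have c3 := Complex.two_pi_I_inv_smul_circleIntegral_sub_sq_inv_smul_of_differentiable
    Metric.isOpen_ball hsub hf h0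
  have hcont : ContinuousOn f (Metric.sphere 0 r) :=
    hf.continuousOn.mono (Metric.sphere_subset_closedBall.trans hsub)
  have hne : ∀ φ, circleMap 0 r φ ≠ 0 := fun φ => circleMap_ne_center hr0.ne'
  have hcc : Continuous fun φ => f (circleMap 0 r φ) :=
    hcont.comp_continuous (continuous_circleMap 0 r) fun φ => circleMap_mem_sphere 0 hr0.le φ
  have e1 : (∮ z in C(0, r), (z - 0)⁻¹ • f z) =
      ∫ φ in (0 : ℝ)..(2 * Real.pi), Complex.I * f (circleMap 0 r φ) := by
    rw [circleIntegral]
    apply intervalIntegral.integral_congr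
    intro φ _
    have := hne φ
    simp only [deriv_circleMap, smul_eq_mul, sub_zero]
    field_simp
  have e2 : (∮ z in C(0, r), f z) =
      ∫ φ in (0 : ℝ)..(2 * Real.pi), Complex.I * (r * (Complex.exp (φ * Complex.I) *
        f (circleMap 0 r φ))) := by
    rw [circleIntegral]
    apply intervalIntegral.integral_congr
    intro φ _
    simp only [deriv_circleMap, smul_eq_mul, circleMap, zero_add]
    ring
  have e3 : (∮ z in C(0, r), ((z - 0) ^ 2)⁻¹ • f z) =
      ∫ φ in (0 : ℝ)..(2 * Real.pi), Complex.I * ((r : ℂ)⁻¹ * (Complex.exp (-(φ * Complex.I)) *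
        f (circleMap 0 r φ))) := by
    rw [circleIntegral]
    apply intervalIntegral.integral_congr
    intro φ _
    have := Complex.exp_ne_zero (φ * Complex.I)
    simp only [deriv_circleMap, smul_eq_mul, circleMap, zero_add, sub_zero, Complex.exp_neg]
    field_simp
  rw [e1, intervalIntegral.integral_const_mul] at c1
  rw [e2, intervalIntegral.integral_const_mul, intervalIntegral.integral_const_mul] at c2
  rw [e3, intervalIntegral.integral_const_mul, intervalIntegral.integral_const_mul] at c3
  have hI := Complex.I_ne_zero
  have hpi : (Real.pi : ℂ) ≠ 0 := by exact_mod_cast Real.pi_ne_zero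
  have d1 : ∫ φ in (0 : ℝ)..(2 * Real.pi), f (circleMap 0 r φ) = 2 * Real.pi * f 0 := by
    have : Complex.I * ∫ φ in (0 : ℝ)..(2 * Real.pi), f (circleMap 0 r φ) =
      Complex.I * (2 * Real.pi * f 0) := by
      rw [c1, smul_eq_mul]; ring
    exact mul_left_cancel₀ hI this
  have d2 : ∫ φ in (0 : ℝ)..(2 * Real.pi), Complex.exp (φ * Complex.I) * f (circleMap 0 r φ) =
      0 := by
    rcases mul_eq_zero.1 c2 with h | h
    · exact absurd h hI
    · exact (mul_eq_zero.1 h).resolve_left hrc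
  have d3 : ∫ φ in (0 : ℝ)..(2 * Real.pi), Complex.exp (-(φ * Complex.I)) *
      f (circleMap 0 r φ) = 2 * Real.pi * (r * deriv f 0) := by
    rw [← c3, smul_eq_mul]
    generalize (∫ φ in (0 : ℝ)..(2 * Real.pi), Complex.exp (-(φ * Complex.I)) *
      f (circleMap 0 r φ)) = J
    field_simp
  have hi1 : IntervalIntegrable (fun φ => f (circleMap 0 r φ)) MeasureTheory.volume 0
      (2 * Real.pi) := hcc.intervalIntegrable _ _
  have hi2 : IntervalIntegrable (fun φ : ℝ => (1 / 2 : ℂ) * (Complex.exp (φ * Complex.I) *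
      f (circleMap 0 r φ))) MeasureTheory.volume 0 (2 * Real.pi) :=
    Continuous.intervalIntegrable (continuous_const.mul (Continuous.mul (by fun_prop) hcc)) _ _
  have hi3 : IntervalIntegrable (fun φ : ℝ => (1 / 2 : ℂ) * (Complex.exp (-(φ * Complex.I)) *
      f (circleMap 0 r φ))) MeasureTheory.volume 0 (2 * Real.pi) :=
    Continuous.intervalIntegrable (continuous_const.mul (Continuous.mul (by fun_prop) hcc)) _ _
  have e4 : ∀ φ : ℝ, f (circleMap 0 r φ) * ((1 - Real.cos φ : ℝ) : ℂ) =
      f (circleMap 0 r φ) - (1 / 2 : ℂ) * (Complex.exp (φ * Complex.I) * f (circleMap 0 r φ)) -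
        (1 / 2 : ℂ) * (Complex.exp (-(φ * Complex.I)) * f (circleMap 0 r φ)) := by
    intro φ
    push_cast
    rw [Complex.cos, neg_mul]
    ring
  simp only [e4]
  rw [intervalIntegral.integral_sub (hi1.sub hi2) hi3, intervalIntegral.integral_sub hi1 hi2,
    intervalIntegral.integral_const_mul, intervalIntegral.integral_const_mul, d1, d2, d3]
  ring

theorem integral_circleMap_mul_sin_sq {f : ℂ → ℂ}
    (hf : DifferentiableOn ℂ f (Metric.ball 0 1)) {r : ℝ} (hr0 : 0 < r) (hr1 : r < 1) :
    ∫ θ in (0 : ℝ)..Real.pi, f (circleMap 0 r (2 * θ)) * ((Real.sin θ ^ 2 : ℝ) : ℂ) =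
      Real.pi / 2 * (f 0 - r * deriv f 0 / 2) := by
  have h := integral_circleMap_mul_one_sub_cos hf hr0 hr1
  have h2 := intervalIntegral.integral_comp_mul_left (a := 0) (b := Real.pi) (c := 2)
    (fun φ => f (circleMap 0 r φ) * ((1 - Real.cos φ : ℝ) : ℂ)) two_ne_zero
  rw [mul_zero, h] at h2
  have e : ∀ θ : ℝ, f (circleMap 0 r (2 * θ)) * ((1 - Real.cos (2 * θ) : ℝ) : ℂ) =
      2 * (f (circleMap 0 r (2 * θ)) * ((Real.sin θ ^ 2 : ℝ) : ℂ)) := by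
    intro θ
    rw [Real.sin_sq_eq_half_sub]
    push_cast
    ring
  simp only [e] at h2
  rw [intervalIntegral.integral_const_mul] at h2
  rw [Complex.real_smul] at h2
  apply mul_left_cancel₀ (two_ne_zero' ℂ)
  rw [h2]
  push_cast
  ring

theorem one_add_mem_slitPlane {z : ℂ} (hz : z ∈ Metric.ball (0 : ℂ) 1) :
    1 + z ∈ Complex.slitPlane := by
  left
  have h1 : ‖z‖ < 1 := by simpa using hz
  have h2 := (abs_le.1 ((Complex.abs_re_le_norm z).trans h1.le)).1
  have h3 := (abs_lt.1 ((Complex.abs_re_le_norm z).trans_lt h1)).1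
  simp only [Complex.add_re, Complex.one_re]
  linarith

theorem hasDerivAt_log_one_add {z : ℂ} (hz : z ∈ Metric.ball (0 : ℂ) 1) :
    HasDerivAt (fun z => Complex.log (1 + z)) (1 / (1 + z)) z :=
  ((hasDerivAt_id z).const_add 1).clog (one_add_mem_slitPlane hz)

/-- The point `1 + r e^{2iθ}`. -/
noncomputable def shiftedCircle (r θ : ℝ) : ℂ := 1 + circleMap 0 r (2 * θ)

theorem circleMap_mem_unitBall {r : ℝ} (hr0 : 0 < r) (hr1 : r < 1) (φ : ℝ) :
    circleMap 0 r φ ∈ Metric.ball (0 : ℂ) 1 := by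
  simp [abs_of_pos hr0, hr1]

theorem continuous_log_shiftedCircle {r : ℝ} (hr0 : 0 < r) (hr1 : r < 1) :
    Continuous fun θ => Complex.log (shiftedCircle r θ) := by
  apply Continuous.clog
  · unfold shiftedCircle; fun_prop
  · exact fun θ => one_add_mem_slitPlane (circleMap_mem_unitBall hr0 hr1 _)

theorem integral_log_norm_shiftedCircle {r : ℝ} (hr0 : 0 < r) (hr1 : r < 1) :
    ∫ θ in (0 : ℝ)..Real.pi, Real.log ‖shiftedCircle r θ‖ * Real.sin θ ^ 2 =
      -(Real.pi / 4) * r := by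
  have hd : DifferentiableOn ℂ (fun z => Complex.log (1 + z)) (Metric.ball 0 1) := fun z hz =>
    (hasDerivAt_log_one_add hz).differentiableAt.differentiableWithinAt
  have h := integral_circleMap_mul_sin_sq hd hr0 hr1
  rw [(hasDerivAt_log_one_add (Metric.mem_ball_self one_pos)).deriv] at h
  have hre := congrArg Complex.re h
  have hcont := continuous_log_shiftedCircle hr0 hr1
  have e : ∀ θ : ℝ, Real.log ‖shiftedCircle r θ‖ * Real.sin θ ^ 2 =
      Complex.reCLM (Complex.log (shiftedCircle r θ) * ((Real.sin θ ^ 2 : ℝ) : ℂ)) := by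
    intro θ
    rw [Complex.reCLM_apply, Complex.re_mul_ofReal, Complex.log_re]
  simp only [e]
  rw [ContinuousLinearMap.intervalIntegral_comp_comm]
  · refine Eq.trans hre ?_
    have e3 : (Real.pi : ℂ) / 2 * (Complex.log (1 + 0) - r * (1 / (1 + 0)) / 2) =
      ((-(Real.pi / 4) * r : ℝ) : ℂ) := by
      rw [add_zero, Complex.log_one]; push_cast; ring
    rw [e3, Complex.ofReal_re]
  · exact Continuous.intervalIntegrable (by fun_prop) _ _

theorem integral_log_sq_norm_shiftedCircle {r : ℝ} (hr0 : 0 < r) (hr1 : r < 1) :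
    ∫ θ in (0 : ℝ)..Real.pi, Real.log ‖shiftedCircle r θ‖ ^ 2 * Real.sin θ ^ 2 =
      ∫ θ in (0 : ℝ)..Real.pi, Complex.arg (shiftedCircle r θ) ^ 2 * Real.sin θ ^ 2 := by
  have hder : ∀ z ∈ Metric.ball (0 : ℂ) 1, HasDerivAt (fun z => Complex.log (1 + z) ^ 2)
      (2 * Complex.log (1 + z) * (1 / (1 + z))) z := by
    intro z hz
    refine ((hasDerivAt_log_one_add hz).fun_pow 2).congr_deriv ?_
    simp
  have hd : DifferentiableOn ℂ (fun z => Complex.log (1 + z) ^ 2) (Metric.ball 0 1) := fun z hz =>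
    (hder z hz).differentiableAt.differentiableWithinAt
  have h := integral_circleMap_mul_sin_sq hd hr0 hr1
  rw [(hder 0 (Metric.mem_ball_self one_pos)).deriv] at h
  have hre := congrArg Complex.re h
  have hcont := continuous_log_shiftedCircle hr0 hr1
  have e : ∀ θ : ℝ, Real.log ‖shiftedCircle r θ‖ ^ 2 * Real.sin θ ^ 2 -
      Complex.arg (shiftedCircle r θ) ^ 2 * Real.sin θ ^ 2 =
      Complex.reCLM (Complex.log (shiftedCircle r θ) ^ 2 * ((Real.sin θ ^ 2 : ℝ) : ℂ)) := by
    intro θ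
    rw [Complex.reCLM_apply, Complex.re_mul_ofReal, pow_two (Complex.log _), Complex.mul_re,
      Complex.log_re, Complex.log_im]
    ring
  have hl : Continuous fun θ => Real.log ‖shiftedCircle r θ‖ := by
    simpa only [Function.comp_def, Complex.log_re] using Complex.continuous_re.comp hcont
  have ha : Continuous fun θ => Complex.arg (shiftedCircle r θ) := by
    simpa only [Function.comp_def, Complex.log_im] using Complex.continuous_im.comp hcont
  rw [← sub_eq_zero, ← intervalIntegral.integral_sub]
  · simp only [e]
    rw [ContinuousLinearMap.intervalIntegral_comp_comm]
    · refine Eq.trans hre ?_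
      simp
    · exact Continuous.intervalIntegrable (by fun_prop) _ _
  · exact Continuous.intervalIntegrable (by fun_prop) _ _
  · exact Continuous.intervalIntegrable (by fun_prop) _ _

/-- An integrable majorant on `[0, π]` for the first two powers of `log |cos θ|`. -/
noncomputable def logCosMajorant (θ : ℝ) : ℝ :=
  3 + 32 * (2 / Real.pi * |Real.pi / 2 - θ|) ^ (-(1 / 2) : ℝ)

theorem abs_log_le_majorant {x y : ℝ} (hy0 : 0 < y) (hy1 : y ≤ 1) (hyx : y ≤ x) (hx2 : x ≤ 2) :
    |Real.log x| ≤ 3 + 32 * y ^ (-(1 / 2) : ℝ) ∧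
      |Real.log x ^ 2| ≤ 3 + 32 * y ^ (-(1 / 2) : ℝ) := by
  have hx0 : 0 < x := hy0.trans_le hyx
  have h1 : |Real.log x| ≤ 1 + 4 * y ^ (-(1 / 4) : ℝ) := by
    have hly : |Real.log y| ≤ 4 * y ^ (-(1 / 4) : ℝ) := by
      have := Real.abs_log_mul_self_rpow_lt y (1 / 4) hy0 hy1 (by norm_num)
      rw [abs_mul, abs_of_pos (Real.rpow_pos_of_pos hy0 _)] at this
      rw [Real.rpow_neg hy0.le, ← div_eq_mul_inv, le_div_iff₀ (Real.rpow_pos_of_pos hy0 _)]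
      linarith
    have hl := Real.log_le_log hy0 hyx
    have hu : Real.log x ≤ 1 := by
      have := Real.log_le_log hx0 hx2
      linarith [Real.log_two_lt_d9]
    have := neg_abs_le (Real.log y)
    have := abs_nonneg (Real.log y)
    rw [abs_le]; constructor <;> linarith
  have hsq : (y ^ (-(1 / 4) : ℝ)) ^ 2 = y ^ (-(1 / 2) : ℝ) := by
    rw [← Real.rpow_natCast, ← Real.rpow_mul hy0.le]; norm_num
  have h2 : Real.log x ^ 2 ≤ 2 + 32 * y ^ (-(1 / 2) : ℝ) := by
    rw [← hsq, ← sq_abs]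
    have := abs_nonneg (Real.log x)
    nlinarith [sq_nonneg (1 - 4 * y ^ (-(1 / 4) : ℝ))]
  refine ⟨?_, ?_⟩
  · have : |Real.log x| ≤ 1 + Real.log x ^ 2 := by
      rw [← sq_abs (Real.log x)]; nlinarith [sq_nonneg (|Real.log x| - 1)]
    linarith
  · rw [abs_of_nonneg (sq_nonneg _)]
    linarith

theorem two_div_pi_mul_le_abs_cos {θ : ℝ} (h0 : 0 ≤ θ) (h1 : θ ≤ Real.pi) :
    2 / Real.pi * |Real.pi / 2 - θ| ≤ |Real.cos θ| := by
  rw [← Real.sin_pi_div_two_sub]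
  apply Real.mul_abs_le_abs_sin
  rw [abs_le]; constructor <;> linarith

theorem intervalIntegrable_logCosMajorant :
    IntervalIntegrable logCosMajorant MeasureTheory.volume 0 Real.pi := by
  unfold logCosMajorant
  refine (intervalIntegrable_const).add (IntervalIntegrable.const_mul ?_ _)
  have hp := Real.pi_pos
  have h1 : IntervalIntegrable (fun θ => (2 / Real.pi * |Real.pi / 2 - θ|) ^ (-(1 / 2) : ℝ))
      MeasureTheory.volume 0 (Real.pi / 2) := by
    have : IntervalIntegrable (fun x : ℝ => (2 / Real.pi) ^ (-(1 / 2) : ℝ) * x ^ (-(1 / 2) : ℝ))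
      MeasureTheory.volume (Real.pi / 2) 0 :=
      (intervalIntegral.intervalIntegrable_rpow' (by norm_num)).const_mul _
    have h2 := this.comp_sub_left (Real.pi / 2)
    simp only [sub_self, sub_zero] at h2
    refine h2.congr ?_
    intro θ hθ
    rw [Set.uIoc_of_le (by linarith)] at hθ
    simp only
    rw [abs_of_nonneg (by linarith [hθ.2]), Real.mul_rpow (by positivity) (by linarith [hθ.2])]
  have h3 : IntervalIntegrable (fun θ => (2 / Real.pi * |Real.pi / 2 - θ|) ^ (-(1 / 2) : ℝ))
      MeasureTheory.volume (Real.pi / 2) Real.pi := by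
    have : IntervalIntegrable (fun x : ℝ => (2 / Real.pi) ^ (-(1 / 2) : ℝ) * x ^ (-(1 / 2) : ℝ))
      MeasureTheory.volume 0 (Real.pi / 2) :=
      (intervalIntegral.intervalIntegrable_rpow' (by norm_num)).const_mul _
    have h2 := this.comp_sub_right (Real.pi / 2)
    rw [zero_add, add_halves] at h2
    refine h2.congr ?_
    intro θ hθ
    rw [Set.uIoc_of_le (by linarith)] at hθ
    simp only
    rw [abs_sub_comm, abs_of_nonneg (by linarith [hθ.1]),
      Real.mul_rpow (by positivity) (by linarith [hθ.1])]
  exact h1.trans h3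

theorem shiftedCircle_re (r θ : ℝ) : (shiftedCircle r θ).re = 1 + r * Real.cos (2 * θ) := by
  rw [shiftedCircle, circleMap_zero, Complex.add_re, Complex.one_re, Complex.re_ofReal_mul,
    Complex.exp_ofReal_mul_I_re]

theorem shiftedCircle_im (r θ : ℝ) : (shiftedCircle r θ).im = r * Real.sin (2 * θ) := by
  rw [shiftedCircle, circleMap_zero, Complex.add_im, Complex.one_im, Complex.im_ofReal_mul,
    Complex.exp_ofReal_mul_I_im, zero_add]

theorem sq_norm_shiftedCircle (r θ : ℝ) :
    ‖shiftedCircle r θ‖ ^ 2 = (1 - r) ^ 2 + 4 * r * Real.cos θ ^ 2 := by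
  rw [Complex.sq_norm, Complex.normSq_apply, shiftedCircle_re, shiftedCircle_im, Real.cos_two_mul,
    Real.sin_two_mul]
  have := Real.sin_sq_add_cos_sq θ
  have h : Real.sin θ ^ 2 = 1 - Real.cos θ ^ 2 := by linarith
  have e : r * (2 * Real.sin θ * Real.cos θ) * (r * (2 * Real.sin θ * Real.cos θ)) =
    4 * r ^ 2 * Real.sin θ ^ 2 * Real.cos θ ^ 2 := by ring
  rw [e, h]
  ring

theorem norm_shiftedCircle_one (θ : ℝ) : ‖shiftedCircle 1 θ‖ = |2 * Real.cos θ| := by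
  rw [← abs_norm, ← sq_eq_sq_iff_abs_eq_abs, sq_norm_shiftedCircle]
  ring

theorem continuous_shiftedCircle_left (θ : ℝ) : Continuous fun r => shiftedCircle r θ := by
  unfold shiftedCircle circleMap; fun_prop

theorem norm_shiftedCircle_bounds {r : ℝ} (hr0 : 1 / 4 < r) (hr1 : r < 1) (θ : ℝ) :
    |Real.cos θ| ≤ ‖shiftedCircle r θ‖ ∧ ‖shiftedCircle r θ‖ ≤ 2 := by
  have hc : Real.cos θ ^ 2 ≤ 1 := Real.cos_sq_le_one θ
  have h := sq_norm_shiftedCircle r θ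
  constructor
  · apply abs_le_of_sq_le_sq _ (norm_nonneg _)
    rw [h]
    nlinarith [sq_nonneg (Real.cos θ), sq_nonneg (1 - r)]
  · rw [← abs_norm]
    apply abs_le_of_sq_le_sq _ (by norm_num)
    rw [h]
    nlinarith [sq_nonneg (Real.cos θ), sq_nonneg (1 - r)]

theorem ae_ne_pi_div_two : ∀ᵐ θ : ℝ, θ ≠ Real.pi / 2 := by
  simp [MeasureTheory.ae_iff]

theorem cos_ne_zero_of_ne {θ : ℝ} (h0 : 0 < θ) (h1 : θ ≤ Real.pi) (h : θ ≠ Real.pi / 2) :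
    Real.cos θ ≠ 0 ∧ 0 < 2 / Real.pi * |Real.pi / 2 - θ| := by
  have hp : 0 < 2 / Real.pi * |Real.pi / 2 - θ| := by
    have := abs_pos.2 (sub_ne_zero.2 h.symm)
    have := Real.pi_pos
    positivity
  exact ⟨abs_pos.1 (hp.trans_le (two_div_pi_mul_le_abs_cos h0.le h1)), hp⟩

theorem two_div_pi_mul_le_one {θ : ℝ} (h0 : 0 ≤ θ) (h1 : θ ≤ Real.pi) :
    2 / Real.pi * |Real.pi / 2 - θ| ≤ 1 :=
  (two_div_pi_mul_le_abs_cos h0 h1).trans (Real.abs_cos_le_one θ)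

/-- Dominated convergence for `log^k ‖·‖` against `sin² θ`, for `k ≤ 2`. -/
theorem tendsto_integral_log_pow_of_pointwise {ι : Type*} {l : Filter ι} [l.IsCountablyGenerated]
    (x : ι → ℝ → ℝ) (x₀ : ℝ → ℝ) {k : ℕ} (hk : k = 1 ∨ k = 2)
    (hm : ∀ᶠ i in l, Measurable (x i))
    (hb : ∀ᶠ i in l, ∀ θ, |Real.cos θ| ≤ x i θ ∧ x i θ ≤ 2)
    (hx : ∀ θ, Tendsto (fun i => x i θ) l (𝓝 (x₀ θ))) (hx₀ : ∀ θ, Real.cos θ ≠ 0 → x₀ θ ≠ 0) :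
    Tendsto (fun i => ∫ θ in (0 : ℝ)..Real.pi, Real.log (x i θ) ^ k * Real.sin θ ^ 2) l
      (𝓝 (∫ θ in (0 : ℝ)..Real.pi, Real.log (x₀ θ) ^ k * Real.sin θ ^ 2)) := by
  apply intervalIntegral.tendsto_integral_filter_of_dominated_convergence logCosMajorant
  · filter_upwards [hm] with i hi
    exact (((Real.measurable_log.comp hi).pow_const k).mul
      (Real.measurable_sin.pow_const 2)).aestronglyMeasurable
  · filter_upwards [hb] with i hi
    filter_upwards [ae_ne_pi_div_two] with θ hne hθ
    rw [Set.uIoc_of_le Real.pi_pos.le] at hθ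
    obtain ⟨-, hy⟩ := cos_ne_zero_of_ne hθ.1 hθ.2 hne
    have h := abs_log_le_majorant hy (two_div_pi_mul_le_one hθ.1.le hθ.2)
      ((two_div_pi_mul_le_abs_cos hθ.1.le hθ.2).trans (hi θ).1) (hi θ).2
    have h2 : |Real.log (x i θ) ^ k| ≤ logCosMajorant θ := by
      rcases hk with rfl | rfl
      · rw [pow_one]; exact h.1
      · exact h.2
    rw [norm_mul, Real.norm_eq_abs, Real.norm_eq_abs, abs_of_nonneg (sq_nonneg (Real.sin θ))]
    calc _ ≤ |Real.log (x i θ) ^ k| * 1 := by gcongr; exact Real.sin_sq_le_one θ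
      _ ≤ _ := by rw [mul_one]; exact h2
  · exact intervalIntegrable_logCosMajorant
  · filter_upwards [ae_ne_pi_div_two] with θ hne hθ
    rw [Set.uIoc_of_le Real.pi_pos.le] at hθ
    obtain ⟨hc, -⟩ := cos_ne_zero_of_ne hθ.1 hθ.2 hne
    exact (((Real.continuousAt_log (hx₀ θ hc)).tendsto.comp (hx θ)).pow k).mul_const _

theorem tendsto_integral_log_norm_shiftedCircle {k : ℕ} (hk : k = 1 ∨ k = 2) :
    Tendsto (fun r => ∫ θ in (0 : ℝ)..Real.pi, Real.log ‖shiftedCircle r θ‖ ^ k * Real.sin θ ^ 2)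
      (𝓝[<] 1) (𝓝 (∫ θ in (0 : ℝ)..Real.pi, Real.log |2 * Real.cos θ| ^ k * Real.sin θ ^ 2)) := by
  apply tendsto_integral_log_pow_of_pointwise (fun r θ => ‖shiftedCircle r θ‖)
    (fun θ => |2 * Real.cos θ|) hk
  · refine Eventually.of_forall fun r => Continuous.measurable ?_
    unfold shiftedCircle; fun_prop
  · filter_upwards [Ioo_mem_nhdsLT (show (1 / 4 : ℝ) < 1 by norm_num)] with r hr θ
    exact norm_shiftedCircle_bounds hr.1 hr.2 θ
  · intro θ
    rw [← norm_shiftedCircle_one θ]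
    exact ((continuous_shiftedCircle_left θ).norm.tendsto 1).mono_left nhdsWithin_le_nhds
  · intro θ h
    simpa using h

theorem integral_log_two_cos_mul_sin_sq :
    ∫ θ in (0 : ℝ)..Real.pi, Real.log |2 * Real.cos θ| * Real.sin θ ^ 2 = -(Real.pi / 4) := by
  have h1 := tendsto_integral_log_norm_shiftedCircle (k := 1) (Or.inl rfl)
  simp only [pow_one] at h1
  have h2 : Tendsto (fun r : ℝ => -(Real.pi / 4) * r) (𝓝[<] 1) (𝓝 (-(Real.pi / 4) * 1)) :=
    ((continuous_const.mul continuous_id).tendsto 1).mono_left nhdsWithin_le_nhds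
  rw [mul_one] at h2
  refine tendsto_nhds_unique h1 (h2.congr' ?_)
  filter_upwards [Ioo_mem_nhdsLT (show (0 : ℝ) < 1 by norm_num)] with r hr
  exact (integral_log_norm_shiftedCircle hr.1 hr.2).symm

theorem shiftedCircle_one_eq (θ : ℝ) : shiftedCircle 1 θ =
    ((2 * Real.cos θ : ℝ) : ℂ) * (Complex.cos θ + Complex.sin θ * Complex.I) := by
  apply Complex.ext
  · rw [shiftedCircle_re, Complex.re_ofReal_mul, ← Complex.ofReal_cos, ← Complex.ofReal_sin,
      Real.cos_two_mul]
    simp [-Complex.ofReal_cos, -Complex.ofReal_sin]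
    ring
  · rw [shiftedCircle_im, Complex.im_ofReal_mul, ← Complex.ofReal_cos, ← Complex.ofReal_sin,
      Real.sin_two_mul]
    simp [-Complex.ofReal_cos, -Complex.ofReal_sin]
    ring

theorem arg_shiftedCircle_one_of_lt {θ : ℝ} (h0 : 0 < θ) (h1 : θ < Real.pi / 2) :
    Complex.arg (shiftedCircle 1 θ) = θ := by
  rw [shiftedCircle_one_eq]
  apply Complex.arg_mul_cos_add_sin_mul_I
  · have := Real.cos_pos_of_mem_Ioo ⟨by linarith, h1⟩
    positivity
  · constructor <;> linarith [Real.pi_pos]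

theorem arg_shiftedCircle_one_of_gt {θ : ℝ} (h0 : Real.pi / 2 < θ) (h1 : θ ≤ Real.pi) :
    Complex.arg (shiftedCircle 1 θ) = θ - Real.pi := by
  have e : shiftedCircle 1 θ = ((2 * Real.cos (θ - Real.pi) : ℝ) : ℂ) *
      (Complex.cos ((θ - Real.pi : ℝ) : ℂ) + Complex.sin ((θ - Real.pi : ℝ) : ℂ) * Complex.I) := by
    rw [shiftedCircle_one_eq, ← Complex.ofReal_cos, ← Complex.ofReal_sin, ← Complex.ofReal_cos,
      ← Complex.ofReal_sin, Real.cos_sub_pi, Real.sin_sub_pi]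
    push_cast
    ring
  rw [e]
  apply Complex.arg_mul_cos_add_sin_mul_I
  · have := Real.cos_pos_of_mem_Ioo (x := θ - Real.pi) ⟨by linarith, by linarith [Real.pi_pos]⟩
    positivity
  · constructor <;> linarith [Real.pi_pos]

theorem integral_sq_mul_sin_sq :
    ∫ θ in (0 : ℝ)..(Real.pi / 2), θ ^ 2 * Real.sin θ ^ 2 = Real.pi ^ 3 / 48 + Real.pi / 8 := by
  have hd : ∀ θ ∈ Set.uIcc (0 : ℝ) (Real.pi / 2), HasDerivAt (fun θ : ℝ => θ ^ 3 / 6 -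
      (θ ^ 2 * Real.sin (2 * θ) / 4 + θ * Real.cos (2 * θ) / 4 - Real.sin (2 * θ) / 8))
      (θ ^ 2 * Real.sin θ ^ 2) θ := by
    intro θ _
    have h2 : HasDerivAt (fun θ : ℝ => 2 * θ) 2 θ := by
      simpa using (hasDerivAt_id θ).const_mul 2
    have hs := h2.sin
    have hc := h2.cos
    have := ((hasDerivAt_pow 3 θ).div_const 6).sub
      (((((hasDerivAt_pow 2 θ).mul hs).div_const 4).add
        (((hasDerivAt_id θ).mul hc).div_const 4)).sub (hs.div_const 8))
    refine this.congr_deriv ?_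
    rw [Real.sin_sq_eq_half_sub]
    simp only [id]
    push_cast
    ring
  rw [intervalIntegral.integral_eq_sub_of_hasDerivAt hd
    (Continuous.intervalIntegrable (by fun_prop) _ _)]
  rw [show 2 * (Real.pi / 2) = Real.pi by ring]
  simp
  ring

theorem integral_log_sq_two_cos_mul_sin_sq :
    ∫ θ in (0 : ℝ)..Real.pi, Real.log |2 * Real.cos θ| ^ 2 * Real.sin θ ^ 2 =
      Real.pi ^ 3 / 24 + Real.pi / 4 := by
  have h1 := tendsto_integral_log_norm_shiftedCircle (k := 2) (Or.inr rfl)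
  have hp := Real.pi_pos
  have hpt : ∀ᵐ θ : ℝ, θ ∈ Set.uIoc 0 Real.pi →
      shiftedCircle 1 θ ∈ Complex.slitPlane := by
    filter_upwards [ae_ne_pi_div_two] with θ hne hθ
    rw [Set.uIoc_of_le hp.le] at hθ
    obtain ⟨hc, -⟩ := cos_ne_zero_of_ne hθ.1 hθ.2 hne
    left
    rw [shiftedCircle_re, Real.cos_two_mul]
    have := pow_pos (abs_pos.2 hc) 2
    rw [sq_abs] at this
    linarith
  have h2 : Tendsto (fun r => ∫ θ in (0 : ℝ)..Real.pi,
      Complex.arg (shiftedCircle r θ) ^ 2 * Real.sin θ ^ 2) (𝓝[<] 1)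
      (𝓝 (∫ θ in (0 : ℝ)..Real.pi, Complex.arg (shiftedCircle 1 θ) ^ 2 * Real.sin θ ^ 2)) := by
    apply intervalIntegral.tendsto_integral_filter_of_dominated_convergence
      (fun _ => Real.pi ^ 2)
    · refine Eventually.of_forall fun r => Measurable.aestronglyMeasurable ?_
      have : Measurable fun θ => shiftedCircle r θ := by
        apply Continuous.measurable
        unfold shiftedCircle; fun_prop
      exact ((Complex.measurable_arg.comp this).pow_const 2).mul (Real.measurable_sin.pow_const 2)
    · refine Eventually.of_forall fun r => Eventually.of_forall fun θ _ => ?_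
      have ha : Complex.arg (shiftedCircle r θ) ^ 2 ≤ Real.pi ^ 2 := by
        rw [← sq_abs]
        gcongr
        exact Complex.abs_arg_le_pi _
      rw [Real.norm_of_nonneg (by positivity)]
      have := Real.sin_sq_le_one θ
      nlinarith [sq_nonneg (Complex.arg (shiftedCircle r θ))]
    · exact intervalIntegrable_const
    · filter_upwards [hpt] with θ hθ hm
      have hc := (continuous_shiftedCircle_left θ).tendsto 1
      exact ((((Complex.continuousAt_arg (hθ hm)).tendsto.comp hc).mono_left
        nhdsWithin_le_nhds).pow 2).mul_const _
  have h3 : ∫ θ in (0 : ℝ)..Real.pi, Complex.arg (shiftedCircle 1 θ) ^ 2 * Real.sin θ ^ 2 =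
      Real.pi ^ 3 / 24 + Real.pi / 4 := by
    have a1 : ∀ᵐ θ : ℝ, θ ∈ Set.uIoc 0 (Real.pi / 2) →
        Complex.arg (shiftedCircle 1 θ) ^ 2 * Real.sin θ ^ 2 = θ ^ 2 * Real.sin θ ^ 2 := by
      filter_upwards [ae_ne_pi_div_two] with θ hne hθ
      rw [Set.uIoc_of_le (by linarith)] at hθ
      rw [arg_shiftedCircle_one_of_lt hθ.1 (lt_of_le_of_ne hθ.2 hne)]
    have a2 : ∀ᵐ θ : ℝ, θ ∈ Set.uIoc (Real.pi / 2) Real.pi →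
        Complex.arg (shiftedCircle 1 θ) ^ 2 * Real.sin θ ^ 2 =
          (Real.pi - θ) ^ 2 * Real.sin (Real.pi - θ) ^ 2 := by
      filter_upwards with θ hθ
      rw [Set.uIoc_of_le (by linarith)] at hθ
      rw [arg_shiftedCircle_one_of_gt hθ.1 hθ.2, Real.sin_pi_sub]
      ring
    have i1 : IntervalIntegrable
        (fun θ => Complex.arg (shiftedCircle 1 θ) ^ 2 * Real.sin θ ^ 2)
        MeasureTheory.volume 0 (Real.pi / 2) := by
      have : IntervalIntegrable (fun θ : ℝ => θ ^ 2 * Real.sin θ ^ 2) MeasureTheory.volume 0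
        (Real.pi / 2) := Continuous.intervalIntegrable (by fun_prop) _ _
      refine this.congr_ae ?_
      rw [Filter.EventuallyEq, MeasureTheory.ae_restrict_iff' measurableSet_uIoc]
      filter_upwards [a1] with θ h hm using (h hm).symm
    have i2 : IntervalIntegrable
        (fun θ => Complex.arg (shiftedCircle 1 θ) ^ 2 * Real.sin θ ^ 2)
        MeasureTheory.volume (Real.pi / 2) Real.pi := by
      have : IntervalIntegrable (fun θ : ℝ => (Real.pi - θ) ^ 2 * Real.sin (Real.pi - θ) ^ 2)
        MeasureTheory.volume (Real.pi / 2) Real.pi :=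
        Continuous.intervalIntegrable (by fun_prop) _ _
      refine this.congr_ae ?_
      rw [Filter.EventuallyEq, MeasureTheory.ae_restrict_iff' measurableSet_uIoc]
      filter_upwards [a2] with θ h hm using (h hm).symm
    rw [← intervalIntegral.integral_add_adjacent_intervals i1 i2,
      intervalIntegral.integral_congr_ae a1, intervalIntegral.integral_congr_ae a2,
      intervalIntegral.integral_comp_sub_left (fun u => u ^ 2 * Real.sin u ^ 2) Real.pi,
      sub_self, show Real.pi - Real.pi / 2 = Real.pi / 2 by ring, integral_sq_mul_sin_sq]
    ring
  rw [h3] at h2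
  refine tendsto_nhds_unique h1 (h2.congr' ?_)
  filter_upwards [Ioo_mem_nhdsLT (show (0 : ℝ) < 1 by norm_num)] with r hr
  exact (integral_log_sq_norm_shiftedCircle hr.1 hr.2).symm

/-- The `k`-th Sato–Tate moment of `log max(|2 cos θ|, δ)`. -/
noncomputable def truncLogMoment (k : ℕ) (δ : ℝ) : ℝ :=
  2 / Real.pi * ∫ θ in (0 : ℝ)..Real.pi,
    Real.log (max |2 * Real.cos θ| δ) ^ k * Real.sin θ ^ 2

theorem tendsto_truncLogMoment {k : ℕ} (hk : k = 1 ∨ k = 2) :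
    Tendsto (truncLogMoment k) (𝓝[>] 0) (𝓝 (2 / Real.pi *
      ∫ θ in (0 : ℝ)..Real.pi, Real.log |2 * Real.cos θ| ^ k * Real.sin θ ^ 2)) := by
  apply Tendsto.const_mul
  apply tendsto_integral_log_pow_of_pointwise (fun δ θ => max |2 * Real.cos θ| δ)
    (fun θ => |2 * Real.cos θ|) hk
  · exact Eventually.of_forall fun r => Continuous.measurable (by fun_prop)
  · filter_upwards [Ioo_mem_nhdsGT (show (0 : ℝ) < 2 by norm_num)] with δ hδ θ
    constructor
    · apply le_max_of_le_left
      rw [abs_mul, abs_two]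
      linarith [abs_nonneg (Real.cos θ)]
    · apply max_le _ hδ.2.le
      rw [abs_mul, abs_two]
      linarith [Real.abs_cos_le_one θ]
  · intro θ
    have : Tendsto (fun δ => max |2 * Real.cos θ| δ) (𝓝 0) (𝓝 (max |2 * Real.cos θ| 0)) :=
      (continuous_const.max continuous_id).tendsto 0
    rw [max_eq_left (abs_nonneg _)] at this
    exact this.mono_left nhdsWithin_le_nhds
  · intro θ h
    simpa using h

theorem tendsto_truncLogMoment_one : Tendsto (truncLogMoment 1) (𝓝[>] 0) (𝓝 (-(1 / 2))) := by
  have h := tendsto_truncLogMoment (k := 1) (Or.inl rfl)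
  simp only [pow_one] at h
  rw [integral_log_two_cos_mul_sin_sq] at h
  convert h using 2
  field_simp
  norm_num

theorem tendsto_truncLogMoment_two :
    Tendsto (truncLogMoment 2) (𝓝[>] 0) (𝓝 (1 / 2 + Real.pi ^ 2 / 12)) := by
  have h := tendsto_truncLogMoment (k := 2) (Or.inr rfl)
  rw [integral_log_sq_two_cos_mul_sin_sq] at h
  convert h using 2
  field_simp
  ring

theorem exists_interval_discrepancy {a : ℕ → ℝ} (hA2 : AssumptionA2 a) :
    ∃ τ : ℕ → ℝ, Tendsto τ atTop (𝓝 0) ∧ ∃ m₀ : ℕ, ∀ m N : ℕ, m₀ ≤ m → m ≤ N →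
      ∀ α β : ℝ, 0 ≤ α → α ≤ β → β ≤ Real.pi →
        |∑ p ∈ primesIoc m N, ((if α ≤ angle a p ∧ angle a p ≤ β then (1 : ℝ) else 0) -
          satoTateMass α β) / p| ≤ τ m := by
  classical
  obtain ⟨K, x₀, hK⟩ := hA2 2 two_pos
  obtain ⟨C, hC0, hC⟩ := exists_primeCounting_le
  set K' := C * |K| with hK'
  refine ⟨fun m => K' * (3 / (Real.log m * Real.log (Real.log m) ^ 2) + 1 / Real.log (Real.log m)),
    ?_, max 16 ⌈x₀⌉₊, ?_⟩
  · have h1 : Tendsto (fun m : ℕ => Real.log m) atTop atTop :=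
      Real.tendsto_log_atTop.comp tendsto_natCast_atTop_atTop
    have h2 : Tendsto (fun m : ℕ => Real.log (Real.log m)) atTop atTop :=
      Real.tendsto_log_atTop.comp h1
    have h3 := (h1.atTop_mul_atTop₀ ((tendsto_pow_atTop two_ne_zero).comp h2)).const_div_atTop 3
    have h4 := (h3.add (h2.const_div_atTop 1)).const_mul K'
    simpa using h4
  · intro m N hm hmN α β hα hαβ hβ
    have h16 : 16 ≤ m := le_of_max_le_left hm
    set c : ℕ → ℝ := fun n => if n.Prime then
      (if α ≤ angle a n ∧ angle a n ≤ β then (1 : ℝ) else 0) - satoTateMass α β else 0 with hc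
    have hsum : ∀ k, ∑ n ∈ Finset.Ioc 0 k, c n =
        (((Finset.Icc 1 k).filter (fun p => p.Prime ∧ α ≤ angle a p ∧ angle a p ≤ β)).card : ℝ) -
          satoTateMass α β * k.primeCounting := by
      intro k
      rw [← card_primesIoc_zero, primesIoc, hc, ← Finset.sum_filter, Finset.sum_sub_distrib,
        Finset.sum_const, nsmul_eq_mul, ← Finset.sum_filter, Finset.sum_const, nsmul_eq_mul,
        mul_one, Finset.filter_filter, mul_comm]
      rfl
    have := abs_sum_Ioc_div_le c (K := K') (by positivity) h16 hmN ?_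
    · refine le_trans (le_of_eq ?_) this
      rw [primesIoc, Finset.sum_filter]
      congr 1
      apply Finset.sum_congr rfl
      intro n _
      simp only [hc]
      split_ifs <;> simp
    · intro k hk
      have hk16 : 16 ≤ k := h16.trans hk
      have hkR : (16 : ℝ) ≤ k := by exact_mod_cast hk16
      have hx : x₀ ≤ k := (Nat.le_ceil x₀).trans (by
        exact_mod_cast (le_of_max_le_right hm).trans hk)
      have h1 := hK k hx α β hα hαβ hβ
      have hπ : (0 : ℝ) < k.primeCounting := by
        have : 0 < k.primeCounting := by
          rw [← card_primesIoc_zero, Finset.card_pos]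
          exact ⟨2, mem_primesIoc.2 ⟨⟨by norm_num, by omega⟩, Nat.prime_two⟩⟩
        exact_mod_cast this
      have hu := log_log_pos hk16
      have hl : 0 < Real.log k := Real.log_pos (by linarith)
      have hlog2 : Real.log (Real.log k) ≤ log₂ k := by
        unfold log₂ log₁
        refine le_trans ?_ (le_max_left _ _)
        exact Real.log_le_log hl (le_max_left _ _)
      have hrp : (log₂ k) ^ (-2 : ℝ) ≤ 1 / Real.log (Real.log k) ^ 2 := by
        rw [Real.rpow_neg (hu.le.trans hlog2), one_div]
        have : (log₂ (k : ℝ)) ^ (2 : ℝ) = log₂ k ^ 2 := by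
          rw [← Real.rpow_natCast]; norm_num
        rw [this]
        gcongr
      have h2 : |angleProportion a k α β - satoTateMass α β| ≤
          |K| * (1 / Real.log (Real.log k) ^ 2) := by
        refine h1.trans ?_
        have h0 : 0 ≤ (log₂ (k : ℝ)) ^ (-2 : ℝ) := Real.rpow_nonneg (hu.le.trans hlog2) _
        calc _ ≤ |K| * (log₂ k) ^ (-2 : ℝ) := by gcongr; exact le_abs_self K
          _ ≤ _ := by gcongr
      rw [hsum]
      rw [angleProportion, Nat.floor_natCast] at h2
      have e : (((Finset.Icc 1 k).filter
          (fun p => p.Prime ∧ α ≤ angle a p ∧ angle a p ≤ β)).card : ℝ) -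
          satoTateMass α β * k.primeCounting = k.primeCounting * ((((Finset.Icc 1 k).filter
          (fun p => p.Prime ∧ α ≤ angle a p ∧ angle a p ≤ β)).card : ℝ) / k.primeCounting -
          satoTateMass α β) := by
        field_simp
      rw [e, abs_mul, Nat.abs_cast]
      calc _ ≤ (C * (k / Real.log k)) * (|K| * (1 / Real.log (Real.log k) ^ 2)) := by
            gcongr
            exact hC k (by omega)
        _ = _ := by rw [hK']; field_simp

/-- The Sato–Tate mass of `{θ : |2 cos θ| ≤ s}`. -/
noncomputable def smallMass (s : ℝ) : ℝ :=
  satoTateMass (Real.arccos (s / 2)) (Real.arccos (-(s / 2)))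

theorem abs_le_iff_arccos {x s : ℝ} (hx : x ∈ Set.Icc (-2 : ℝ) 2) (hs0 : 0 ≤ s) (hs2 : s ≤ 2) :
    |x| ≤ s ↔ Real.arccos (s / 2) ≤ Real.arccos (x / 2) ∧
      Real.arccos (x / 2) ≤ Real.arccos (-(s / 2)) := by
  have h1 : x / 2 ∈ Set.Icc (-1 : ℝ) 1 := ⟨by linarith [hx.1], by linarith [hx.2]⟩
  have h2 : s / 2 ∈ Set.Icc (-1 : ℝ) 1 := ⟨by linarith, by linarith⟩
  have h3 : -(s / 2) ∈ Set.Icc (-1 : ℝ) 1 := ⟨by linarith, by linarith⟩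
  rw [Real.strictAntiOn_arccos.le_iff_ge h2 h1, Real.strictAntiOn_arccos.le_iff_ge h1 h3, abs_le]
  constructor
  · rintro ⟨h, h'⟩; constructor <;> linarith
  · rintro ⟨h, h'⟩; constructor <;> linarith

theorem exists_discrepancy {a : ℕ → ℝ} (ha : SatoTateClass a) (hA2 : AssumptionA2 a) :
    ∃ τ : ℕ → ℝ, Tendsto τ atTop (𝓝 0) ∧ ∃ m₀ : ℕ, ∀ m N : ℕ, m₀ ≤ m → m ≤ N →
      ∀ s ∈ Set.Icc (0 : ℝ) 2,
        |∑ p ∈ primesIoc m N, ((if |a p| ≤ s then (1 : ℝ) else 0) - smallMass s) / p| ≤ τ m := by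
  obtain ⟨τ, hτ, m₀, h⟩ := exists_interval_discrepancy hA2
  refine ⟨τ, hτ, m₀, fun m N hm hmN s hs => ?_⟩
  have h1 := h m N hm hmN _ _ (Real.arccos_nonneg (s / 2))
    (Real.arccos_le_arccos (by linarith [hs.1] : -(s / 2) ≤ s / 2)) (Real.arccos_le_pi _)
  refine le_trans (le_of_eq ?_) h1
  congr 1
  apply Finset.sum_congr rfl
  intro p hp
  rw [mem_primesIoc] at hp
  rw [if_congr (abs_le_iff_arccos (ha.mem_Icc p hp.2) hs.1 hs.2) rfl rfl]
  rfl

theorem smallMass_eq (s : ℝ) (hs : 0 ≤ s) (hs2 : s ≤ 2) :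
    smallMass s = 2 / Real.pi * ∫ θ in (0 : ℝ)..Real.pi,
      if |2 * Real.cos θ| ≤ s then Real.sin θ ^ 2 else 0 := by
  have hαβ : Real.arccos (s / 2) ≤ Real.arccos (-(s / 2)) :=
    Real.arccos_le_arccos (by linarith)
  rw [smallMass, satoTateMass, intervalIntegral.integral_of_le hαβ,
    intervalIntegral.integral_of_le Real.pi_pos.le,
    ← MeasureTheory.integral_Icc_eq_integral_Ioc, ← MeasureTheory.integral_Icc_eq_integral_Ioc]
  congr 1
  have hsub : Set.Icc (Real.arccos (s / 2)) (Real.arccos (-(s / 2))) ⊆ Set.Icc 0 Real.pi :=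
    Set.Icc_subset_Icc (Real.arccos_nonneg _) (Real.arccos_le_pi _)
  have e : ∫ θ in Set.Icc 0 Real.pi, (if |2 * Real.cos θ| ≤ s then Real.sin θ ^ 2 else 0) =
      ∫ θ in Set.Icc 0 Real.pi,
        (Set.Icc (Real.arccos (s / 2)) (Real.arccos (-(s / 2)))).indicator
          (fun θ => Real.sin θ ^ 2) θ := by
    apply MeasureTheory.setIntegral_congr_fun measurableSet_Icc
    intro θ hθ
    have h2 : 2 * Real.cos θ ∈ Set.Icc (-2 : ℝ) 2 :=
      ⟨by linarith [Real.neg_one_le_cos θ], by linarith [Real.cos_le_one θ]⟩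
    simp only [abs_le_iff_arccos h2 hs hs2, mul_div_cancel_left₀ _ (two_ne_zero' ℝ),
      Real.arccos_cos hθ.1 hθ.2, Set.indicator_apply, Set.mem_Icc]
  rw [e, MeasureTheory.setIntegral_indicator measurableSet_Icc, Set.inter_eq_right.2 hsub]

theorem smallMass_nonneg {s : ℝ} (hs : 0 ≤ s) : 0 ≤ smallMass s := by
  have hαβ : Real.arccos (s / 2) ≤ Real.arccos (-(s / 2)) :=
    Real.arccos_le_arccos (by linarith)
  refine mul_nonneg (by have := Real.pi_pos; positivity) ?_
  exact intervalIntegral.integral_nonneg hαβ fun t _ => sq_nonneg _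

theorem smallMass_le {s : ℝ} (hs : 0 ≤ s) (hs2 : s ≤ 2) : smallMass s ≤ s := by
  have hαβ : Real.arccos (s / 2) ≤ Real.arccos (-(s / 2)) :=
    Real.arccos_le_arccos (by linarith)
  have hp := Real.pi_pos
  have h1 : ∫ t in Real.arccos (s / 2)..Real.arccos (-(s / 2)), Real.sin t ^ 2 ≤
      2 * Real.arcsin (s / 2) := by
    have := intervalIntegral.integral_mono_on hαβ
      (Continuous.intervalIntegrable (by fun_prop) _ _ :
        IntervalIntegrable (fun t => Real.sin t ^ 2) MeasureTheory.volume _ _)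
      (intervalIntegrable_const : IntervalIntegrable (fun _ => (1 : ℝ)) MeasureTheory.volume _ _)
      fun t _ => Real.sin_sq_le_one t
    refine this.trans (le_of_eq ?_)
    rw [intervalIntegral.integral_const, Real.arccos_neg, Real.arccos_eq_pi_div_two_sub_arcsin]
    simp
    ring
  have h2 : 2 / Real.pi * Real.arcsin (s / 2) ≤ s / 2 := by
    have := Real.mul_le_sin (Real.arcsin_nonneg.2 (by linarith : 0 ≤ s / 2))
      (Real.arcsin_le_pi_div_two _)
    rwa [Real.sin_arcsin (by linarith) (by linarith)] at this
  rw [smallMass, satoTateMass]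
  calc _ ≤ 2 / Real.pi * (2 * Real.arcsin (s / 2)) := by gcongr
    _ ≤ s := by linarith

theorem continuous_smallMass : Continuous smallMass := by
  have e : smallMass = fun s => 2 / Real.pi *
      ((Real.sin (Real.arccos (s / 2)) * Real.cos (Real.arccos (s / 2)) -
        Real.sin (Real.arccos (-(s / 2))) * Real.cos (Real.arccos (-(s / 2))) +
        Real.arccos (-(s / 2)) - Real.arccos (s / 2)) / 2) := by
    funext s
    rw [smallMass, satoTateMass, integral_sin_sq]
  rw [e]
  have h1 : Continuous fun s : ℝ => Real.arccos (s / 2) :=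
    Real.continuous_arccos.comp (by fun_prop)
  have h2 : Continuous fun s : ℝ => Real.arccos (-(s / 2)) :=
    Real.continuous_arccos.comp (by fun_prop)
  fun_prop

/-- Layer-cake representation of `H (max x δ)`. -/
theorem integral_ite_le_eq {H h : ℝ → ℝ} {δ x : ℝ} (hδ2 : δ ≤ 2) (hx : x ≤ 2)
    (hH : ∀ s ∈ Set.Icc δ 2, HasDerivAt H (h s) s) (hh : ContinuousOn h (Set.Icc δ 2)) :
    ∫ s in δ..2, (if x ≤ s then h s else 0) = H 2 - H (max x δ) := by
  have hy2 : max x δ ≤ 2 := max_le hx hδ2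
  have hyδ : δ ≤ max x δ := le_max_right _ _
  rw [← intervalIntegral.integral_eq_sub_of_hasDerivAt (a := max x δ) (b := 2) (f' := h)]
  · rw [intervalIntegral.integral_of_le hδ2, intervalIntegral.integral_of_le hy2,
      ← MeasureTheory.integral_Icc_eq_integral_Ioc, ← MeasureTheory.integral_Icc_eq_integral_Ioc]
    have e : ∀ s, (if x ≤ s then h s else 0) = (Set.Ici x).indicator h s := fun s => by
      simp [Set.indicator_apply]
    simp only [e]
    rw [MeasureTheory.setIntegral_indicator measurableSet_Ici]
    congr 2
    ext s
    simp only [Set.mem_inter_iff, Set.mem_Icc, Set.mem_Ici, max_le_iff]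
    tauto
  · intro s hs
    rw [Set.uIcc_of_le hy2] at hs
    exact hH s ⟨hyδ.trans hs.1, hs.2⟩
  · apply ContinuousOn.intervalIntegrable
    rw [Set.uIcc_of_le hy2]
    exact hh.mono (Set.Icc_subset_Icc_left hyδ)

theorem intervalIntegrable_ite_le {h : ℝ → ℝ} {δ x : ℝ} (hδ2 : δ ≤ 2)
    (hh : ContinuousOn h (Set.Icc δ 2)) :
    IntervalIntegrable (fun s => if x ≤ s then h s else 0) MeasureTheory.volume δ 2 := by
  have h1 : IntervalIntegrable h MeasureTheory.volume δ 2 := by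
    apply ContinuousOn.intervalIntegrable
    rwa [Set.uIcc_of_le hδ2]
  rw [intervalIntegrable_iff_integrableOn_Ioc_of_le hδ2] at h1 ⊢
  have e : (fun s => if x ≤ s then h s else 0) = (Set.Ici x).indicator h := by
    funext s; simp [Set.indicator_apply]
  rw [e]
  exact h1.indicator measurableSet_Ici

/-- Discrepancy of `H (max |a_p| δ)` by the layer-cake formula. -/
theorem abs_sum_primes_sub_le {a : ℕ → ℝ} (ha : SatoTateClass a) {H h : ℝ → ℝ} {δ : ℝ}
    (hδ : 0 < δ) (hδ2 : δ ≤ 2) (hH : ∀ s ∈ Set.Icc δ 2, HasDerivAt H (h s) s)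
    (hh : ContinuousOn h (Set.Icc δ 2)) {m N : ℕ} {t : ℝ}
    (hd : ∀ s ∈ Set.Icc (0 : ℝ) 2,
        |∑ p ∈ primesIoc m N, ((if |a p| ≤ s then (1 : ℝ) else 0) - smallMass s) / p| ≤ t) :
    |∑ p ∈ primesIoc m N, H (max |a p| δ) / p -
      (H 2 - ∫ s in δ..2, smallMass s * h s) * ∑ p ∈ primesIoc m N, 1 / (p : ℝ)| ≤
      t * ∫ s in δ..2, |h s| := by
  have hm : IntervalIntegrable (fun s => smallMass s * h s) MeasureTheory.volume δ 2 := by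
    apply ContinuousOn.intervalIntegrable
    rw [Set.uIcc_of_le hδ2]
    exact continuous_smallMass.continuousOn.mul hh
  have key : ∀ p ∈ primesIoc m N, H (max |a p| δ) / p -
      (H 2 - ∫ s in δ..2, smallMass s * h s) * (1 / (p : ℝ)) =
      -∫ s in δ..2, ((if |a p| ≤ s then (1 : ℝ) else 0) - smallMass s) / p * h s := by
    intro p hp
    rw [mem_primesIoc] at hp
    have hap : |a p| ≤ 2 := abs_le.2 (ha.mem_Icc p hp.2)
    have h1 := integral_ite_le_eq hδ2 hap hH hh
    have e : ∀ s, ((if |a p| ≤ s then (1 : ℝ) else 0) - smallMass s) / p * h s =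
        (1 / (p : ℝ)) * ((if |a p| ≤ s then h s else 0) - smallMass s * h s) := by
      intro s
      split_ifs <;> ring
    simp only [e]
    rw [intervalIntegral.integral_const_mul, intervalIntegral.integral_sub
      (intervalIntegrable_ite_le hδ2 hh) hm, h1]
    ring
  rw [Finset.mul_sum, ← Finset.sum_sub_distrib, Finset.sum_congr rfl key, Finset.sum_neg_distrib,
    abs_neg, ← intervalIntegral.integral_finsetSum]
  · calc _ ≤ ∫ s in δ..2, t * |h s| := by
          rw [← Real.norm_eq_abs]
          refine intervalIntegral.norm_integral_le_of_norm_le hδ2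
            (Eventually.of_forall fun s hs => ?_) (IntervalIntegrable.const_mul ?_ _)
          · rw [← Finset.sum_mul, norm_mul, Real.norm_eq_abs, Real.norm_eq_abs]
            gcongr
            exact hd s ⟨hδ.le.trans hs.1.le, hs.2⟩
          · apply ContinuousOn.intervalIntegrable
            rw [Set.uIcc_of_le hδ2]
            exact hh.abs
      _ = _ := intervalIntegral.integral_const_mul _ _
  · intro p _
    have e : ∀ s, ((if |a p| ≤ s then (1 : ℝ) else 0) - smallMass s) / p * h s =
        (1 / (p : ℝ)) * ((if |a p| ≤ s then h s else 0) - smallMass s * h s) := by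
      intro s
      split_ifs <;> ring
    simp only [e]
    exact ((intervalIntegrable_ite_le hδ2 hh).sub hm).const_mul _

/-- The Sato–Tate mean of `H (max |2 cos θ| δ)`, by the layer-cake formula and Fubini. -/
theorem satoTate_mean_eq {H h : ℝ → ℝ} {δ : ℝ} (hδ : 0 < δ) (hδ2 : δ ≤ 2)
    (hH : ∀ s ∈ Set.Icc δ 2, HasDerivAt H (h s) s) (hh : ContinuousOn h (Set.Icc δ 2))
    (hmeas : Measurable h) :
    2 / Real.pi * ∫ θ in (0 : ℝ)..Real.pi, H (max |2 * Real.cos θ| δ) * Real.sin θ ^ 2 =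
      H 2 - ∫ s in δ..2, smallMass s * h s := by
  have hp := Real.pi_pos
  set G : ℝ → ℝ → ℝ := fun θ s => (if |2 * Real.cos θ| ≤ s then h s else 0) * Real.sin θ ^ 2
    with hG
  have hcos : ∀ θ, |2 * Real.cos θ| ≤ 2 := fun θ => by
    rw [abs_mul, abs_two]; linarith [Real.abs_cos_le_one θ]
  have hpt : ∀ θ, ∫ s in δ..2, G θ s = H 2 * Real.sin θ ^ 2 -
      H (max |2 * Real.cos θ| δ) * Real.sin θ ^ 2 := by
    intro θ
    rw [hG]
    simp only
    rw [intervalIntegral.integral_mul_const, integral_ite_le_eq hδ2 (hcos θ) hH hh]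
    ring
  obtain ⟨B, hB⟩ := isCompact_Icc.exists_bound_of_continuousOn hh
  have hint : MeasureTheory.Integrable (Function.uncurry G)
      ((MeasureTheory.volume.restrict (Set.Ioc 0 Real.pi)).prod
        (MeasureTheory.volume.restrict (Set.Ioc δ 2))) := by
    refine MeasureTheory.Integrable.mono' (g := fun _ => B) (MeasureTheory.integrable_const B) ?_ ?_
    · apply Measurable.aestronglyMeasurable
      apply Measurable.mul
      · apply Measurable.ite
        · exact measurableSet_le (by fun_prop) measurable_snd
        · exact hmeas.comp measurable_snd
        · exact measurable_const
      · fun_prop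
    · rw [MeasureTheory.Measure.prod_restrict, MeasureTheory.ae_restrict_iff'
        (measurableSet_Ioc.prod measurableSet_Ioc)]
      refine Eventually.of_forall ?_
      rintro ⟨θ, s⟩ ⟨-, hs⟩
      have hs' : ‖h s‖ ≤ B := hB s ⟨hs.1.le, hs.2⟩
      have hB0 : 0 ≤ B := (norm_nonneg _).trans hs'
      simp only [Function.uncurry, hG]
      rw [norm_mul, Real.norm_of_nonneg (sq_nonneg (Real.sin θ))]
      have h1 : ‖(if |2 * Real.cos θ| ≤ s then h s else 0)‖ ≤ B := by
        split_ifs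
        · exact hs'
        · simpa using hB0
      calc _ ≤ B * 1 := by gcongr; exact Real.sin_sq_le_one θ
        _ = B := mul_one B
  have hswap := MeasureTheory.integral_integral_swap hint
  simp only [← intervalIntegral.integral_of_le hδ2, ← intervalIntegral.integral_of_le hp.le]
    at hswap
  have hinner : ∀ s ∈ Set.uIcc δ 2, 2 / Real.pi * ∫ θ in (0 : ℝ)..Real.pi, G θ s =
      smallMass s * h s := by
    intro s hs
    rw [Set.uIcc_of_le hδ2] at hs
    rw [smallMass_eq s (hδ.le.trans hs.1) hs.2, mul_assoc, ← intervalIntegral.integral_mul_const]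
    congr 2
    funext θ
    simp only [hG]
    split_ifs
    · ring
    · ring
  have hlhs : ∫ s in δ..2, smallMass s * h s =
      2 / Real.pi * ∫ θ in (0 : ℝ)..Real.pi, ∫ s in δ..2, G θ s := by
    rw [hswap, ← intervalIntegral.integral_const_mul]
    exact (intervalIntegral.integral_congr hinner).symm
  have hHc : Continuous fun θ => H (max |2 * Real.cos θ| δ) := by
    have hHon : ContinuousOn H (Set.Icc δ 2) := fun s hs => (hH s hs).continuousAt.continuousWithinAt
    exact hHon.comp_continuous (by fun_prop) fun θ => ⟨le_max_right _ _, max_le (hcos θ) hδ2⟩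
  have hHs : Continuous fun θ => H (max |2 * Real.cos θ| δ) * Real.sin θ ^ 2 :=
    hHc.mul (Real.continuous_sin.pow 2)
  simp only [hpt] at hlhs
  rw [hlhs, intervalIntegral.integral_sub (Continuous.intervalIntegrable (by fun_prop) _ _)
    (hHs.intervalIntegrable _ _),
    intervalIntegral.integral_const_mul, integral_sin_sq]
  simp
  field_simp
  ring

theorem truncLogMoment_one_eq {δ : ℝ} (hδ : 0 < δ) (hδ2 : δ ≤ 2) :
    truncLogMoment 1 δ = Real.log 2 - ∫ s in δ..2, smallMass s * s⁻¹ := by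
  rw [truncLogMoment]
  simp only [pow_one]
  refine satoTate_mean_eq hδ hδ2 (fun s hs => Real.hasDerivAt_log (by linarith [hs.1])) ?_
    measurable_inv
  exact continuousOn_inv₀.mono fun s hs => by
    have := hs.1
    simp only [Set.mem_compl_iff, Set.mem_singleton_iff]; linarith

theorem abs_truncLogMoment_one_add_le {δ : ℝ} (hδ : 0 < δ) (hδ2 : δ ≤ 2) :
    |truncLogMoment 1 δ + 1 / 2| ≤ δ := by
  have h1 : Tendsto (fun δ' => |truncLogMoment 1 δ - truncLogMoment 1 δ'|) (𝓝[>] 0)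
      (𝓝 |truncLogMoment 1 δ - -(1 / 2)|) :=
    (tendsto_const_nhds.sub tendsto_truncLogMoment_one).abs
  rw [sub_neg_eq_add] at h1
  refine le_of_tendsto h1 ?_
  filter_upwards [Ioo_mem_nhdsGT hδ] with δ' hδ'
  have hI : ∀ u v : ℝ, 0 < u → u ≤ v →
      IntervalIntegrable (fun s => smallMass s * s⁻¹) MeasureTheory.volume u v := by
    intro u v hu huv
    apply ContinuousOn.intervalIntegrable
    rw [Set.uIcc_of_le huv]
    refine continuous_smallMass.continuousOn.mul (continuousOn_inv₀.mono fun s hs => ?_)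
    have := hs.1
    simp only [Set.mem_compl_iff, Set.mem_singleton_iff]; linarith
  rw [truncLogMoment_one_eq hδ hδ2, truncLogMoment_one_eq hδ'.1 (hδ'.2.le.trans hδ2),
    ← intervalIntegral.integral_add_adjacent_intervals (hI δ' δ hδ'.1 hδ'.2.le) (hI δ 2 hδ hδ2)]
  have h2 : ‖∫ s in δ'..δ, smallMass s * s⁻¹‖ ≤ ∫ s in δ'..δ, (1 : ℝ) := by
    refine intervalIntegral.norm_integral_le_of_norm_le hδ'.2.le
      (Eventually.of_forall fun s hs => ?_) intervalIntegrable_const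
    have hs0 : 0 < s := hδ'.1.trans hs.1
    have := smallMass_le hs0.le (hs.2.trans hδ2)
    have h3 := smallMass_nonneg hs0.le
    rw [Real.norm_of_nonneg (by positivity), ← div_eq_mul_inv, div_le_one hs0]
    exact this
  rw [intervalIntegral.integral_const, smul_eq_mul, mul_one, Real.norm_eq_abs] at h2
  calc _ = |∫ s in δ'..δ, smallMass s * s⁻¹| := by congr 1; ring
    _ ≤ δ := by linarith [hδ'.1]

theorem integral_inv_eq_log_div {δ : ℝ} (hδ : 0 < δ) :
    ∫ s in δ..2, s⁻¹ = Real.log (2 / δ) := integral_inv_of_pos hδ two_pos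

theorem abs_sum_log_sub_le {a : ℕ → ℝ} (ha : SatoTateClass a) {δ : ℝ}
    (hδ : 0 < δ) (hδ1 : δ < 1) {m N : ℕ} {t : ℝ}
    (hd : ∀ s ∈ Set.Icc (0 : ℝ) 2,
        |∑ p ∈ primesIoc m N, ((if |a p| ≤ s then (1 : ℝ) else 0) - smallMass s) / p| ≤ t) :
    |∑ p ∈ primesIoc m N, Real.log (max |a p| δ) / p -
      truncLogMoment 1 δ * ∑ p ∈ primesIoc m N, 1 / (p : ℝ)| ≤ t * Real.log (2 / δ) := by
  have hδ2 : δ ≤ 2 := by linarith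
  rw [truncLogMoment_one_eq hδ hδ2, ← integral_inv_eq_log_div hδ]
  have hpos : ∀ s ∈ Set.Icc δ 2, 0 < s := fun s hs => hδ.trans_le hs.1
  have := abs_sum_primes_sub_le ha hδ hδ2 (fun s hs => Real.hasDerivAt_log (hpos s hs).ne')
    (continuousOn_inv₀.mono fun s hs => (hpos s hs).ne') hd
  refine this.trans (le_of_eq ?_)
  congr 1
  apply intervalIntegral.integral_congr
  intro s hs
  rw [Set.uIcc_of_le hδ2] at hs
  exact abs_of_pos (inv_pos.2 (hpos s hs))

theorem abs_sum_log_sq_sub_le {a : ℕ → ℝ} (ha : SatoTateClass a) {δ : ℝ}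
    (hδ : 0 < δ) (hδ1 : δ < 1) {m N : ℕ} {t : ℝ} (ht : 0 ≤ t)
    (hd : ∀ s ∈ Set.Icc (0 : ℝ) 2,
        |∑ p ∈ primesIoc m N, ((if |a p| ≤ s then (1 : ℝ) else 0) - smallMass s) / p| ≤ t) :
    |∑ p ∈ primesIoc m N, Real.log (max |a p| δ) ^ 2 / p -
      truncLogMoment 2 δ * ∑ p ∈ primesIoc m N, 1 / (p : ℝ)| ≤
      t * (2 * (1 + |Real.log δ|) * Real.log (2 / δ)) := by
  have hδ2 : δ ≤ 2 := by linarith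
  have hpos : ∀ s ∈ Set.Icc δ 2, 0 < s := fun s hs => hδ.trans_le hs.1
  have hder : ∀ s ∈ Set.Icc δ 2,
      HasDerivAt (fun s => Real.log s ^ 2) (2 * Real.log s * s⁻¹) s := by
    intro s hs
    refine ((Real.hasDerivAt_log (hpos s hs).ne').fun_pow 2).congr_deriv ?_
    simp
  have hcont : ContinuousOn (fun s => 2 * Real.log s * s⁻¹) (Set.Icc δ 2) := by
    apply ContinuousOn.mul
    · exact continuousOn_const.mul
        (Real.continuousOn_log.mono fun s hs => (hpos s hs).ne')
    · exact continuousOn_inv₀.mono fun s hs => (hpos s hs).ne'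
  have e : truncLogMoment 2 δ =
      Real.log 2 ^ 2 - ∫ s in δ..2, smallMass s * (2 * Real.log s * s⁻¹) := by
    rw [truncLogMoment]
    exact satoTate_mean_eq hδ hδ2 hder hcont
      ((Real.measurable_log.const_mul 2).mul measurable_inv)
  rw [e]
  refine (abs_sum_primes_sub_le ha hδ hδ2 hder hcont hd).trans ?_
  gcongr
  rw [← integral_inv_eq_log_div hδ, ← intervalIntegral.integral_const_mul]
  apply intervalIntegral.integral_mono_on hδ2
  · apply ContinuousOn.intervalIntegrable
    rw [Set.uIcc_of_le hδ2]
    exact hcont.abs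
  · apply ContinuousOn.intervalIntegrable
    rw [Set.uIcc_of_le hδ2]
    exact continuousOn_const.mul (continuousOn_inv₀.mono fun s hs => (hpos s hs).ne')
  · intro s hs
    have hs0 := hpos s hs
    rw [abs_mul, abs_mul, abs_two, abs_of_pos (inv_pos.2 hs0)]
    gcongr
    have h1 := Real.log_le_log hδ hs.1
    have h2 := Real.log_le_log hs0 hs.2
    have h3 := Real.log_two_lt_d9
    rw [abs_le]
    constructor <;> linarith [neg_abs_le (Real.log δ), abs_nonneg (Real.log δ)]

theorem card_filter_exists_dvd_le (N : ℕ) (T : Finset ℕ) (e : ℕ → ℕ) :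
    (((Finset.Icc 1 N).filter (fun n => ∃ p ∈ T, e p ∣ n)).card : ℝ) ≤
      N * ∑ p ∈ T, 1 / (e p : ℝ) := by
  classical
  have hsub : (Finset.Icc 1 N).filter (fun n => ∃ p ∈ T, e p ∣ n) ⊆
      T.biUnion fun p => (Finset.Ioc 0 N).filter (fun n => e p ∣ n) := by
    intro n hn
    simp only [Finset.mem_filter, Finset.mem_Icc, Finset.mem_biUnion, Finset.mem_Ioc] at *
    obtain ⟨h1, p, hp, hd⟩ := hn
    exact ⟨p, hp, ⟨by omega, h1.2⟩, hd⟩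
  have h1 := (Finset.card_le_card hsub).trans Finset.card_biUnion_le
  simp only [Nat.Ioc_filter_dvd_card_eq_div] at h1
  calc _ ≤ ((∑ p ∈ T, N / e p : ℕ) : ℝ) := by exact_mod_cast h1
    _ ≤ _ := by
      push_cast
      rw [Finset.mul_sum]
      refine Finset.sum_le_sum fun p _ => ?_
      rw [mul_one_div]
      exact Nat.cast_div_le

theorem sum_primesIoc_inv_sq_le {m N : ℕ} (hm : m ≠ 0) (hmN : m ≤ N) :
    ∑ p ∈ primesIoc m N, 1 / ((p ^ 2 : ℕ) : ℝ) ≤ 1 / m := by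
  have h := sum_Ioc_inv_sq_le_sub (α := ℝ) hm hmN
  have h2 : ∑ p ∈ primesIoc m N, 1 / ((p ^ 2 : ℕ) : ℝ) ≤
      ∑ i ∈ Finset.Ioc m N, ((i : ℝ) ^ 2)⁻¹ := by
    simp only [Nat.cast_pow, one_div]
    exact Finset.sum_le_sum_of_subset_of_nonneg (Finset.filter_subset _ _)
      fun i _ _ => by positivity
  have h3 : (0 : ℝ) ≤ (N : ℝ)⁻¹ := by positivity
  rw [one_div]
  linarith

/-- The primes in `(m, N]` with `|a_p| ≤ s`. -/
noncomputable def smallPrimes (a : ℕ → ℝ) (m N : ℕ) (s : ℝ) : Finset ℕ :=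
  (primesIoc m N).filter (fun p => |a p| ≤ s)

theorem sum_smallPrimes_le {a : ℕ → ℝ} {m N : ℕ} {t s : ℝ} (hs : 0 ≤ s) (hs2 : s ≤ 2)
    (hd : ∀ s ∈ Set.Icc (0 : ℝ) 2,
        |∑ p ∈ primesIoc m N, ((if |a p| ≤ s then (1 : ℝ) else 0) - smallMass s) / p| ≤ t) :
    ∑ p ∈ smallPrimes a m N s, 1 / (p : ℝ) ≤ t + s * ∑ p ∈ primesIoc m N, 1 / (p : ℝ) := by
  have h1 := (abs_le.1 (hd s ⟨hs, hs2⟩)).2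
  have e : ∑ p ∈ primesIoc m N, ((if |a p| ≤ s then (1 : ℝ) else 0) - smallMass s) / p =
      ∑ p ∈ smallPrimes a m N s, 1 / (p : ℝ) -
        smallMass s * ∑ p ∈ primesIoc m N, 1 / (p : ℝ) := by
    rw [smallPrimes, Finset.sum_filter, Finset.mul_sum, ← Finset.sum_sub_distrib]
    apply Finset.sum_congr rfl
    intro p _
    split_ifs <;> ring
  rw [e] at h1
  have h2 : smallMass s * ∑ p ∈ primesIoc m N, 1 / (p : ℝ) ≤
      s * ∑ p ∈ primesIoc m N, 1 / (p : ℝ) :=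
    mul_le_mul_of_nonneg_right (smallMass_le hs hs2) (Finset.sum_nonneg fun p _ => by positivity)
  linarith

theorem tendsto_log_log_natCast : Tendsto (fun N : ℕ => Real.log (Real.log N)) atTop atTop :=
  Real.tendsto_log_atTop.comp (Real.tendsto_log_atTop.comp tendsto_natCast_atTop_atTop)

theorem exists_sum_primesIoc_bound :
    ∃ C : ℝ, 0 ≤ C ∧ ∀ m N : ℕ, 2 ≤ N → m ≤ N →
      |∑ p ∈ primesIoc m N, 1 / (p : ℝ) - Real.log (Real.log N)| ≤ C + m := by
  obtain ⟨C, hC0, hC⟩ := exists_mertens_second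
  refine ⟨C, hC0, fun m N hN hmN => ?_⟩
  have h1 := hC N hN
  rw [primesIoc_union (Nat.zero_le m) hmN] at h1
  have h2 : 0 ≤ ∑ p ∈ primesIoc 0 m, 1 / (p : ℝ) := Finset.sum_nonneg fun p _ => by positivity
  have h3 : ∑ p ∈ primesIoc 0 m, 1 / (p : ℝ) ≤ m := by
    calc _ ≤ ∑ p ∈ primesIoc 0 m, (1 : ℝ) := by
          refine Finset.sum_le_sum fun p hp => ?_
          rw [mem_primesIoc] at hp
          have : (1 : ℝ) ≤ p := by exact_mod_cast hp.2.one_lt.le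
          rw [div_le_one (by linarith)]
          exact this
      _ ≤ m := by
          rw [Finset.sum_const, nsmul_eq_mul, mul_one]
          have : (primesIoc 0 m).card ≤ (Finset.Ioc 0 m).card :=
            Finset.card_le_card (Finset.filter_subset _ _)
          rw [Nat.card_Ioc] at this
          exact_mod_cast this
  rw [abs_le] at h1 ⊢
  constructor <;> linarith [h1.1, h1.2]

theorem SatoTateClass.map_one {a : ℕ → ℝ} (ha : SatoTateClass a) (hA2 : AssumptionA2 a) :
    a 1 = 1 := by
  have h1 := ha.multiplicative 1 1 one_pos one_pos (Nat.coprime_one_left 1)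
  rw [mul_one] at h1
  by_contra hne
  have h0 : a 1 = 0 := by
    have : a 1 * (a 1 - 1) = 0 := by linarith
    exact (mul_eq_zero.1 this).resolve_right (sub_ne_zero.2 hne)
  obtain ⟨τ, -, m₀, h⟩ := exists_discrepancy ha hA2
  obtain ⟨C, -, hC⟩ := exists_sum_primesIoc_bound
  obtain ⟨N, hN1, hN2, hN3⟩ := ((tendsto_log_log_natCast.eventually_gt_atTop (C + m₀ + τ m₀)).and
    ((eventually_ge_atTop 2).and (eventually_ge_atTop m₀))).exists
  have h2 := sum_smallPrimes_le (s := 0) le_rfl zero_le_two (h m₀ N le_rfl hN3)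
  have h3 : smallPrimes a m₀ N 0 = primesIoc m₀ N := by
    rw [smallPrimes, Finset.filter_true_of_mem]
    intro p hp
    have := ha.multiplicative 1 p one_pos (mem_primesIoc.1 hp).2.pos (Nat.coprime_one_left p)
    rw [one_mul, h0, zero_mul] at this
    rw [this, abs_zero]
  rw [h3, zero_mul, add_zero] at h2
  have := (abs_le.1 (hC m₀ N hN2 hN3)).1
  linarith

theorem map_prod_primes {a : ℕ → ℝ} (ha : SatoTateClass a) (h1 : a 1 = 1) {T : Finset ℕ}
    (hT : ∀ p ∈ T, p.Prime) : a (∏ p ∈ T, p) = ∏ p ∈ T, a p := by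
  induction T using Finset.induction_on with
  | empty => simpa using h1
  | insert p T hp ih =>
    have hT' : ∀ q ∈ T, q.Prime := fun q hq => hT q (Finset.mem_insert_of_mem hq)
    have hpp := hT p (Finset.mem_insert_self p T)
    rw [Finset.prod_insert hp, Finset.prod_insert hp, ← ih hT']
    apply ha.multiplicative _ _ hpp.pos (Finset.prod_pos fun q hq => (hT' q hq).pos)
    apply Nat.Coprime.prod_right
    intro q hq
    rw [Nat.coprime_primes hpp (hT' q hq)]
    rintro rfl
    exact hp hq

/-- Splitting off the part of `n` composed of primes `≤ m`. -/
theorem map_eq_map_gcd_mul_prod {a : ℕ → ℝ} (ha : SatoTateClass a) (h1 : a 1 = 1)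
    {m K N n : ℕ} (hn : n ∈ Finset.Icc 1 N)
    (hsq : ∀ p ∈ primesIoc m N, ¬p ^ 2 ∣ n) (hK : ∀ p ∈ primesIoc 0 m, ¬p ^ (K + 1) ∣ n) :
    a n = a (n.gcd (m.factorial ^ K)) * ∏ p ∈ (primesIoc m N).filter (· ∣ n), a p := by
  rw [Finset.mem_Icc] at hn
  set Q := m.factorial ^ K with hQ
  have hQ0 : Q ≠ 0 := pow_ne_zero _ m.factorial_ne_zero
  obtain ⟨k, hk⟩ := Nat.gcd_dvd_left n Q
  set d := n.gcd Q with hd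
  have hd0 : 0 < d := Nat.gcd_pos_of_pos_left _ hn.1
  have hk0 : 0 < k := Nat.pos_of_ne_zero (by rintro rfl; omega)
  have hkn : k ∣ n := ⟨d, by rw [mul_comm]; exact hk⟩
  have hcop : k.Coprime Q := by
    apply Nat.coprime_of_dvd
    intro p hp hpk hpQ
    have hpm : p ≤ m := (hp.dvd_factorial).1 (hp.dvd_of_dvd_pow hpQ)
    have hpK : p ^ K ∣ Q := pow_dvd_pow_of_dvd ((hp.dvd_factorial).2 hpm) K
    have hnK := hK p (mem_primesIoc.2 ⟨⟨hp.pos, hpm⟩, hp⟩)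
    have hfac : n.factorization p ≤ K := by
      by_contra hlt
      exact hnK ((hp.pow_dvd_iff_le_factorization (by omega)).2 (by omega))
    have h2 : p ^ n.factorization p ∣ d :=
      Nat.dvd_gcd (Nat.ordProj_dvd n p) ((pow_dvd_pow p hfac).trans hpK)
    have h3 : p ^ (n.factorization p + 1) ∣ n := by
      have := mul_dvd_mul h2 hpk
      rwa [← pow_succ, ← hk] at this
    exact Nat.pow_succ_factorization_not_dvd (by omega) hp h3
  have hdk : d.Coprime k := (hcop.coprime_dvd_right (Nat.gcd_dvd_right n Q)).symm
  have hgt : ∀ p, p.Prime → p ∣ k → m < p := by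
    intro p hp hpk
    by_contra hle
    have hpQ : p ∣ m.factorial := (hp.dvd_factorial).2 (by omega)
    rcases Nat.eq_zero_or_pos K with rfl | hK0
    · apply hK p (mem_primesIoc.2 ⟨⟨hp.pos, by omega⟩, hp⟩)
      rw [zero_add, pow_one]
      exact hpk.trans hkn
    · have h4 : p ∣ Q := hpQ.trans (dvd_pow_self _ hK0.ne')
      exact hp.one_lt.ne' (Nat.dvd_one.1 (hcop ▸ Nat.dvd_gcd hpk h4))
  have hmem : ∀ p, p.Prime → p ∣ k → p ∈ primesIoc m N := fun p hp hpk =>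
    mem_primesIoc.2 ⟨⟨hgt p hp hpk, (Nat.le_of_dvd hk0 hpk).trans
      ((Nat.le_of_dvd hn.1 hkn).trans hn.2)⟩, hp⟩
  have hsf : Squarefree k := by
    rw [Nat.squarefree_iff_prime_squarefree]
    intro p hp hpp
    apply hsq p (hmem p hp (dvd_of_mul_left_dvd hpp))
    rw [pow_two]
    exact hpp.trans hkn
  have hpf : (primesIoc m N).filter (· ∣ n) = k.primeFactors := by
    ext p
    rw [Finset.mem_filter, Nat.mem_primeFactors]
    constructor
    · rintro ⟨hp, hpn⟩
      rw [mem_primesIoc] at hp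
      refine ⟨hp.2, ?_, hk0.ne'⟩
      rw [hk] at hpn
      refine (hp.2.dvd_mul.1 hpn).resolve_left fun hpd => ?_
      have := (hp.2.dvd_factorial).1 (hp.2.dvd_of_dvd_pow (hpd.trans (Nat.gcd_dvd_right n Q)))
      omega
    · rintro ⟨hp, hpk, -⟩
      exact ⟨hmem p hp hpk, hpk.trans hkn⟩
  rw [hpf, ← map_prod_primes ha h1 fun p hp => Nat.prime_of_mem_primeFactors hp,
    Nat.prod_primeFactors_of_squarefree hsf, ← ha.multiplicative d k hd0 hk0 hdk, ← hk]

theorem periodic_map_gcd_ne_zero (a : ℕ → ℝ) (Q : ℕ) :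
    Function.Periodic (fun n => a (n.gcd Q) ≠ 0) Q := by
  intro n
  simp only [Nat.gcd_add_self_left]

theorem card_primesIoc_le (m N : ℕ) : (primesIoc m N).card ≤ N.primeCounting := by
  rw [← card_primesIoc_zero]
  apply Finset.card_le_card
  intro p hp
  rw [mem_primesIoc] at *
  exact ⟨⟨hp.2.pos, hp.1.2⟩, hp.2⟩

theorem tendsto_primeCounting_div : Tendsto (fun N : ℕ => (N.primeCounting : ℝ) / N) atTop (𝓝 0) := by
  obtain ⟨C, hC0, hC⟩ := exists_primeCounting_le
  have h1 : Tendsto (fun N : ℕ => C / Real.log N) atTop (𝓝 0) :=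
    (Real.tendsto_log_atTop.comp tendsto_natCast_atTop_atTop).const_div_atTop C
  refine squeeze_zero' (Eventually.of_forall fun N => by positivity) ?_ h1
  filter_upwards [eventually_ge_atTop 2] with N hN
  have hN0 : (0 : ℝ) < N := by exact_mod_cast (by omega : 0 < N)
  rw [div_le_iff₀ hN0]
  refine (hC N hN).trans (le_of_eq ?_)
  ring

/-- The non-vanishing set has positive lower density. -/
theorem exists_le_card_nonvanishing {a : ℕ → ℝ} (ha : SatoTateClass a) (hA2 : AssumptionA2 a) :
    ∃ κ : ℝ, 0 < κ ∧ ∀ᶠ N : ℕ in atTop, κ * N ≤ (nonvanishing a N).card := by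
  classical
  have h1 := ha.map_one hA2
  obtain ⟨τ, hτ, m₀, hd⟩ := exists_discrepancy ha hA2
  obtain ⟨m, hm1, hm2, hm3⟩ := ((hτ.eventually_le_const (show (0 : ℝ) < 1 / 4 by norm_num)).and
    ((eventually_ge_atTop m₀).and (eventually_ge_atTop 4))).exists
  set Q := m.factorial with hQ
  have hQ0 : 0 < Q := m.factorial_pos
  have hQR : (1 : ℝ) ≤ Q := by exact_mod_cast hQ0
  set W : ℕ → Prop := fun n => n ≡ 1 [MOD Q] with hW
  have hper : Function.Periodic W Q := by
    intro n
    simp [hW, Nat.ModEq]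
  have hcount : (1 : ℝ) ≤ Q.count W := by
    have : 0 < Q.count W := by
      rw [Nat.count_eq_card_filter_range, Finset.card_pos]
      refine ⟨1 % Q, ?_⟩
      rw [Finset.mem_filter, Finset.mem_range]
      exact ⟨Nat.mod_lt _ hQ0, Nat.mod_modEq 1 Q⟩
    exact_mod_cast this
  refine ⟨1 / (8 * Q), by positivity, ?_⟩
  have hsqrt : Tendsto (fun N : ℕ => √(N : ℝ) / N) atTop (𝓝 0) := by
    have : Tendsto (fun N : ℕ => 1 / √(N : ℝ)) atTop (𝓝 0) :=
      (Real.tendsto_sqrt_atTop.comp tendsto_natCast_atTop_atTop).const_div_atTop 1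
    simpa only [Real.sqrt_div_self', one_div] using this
  have herr : Tendsto (fun N : ℕ => 3 * Q * ((N.primeCounting : ℝ) / N + √(N : ℝ) / N) +
      Q / (N : ℝ)) atTop (𝓝 (3 * Q * (0 + 0) + 0)) :=
    ((tendsto_primeCounting_div.add hsqrt).const_mul _).add
      (tendsto_natCast_atTop_atTop.const_div_atTop _)
  rw [add_zero, add_zero, mul_zero] at herr
  filter_upwards [herr.eventually_lt_const (show (0 : ℝ) < 1 / (8 * Q) by positivity),
    eventually_ge_atTop m, eventually_gt_atTop 0] with N hN hNm hN0
  have hNR : (0 : ℝ) < N := by exact_mod_cast hN0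
  set WN := (Finset.Icc 1 N).filter W with hWN
  have hWcard : (N : ℝ) / Q - Q ≤ WN.card := by
    have h2 := (abs_le.1 (card_filter_periodic_bounds Q hQ0 W hper N)).1
    have h3 : (N : ℝ) / Q ≤ (Q.count W : ℝ) * N / Q := by
      apply div_le_div_of_nonneg_right _ (by positivity)
      nlinarith
    linarith
  have hcopr : ∀ p ∈ primesIoc m N, p.Coprime Q := by
    intro p hp
    rw [mem_primesIoc] at hp
    exact (hp.2.coprime_iff_not_dvd).2 fun h => by
      have := (hp.2.dvd_factorial).1 h
      omega
  set T := smallPrimes a m N 0 with hT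
  have hTsub : T ⊆ primesIoc m N := Finset.filter_subset _ _
  set s := Nat.sqrt N with hs
  set U := primesIoc m s with hU
  have hsN : s ≤ N := Nat.sqrt_le_self N
  have hUsub : U ⊆ primesIoc m N := by
    intro p hp
    rw [hU, mem_primesIoc] at hp
    exact mem_primesIoc.2 ⟨⟨hp.1.1, hp.1.2.trans hsN⟩, hp.2⟩
  have hsub : WN ⊆ nonvanishing a N ∪
      (T.biUnion (fun p => (Finset.Icc 1 N).filter (fun n => W n ∧ p ∣ n)) ∪
        U.biUnion (fun p => (Finset.Icc 1 N).filter (fun n => W n ∧ p ^ 2 ∣ n))) := by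
    intro n hn
    rw [hWN, Finset.mem_filter] at hn
    by_contra hcon
    simp only [Finset.mem_union, Finset.mem_biUnion, Finset.mem_filter, not_or, not_exists,
      not_and] at hcon
    obtain ⟨hc1, hc2, hc3⟩ := hcon
    have hn1 := Finset.mem_Icc.1 hn.1
    have hcop : n.Coprime Q := by
      have : Nat.gcd n Q = Nat.gcd 1 Q := hn.2.gcd_eq
      rwa [Nat.gcd_one_left] at this
    have hfac := map_eq_map_gcd_mul_prod ha h1 (m := m) (K := 1) hn.1 ?_ ?_
    · apply hc1
      rw [nonvanishing, Nat.floor_natCast, Finset.mem_filter]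
      refine ⟨hn.1, ?_⟩
      rw [hfac, pow_one, hcop.gcd_eq_one, h1, one_mul, Finset.prod_ne_zero_iff]
      intro p hp h0
      rw [Finset.mem_filter] at hp
      refine hc2 p ?_ hn.1 hn.2 hp.2
      rw [hT, smallPrimes, Finset.mem_filter]
      exact ⟨hp.1, by rw [h0, abs_zero]⟩
    · intro p hp hpn
      refine hc3 p ?_ hn.1 hn.2 hpn
      rw [mem_primesIoc] at hp
      rw [hU, mem_primesIoc]
      refine ⟨⟨hp.1.1, ?_⟩, hp.2⟩
      rw [hs, Nat.le_sqrt']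
      exact (Nat.le_of_dvd hn1.1 hpn).trans hn1.2
    · intro p hp hpn
      rw [mem_primesIoc] at hp
      have h5 : p ∣ n := (dvd_pow_self p (by norm_num)).trans hpn
      have h6 : p ∣ Q := (hp.2.dvd_factorial).2 hp.1.2
      exact hp.2.one_lt.ne' (Nat.dvd_one.1 (hcop ▸ Nat.dvd_gcd h5 h6))
  have hcard := (Finset.card_le_card hsub).trans ((Finset.card_union_le _ _).trans
    (Nat.add_le_add_left (Finset.card_union_le _ _) _))
  have hb1 : ((T.biUnion (fun p => (Finset.Icc 1 N).filter (fun n => W n ∧ p ∣ n))).card : ℝ) ≤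
      WN.card * (1 / 4) + 3 * Q * N.primeCounting := by
    calc _ ≤ ∑ p ∈ T, (((Finset.Icc 1 N).filter (fun n => W n ∧ p ∣ n)).card : ℝ) := by
          exact_mod_cast Finset.card_biUnion_le
      _ ≤ ∑ p ∈ T, (WN.card * (1 / (p : ℝ)) + 3 * Q) := by
          refine Finset.sum_le_sum fun p hp => ?_
          have hp' := hTsub hp
          have := (abs_le.1 (abs_card_filter_dvd_sub_le Q hQ0 W hper (hcopr p hp')
            (mem_primesIoc.1 hp').2.pos N)).2
          rw [mul_one_div]
          linarith
      _ ≤ _ := by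
          rw [Finset.sum_add_distrib, ← Finset.mul_sum, Finset.sum_const, nsmul_eq_mul, mul_comm _ (3 * (Q : ℝ))]
          have h2 := sum_smallPrimes_le (s := 0) le_rfl zero_le_two (hd m N hm2 hNm)
          rw [zero_mul, add_zero] at h2
          have h3 : (T.card : ℝ) ≤ N.primeCounting := by
            exact_mod_cast (Finset.card_le_card hTsub).trans (card_primesIoc_le m N)
          gcongr
          exact h2.trans hm1
  have hb2 : ((U.biUnion (fun p => (Finset.Icc 1 N).filter (fun n => W n ∧ p ^ 2 ∣ n))).card : ℝ) ≤
      WN.card * (1 / 4) + 3 * Q * √N := by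
    calc _ ≤ ∑ p ∈ U, (((Finset.Icc 1 N).filter (fun n => W n ∧ p ^ 2 ∣ n)).card : ℝ) := by
          exact_mod_cast Finset.card_biUnion_le
      _ ≤ ∑ p ∈ U, (WN.card * (1 / ((p ^ 2 : ℕ) : ℝ)) + 3 * Q) := by
          refine Finset.sum_le_sum fun p hp => ?_
          have hp' := hUsub hp
          have := (abs_le.1 (abs_card_filter_dvd_sub_le Q hQ0 W hper
            (Nat.Coprime.pow_left 2 (hcopr p hp'))
            (pow_pos (mem_primesIoc.1 hp').2.pos 2) N)).2
          rw [mul_one_div]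
          linarith
      _ ≤ _ := by
          rw [Finset.sum_add_distrib, ← Finset.mul_sum, Finset.sum_const, nsmul_eq_mul, mul_comm _ (3 * (Q : ℝ))]
          have h2 : ∑ p ∈ U, 1 / ((p ^ 2 : ℕ) : ℝ) ≤ 1 / 4 := by
            calc _ ≤ ∑ p ∈ primesIoc m N, 1 / ((p ^ 2 : ℕ) : ℝ) :=
                  Finset.sum_le_sum_of_subset_of_nonneg hUsub fun p _ _ => by positivity
              _ ≤ 1 / (m : ℝ) := sum_primesIoc_inv_sq_le (by omega) hNm
              _ ≤ 1 / 4 := by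
                apply one_div_le_one_div_of_le (by norm_num)
                exact_mod_cast hm3
          have h3 : (U.card : ℝ) ≤ √N := by
            have : U.card ≤ s := by
              refine (Finset.card_le_card (Finset.filter_subset _ _)).trans ?_
              rw [Nat.card_Ioc]; omega
            exact le_trans (by exact_mod_cast this) (Real.nat_sqrt_le_real_sqrt)
          gcongr
  have hcardR : (WN.card : ℝ) ≤ (nonvanishing a N).card +
      ((T.biUnion (fun p => (Finset.Icc 1 N).filter (fun n => W n ∧ p ∣ n))).card +
      (U.biUnion (fun p => (Finset.Icc 1 N).filter (fun n => W n ∧ p ^ 2 ∣ n))).card) := by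
    exact_mod_cast hcard
  have hfin : 3 * Q * ((N.primeCounting : ℝ) + √N) + Q ≤ 1 / (8 * Q) * N := by
    have e : 3 * Q * ((N.primeCounting : ℝ) + √N) + Q =
        (3 * Q * ((N.primeCounting : ℝ) / N + √(N : ℝ) / N) + Q / (N : ℝ)) * N := by
      field_simp
    rw [e]
    gcongr
  have e2 : (N : ℝ) / Q = 8 * (1 / (8 * Q) * N) := by field_simp
  rw [e2] at hWcard
  have h8 : 0 ≤ 1 / (8 * Q) * (N : ℝ) := by positivity
  linarith

/-- `log log N`. -/
noncomputable def iterLog (N : ℕ) : ℝ := Real.log (Real.log N)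

/-- The truncation level `(log log N)⁻²` for `|a_p|`. -/
noncomputable def cutoff (N : ℕ) : ℝ := 1 / iterLog N ^ 2

/-- `⌊N ^ (1 / log log N)⌋`. -/
noncomputable def primeBound (N : ℕ) : ℕ := ⌊(N : ℝ) ^ (1 / iterLog N)⌋₊

/-- `log |a_p|`, truncated from below. -/
noncomputable def truncLog (a : ℕ → ℝ) (N p : ℕ) : ℝ := Real.log (max |a p| (cutoff N))

theorem tendsto_iterLog : Tendsto iterLog atTop atTop := tendsto_log_log_natCast

theorem tendsto_affine_log_div_rpow (A B : ℝ) :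
    Tendsto (fun N => (A + B * Real.log (iterLog N)) / iterLog N ^ (1 / 4 : ℝ)) atTop (𝓝 0) := by
  have h1 : Tendsto (fun x : ℝ => Real.log x / x ^ (1 / 4 : ℝ)) atTop (𝓝 0) :=
    (isLittleO_log_rpow_atTop (by norm_num)).tendsto_div_nhds_zero
  have h2 : Tendsto (fun x : ℝ => A / x ^ (1 / 4 : ℝ)) atTop (𝓝 0) :=
    (tendsto_rpow_atTop (by norm_num)).const_div_atTop A
  have h3 := (h2.add (h1.const_mul B)).comp tendsto_iterLog
  rw [mul_zero, add_zero] at h3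
  refine h3.congr fun N => ?_
  simp only [Function.comp]
  ring

theorem rpow_quarter_mul_self {x : ℝ} (hx : 0 ≤ x) :
    x ^ (1 / 4 : ℝ) * x ^ (1 / 4 : ℝ) = √x := by
  rw [← Real.rpow_add_of_nonneg hx (by norm_num) (by norm_num), Real.sqrt_eq_rpow]
  norm_num

theorem tendsto_affine_log_mul_div_sqrt (A B A' B' : ℝ) :
    Tendsto (fun N => (A + B * Real.log (iterLog N)) * (A' + B' * Real.log (iterLog N)) /
      √(iterLog N)) atTop (𝓝 0) := by
  have h := (tendsto_affine_log_div_rpow A B).mul (tendsto_affine_log_div_rpow A' B')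
  rw [mul_zero] at h
  refine h.congr' ?_
  filter_upwards [tendsto_iterLog.eventually_ge_atTop 0] with N hN
  rw [← rpow_quarter_mul_self hN, mul_div_mul_comm]

theorem tendsto_affine_log_div_sqrt (A B : ℝ) :
    Tendsto (fun N => (A + B * Real.log (iterLog N)) / √(iterLog N)) atTop (𝓝 0) := by
  simpa using tendsto_affine_log_mul_div_sqrt A B 1 0

theorem tendsto_affine_log_mul_div (A B A' B' : ℝ) :
    Tendsto (fun N => (A + B * Real.log (iterLog N)) * (A' + B' * Real.log (iterLog N)) /
      iterLog N) atTop (𝓝 0) := by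
  have h := (tendsto_affine_log_div_sqrt A B).mul (tendsto_affine_log_div_sqrt A' B')
  rw [mul_zero] at h
  refine h.congr' ?_
  filter_upwards [tendsto_iterLog.eventually_ge_atTop 0] with N hN
  rw [div_mul_div_comm, Real.mul_self_sqrt hN]

theorem eventually_primeBound (m : ℕ) : ∀ᶠ N : ℕ in atTop, 2 ≤ primeBound N ∧ m ≤ primeBound N ∧
    primeBound N ≤ N ∧ iterLog N - Real.log (iterLog N) - 1 ≤ iterLog (primeBound N) ∧
    iterLog (primeBound N) ≤ iterLog N := by
  have hlog : Tendsto (fun N : ℕ => Real.log N) atTop atTop :=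
    Real.tendsto_log_atTop.comp tendsto_natCast_atTop_atTop
  have hratio : Tendsto (fun N : ℕ => Real.log N / iterLog N) atTop atTop := by
    have h1 : Tendsto (fun x : ℝ => Real.log x / x) atTop (𝓝 0) :=
      Real.isLittleO_log_id_atTop.tendsto_div_nhds_zero
    have h2 : Tendsto (fun x : ℝ => Real.log x / x) atTop (𝓝[>] 0) := by
      refine tendsto_nhdsWithin_iff.2 ⟨h1, ?_⟩
      filter_upwards [eventually_gt_atTop 1] with x hx
      exact div_pos (Real.log_pos hx) (by linarith)
    refine (h2.inv_tendsto_nhdsGT_zero.comp hlog).congr fun N => ?_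
    simp [iterLog]
  filter_upwards [hratio.eventually_ge_atTop (max (2 * Real.log 2) (Real.log (m + 2))),
    tendsto_iterLog.eventually_ge_atTop 1, hlog.eventually_ge_atTop 1, eventually_ge_atTop 2] with
    N hr hL hl hN2
  have hr1 : 2 * Real.log 2 ≤ Real.log N / iterLog N := (le_max_left _ _).trans hr
  have hr2 : Real.log (m + 2) ≤ Real.log N / iterLog N := (le_max_right _ _).trans hr
  have hNR : (2 : ℝ) ≤ N := by exact_mod_cast hN2
  set L := iterLog N with hLdef
  set z : ℝ := (N : ℝ) ^ (1 / L) with hz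
  have hz0 : 0 < z := by positivity
  have hlz : Real.log z = Real.log N / L := by
    rw [hz, Real.log_rpow (by linarith)]; ring
  have hzm : (m : ℝ) + 2 ≤ z := by
    rw [← hlz] at hr2
    exact (Real.log_le_log_iff (by positivity) hz0).1 hr2
  have hzN : z ≤ N := by
    rw [hz]
    conv_rhs => rw [← Real.rpow_one (N : ℝ)]
    apply Real.rpow_le_rpow_of_exponent_le (by linarith)
    rw [div_le_one (by linarith)]
    exact hL
  have hym : m + 2 ≤ primeBound N := by
    apply Nat.le_floor
    push_cast
    exact hzm
  have hyz : ((primeBound N : ℕ) : ℝ) ≤ z := Nat.floor_le hz0.le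
  have hyN : primeBound N ≤ N := by exact_mod_cast hyz.trans hzN
  have hy2 : (2 : ℝ) ≤ primeBound N := by exact_mod_cast (by omega : 2 ≤ primeBound N)
  have hly : 0 < Real.log (primeBound N) := Real.log_pos (by linarith)
  refine ⟨by omega, by omega, hyN, ?_, ?_⟩
  · have h1 : z ≤ 2 * primeBound N := by
      have := (Nat.lt_floor_add_one z).le
      have e : (⌊z⌋₊ : ℝ) = primeBound N := rfl
      rw [e] at this
      linarith
    have h2 : Real.log z ≤ Real.log 2 + Real.log (primeBound N) := by
      rw [← Real.log_mul (by norm_num) (by linarith)]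
      exact Real.log_le_log hz0 h1
    rw [hlz] at h2
    have h3 : Real.log N / (2 * L) ≤ Real.log (primeBound N) := by
      have e : Real.log N / (2 * L) = Real.log N / L / 2 := by
        field_simp
      rw [e]; linarith
    have h4 := Real.log_le_log (by positivity) h3
    rw [Real.log_div (by linarith) (by linarith), Real.log_mul (by norm_num) (by linarith)] at h4
    have h5 := Real.log_two_lt_d9
    have e1 : Real.log (Real.log N) = L := rfl
    rw [e1] at h4
    unfold iterLog
    linarith
  · apply Real.log_le_log hly
    exact Real.log_le_log (by linarith) (by exact_mod_cast hyN)

theorem exists_sum_inv_bounds (m : ℕ) : ∃ C : ℝ, 0 ≤ C ∧ ∀ᶠ N : ℕ in atTop,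
    |∑ p ∈ primesIoc m (primeBound N), 1 / (p : ℝ) - iterLog N| ≤ C + Real.log (iterLog N) ∧
      ∑ p ∈ primesIoc m N, 1 / (p : ℝ) ≤ iterLog N + C ∧
      ∑ p ∈ primesIoc (primeBound N) N, 1 / (p : ℝ) ≤ C + Real.log (iterLog N) := by
  obtain ⟨C, hC0, hC⟩ := exists_sum_primesIoc_bound
  refine ⟨2 * (C + m) + 1, by positivity, ?_⟩
  filter_upwards [eventually_primeBound m, tendsto_iterLog.eventually_ge_atTop 1] with N hN hL
  obtain ⟨h2, hm, hyN, hlo, hup⟩ := hN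
  have hlL : 0 ≤ Real.log (iterLog N) := Real.log_nonneg hL
  have h3 := abs_le.1 (hC m _ h2 hm)
  have h4 := abs_le.1 (hC m N (h2.trans hyN) (hm.trans hyN))
  have h5 := primesIoc_union hm hyN (fun p => 1 / (p : ℝ))
  have e1 : Real.log (Real.log (primeBound N)) = iterLog (primeBound N) := rfl
  have e2 : Real.log (Real.log N) = iterLog N := rfl
  rw [e1] at h3
  rw [e2] at h4
  have hm0 : (0 : ℝ) ≤ m := by positivity
  refine ⟨?_, ?_, ?_⟩
  · rw [abs_le]; constructor <;> linarith [h3.1, h3.2]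
  · linarith [h4.2]
  · linarith [h3.1, h4.2]

theorem eventually_cutoff : ∀ᶠ N : ℕ in atTop, 0 < cutoff N ∧ cutoff N < 1 ∧
    Real.log (cutoff N) = -(2 * Real.log (iterLog N)) ∧ 0 ≤ Real.log (iterLog N) := by
  filter_upwards [tendsto_iterLog.eventually_gt_atTop 1] with N hL
  have hL0 : 0 < iterLog N := by linarith
  refine ⟨by unfold cutoff; positivity, ?_, ?_, Real.log_nonneg hL.le⟩
  · rw [cutoff, div_lt_one (by positivity)]
    nlinarith
  · rw [cutoff, one_div, Real.log_inv, Real.log_pow]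
    push_cast
    ring

theorem tendsto_cutoff : Tendsto cutoff atTop (𝓝[>] 0) := by
  refine tendsto_nhdsWithin_iff.2 ⟨?_, ?_⟩
  · exact ((tendsto_pow_atTop two_ne_zero).comp tendsto_iterLog).const_div_atTop 1
  · filter_upwards [eventually_cutoff] with N hN using hN.1

theorem eventually_abs_truncLog_le {a : ℕ → ℝ} (ha : SatoTateClass a) : ∀ᶠ N : ℕ in atTop,
    ∀ p, p.Prime → |truncLog a N p| ≤ 1 + 2 * Real.log (iterLog N) := by
  filter_upwards [eventually_cutoff] with N hN p hp
  obtain ⟨h0, h1, h2, h3⟩ := hN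
  have hap : |a p| ≤ 2 := abs_le.2 (ha.mem_Icc p hp)
  have h4 := Real.log_le_log h0 (le_max_right |a p| (cutoff N))
  have h5 := Real.log_le_log (h0.trans_le (le_max_right |a p| (cutoff N)))
    (max_le hap (by linarith : cutoff N ≤ 2))
  rw [truncLog, abs_le]
  constructor <;> linarith [Real.log_two_lt_d9]

theorem eventually_log_two_div_cutoff_le : ∀ᶠ N : ℕ in atTop,
    Real.log (2 / cutoff N) ≤ 1 + 2 * Real.log (iterLog N) := by
  filter_upwards [eventually_cutoff] with N hN
  obtain ⟨h0, h1, h2, h3⟩ := hN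
  rw [Real.log_div two_ne_zero h0.ne', h2]
  linarith [Real.log_two_lt_d9]

theorem tendsto_div_sqrt_iterLog {u : ℕ → ℝ} (A B A' B' : ℝ)
    (h : ∀ᶠ N in atTop, |u N| ≤
      (A + B * Real.log (iterLog N)) * (A' + B' * Real.log (iterLog N))) :
    Tendsto (fun N => u N / √(iterLog N)) atTop (𝓝 0) := by
  refine squeeze_zero_norm' ?_ (tendsto_affine_log_mul_div_sqrt A B A' B')
  filter_upwards [h] with N hN
  rw [Real.norm_eq_abs, abs_div, abs_of_nonneg (Real.sqrt_nonneg _)]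
  gcongr

theorem tendsto_sum_inv_div (m : ℕ) :
    Tendsto (fun N => (∑ p ∈ primesIoc m (primeBound N), 1 / (p : ℝ)) / iterLog N) atTop
      (𝓝 1) := by
  obtain ⟨C, hC0, hC⟩ := exists_sum_inv_bounds m
  rw [← tendsto_sub_nhds_zero_iff]
  refine squeeze_zero_norm' ?_ (by simpa using tendsto_affine_log_mul_div C 1 1 0)
  filter_upwards [hC, tendsto_iterLog.eventually_gt_atTop 0] with N hN hL
  rw [Real.norm_eq_abs, div_sub_one hL.ne', abs_div, abs_of_pos hL]
  gcongr
  exact hN.1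

theorem tendsto_sum_truncLog_sq {a : ℕ → ℝ} (ha : SatoTateClass a) {m : ℕ} {t : ℝ}
    (hd : ∀ N, m ≤ N → ∀ s ∈ Set.Icc (0 : ℝ) 2,
      |∑ p ∈ primesIoc m N, ((if |a p| ≤ s then (1 : ℝ) else 0) - smallMass s) / p| ≤ t) :
    Tendsto (fun N => (∑ p ∈ primesIoc m (primeBound N), truncLog a N p ^ 2 / p) / iterLog N) atTop
      (𝓝 (1 / 2 + Real.pi ^ 2 / 12)) := by
  have ht : 0 ≤ t := (abs_nonneg _).trans (hd m le_rfl 0 ⟨le_rfl, zero_le_two⟩)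
  have hmain : Tendsto (fun N => truncLogMoment 2 (cutoff N) *
      ((∑ p ∈ primesIoc m (primeBound N), 1 / (p : ℝ)) / iterLog N)) atTop
      (𝓝 ((1 / 2 + Real.pi ^ 2 / 12) * 1)) :=
    (tendsto_truncLogMoment_two.comp tendsto_cutoff).mul (tendsto_sum_inv_div m)
  have herr : Tendsto (fun N => (∑ p ∈ primesIoc m (primeBound N), truncLog a N p ^ 2 / p) /
      iterLog N - truncLogMoment 2 (cutoff N) *
      ((∑ p ∈ primesIoc m (primeBound N), 1 / (p : ℝ)) / iterLog N)) atTop (𝓝 0) := by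
    have h0 := (tendsto_affine_log_mul_div 1 2 1 2).const_mul (t * 2)
    rw [mul_zero] at h0
    refine squeeze_zero_norm' ?_ h0
    filter_upwards [eventually_primeBound m, eventually_cutoff, eventually_log_two_div_cutoff_le,
      tendsto_iterLog.eventually_gt_atTop 0] with N hy hcut hlog hL
    have h1 := abs_sum_log_sq_sub_le ha hcut.1 hcut.2.1 ht (hd _ hy.2.1)
    rw [hcut.2.2.1, abs_neg, abs_of_nonneg (mul_nonneg zero_le_two hcut.2.2.2)] at h1
    rw [Real.norm_eq_abs, ← mul_div_assoc, ← sub_div, abs_div, abs_of_pos hL, mul_div_assoc',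
      div_le_div_iff_of_pos_right hL]
    refine h1.trans ?_
    have := hcut.2.2.2
    rw [mul_assoc, mul_assoc]
    gcongr
  have h := herr.add hmain
  rw [mul_one, zero_add] at h
  exact h.congr fun N => by ring

theorem tendsto_sum_truncLog {a : ℕ → ℝ} (ha : SatoTateClass a) {m : ℕ} {t : ℝ}
    (hd : ∀ N, m ≤ N → ∀ s ∈ Set.Icc (0 : ℝ) 2,
      |∑ p ∈ primesIoc m N, ((if |a p| ≤ s then (1 : ℝ) else 0) - smallMass s) / p| ≤ t) :
    Tendsto (fun N => (∑ p ∈ primesIoc m (primeBound N), truncLog a N p / p + iterLog N / 2) /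
      √(iterLog N)) atTop (𝓝 0) := by
  have ht : 0 ≤ t := (abs_nonneg _).trans (hd m le_rfl 0 ⟨le_rfl, zero_le_two⟩)
  obtain ⟨C, hC0, hC⟩ := exists_sum_inv_bounds m
  refine tendsto_div_sqrt_iterLog (t + 1 + 3 / 2 * C) (t * 2 + 3 / 2) 1 0 ?_
  filter_upwards [eventually_primeBound m, eventually_cutoff, eventually_log_two_div_cutoff_le,
    tendsto_iterLog.eventually_ge_atTop 1, hC] with N hy hcut hlog hL hS
  obtain ⟨hS, -, -⟩ := hS
  have h1 := abs_sum_log_sub_le ha hcut.1 hcut.2.1 (hd _ hy.2.1)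
  have h2 := abs_truncLogMoment_one_add_le hcut.1 (by linarith [hcut.2.1] : cutoff N ≤ 2)
  have h3 : t * Real.log (2 / cutoff N) ≤ t * (1 + 2 * Real.log (iterLog N)) := by gcongr
  have hS0 : 0 ≤ ∑ p ∈ primesIoc m (primeBound N), 1 / (p : ℝ) :=
    Finset.sum_nonneg fun p _ => by positivity
  have hcL : cutoff N * iterLog N ≤ 1 := by
    rw [cutoff, div_mul_eq_mul_div, one_mul, div_le_one (by positivity)]
    nlinarith
  have e : ∑ p ∈ primesIoc m (primeBound N), Real.log (max |a p| (cutoff N)) / p =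
    ∑ p ∈ primesIoc m (primeBound N), truncLog a N p / p := rfl
  rw [e] at h1
  set S := ∑ p ∈ primesIoc m (primeBound N), 1 / (p : ℝ)
  have h4 : |(truncLogMoment 1 (cutoff N) + 1 / 2) * S| ≤ 1 + (C + Real.log (iterLog N)) := by
    rw [abs_mul, abs_of_nonneg hS0]
    calc _ ≤ cutoff N * S := by gcongr
      _ ≤ cutoff N * (iterLog N + (C + Real.log (iterLog N))) := by
        have := hcut.1
        gcongr
        linarith [(abs_le.1 hS).2]
      _ ≤ 1 + 1 * (C + Real.log (iterLog N)) := by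
        rw [mul_add]
        have := hcut.2.2.2
        have := hcut.2.1
        gcongr
      _ = _ := by ring
  have h1' := abs_le.1 h1
  have h4' := abs_le.1 h4
  have hS' := abs_le.1 hS
  rw [abs_le]
  constructor <;> nlinarith

theorem tendsto_sum_abs_truncLog_tail {a : ℕ → ℝ} (ha : SatoTateClass a) :
    Tendsto (fun N => (∑ p ∈ primesIoc (primeBound N) N, |truncLog a N p| / p) / √(iterLog N))
      atTop (𝓝 0) := by
  obtain ⟨C, hC0, hC⟩ := exists_sum_inv_bounds 0
  refine tendsto_div_sqrt_iterLog 1 2 C 1 ?_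
  filter_upwards [eventually_abs_truncLog_le ha, hC, eventually_cutoff] with N hf hS hcut
  have := hcut.2.2.2
  rw [abs_of_nonneg (Finset.sum_nonneg fun p _ => by positivity)]
  calc _ ≤ ∑ p ∈ primesIoc (primeBound N) N,
        (1 + 2 * Real.log (iterLog N)) * (1 / (p : ℝ)) := by
        apply Finset.sum_le_sum
        intro p hp
        rw [mul_one_div]
        gcongr
        exact hf p (mem_primesIoc.1 hp).2
    _ = (1 + 2 * Real.log (iterLog N)) * ∑ p ∈ primesIoc (primeBound N) N, 1 / (p : ℝ) := by
        rw [Finset.mul_sum]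
    _ ≤ _ := by
        rw [one_mul]
        gcongr
        exact hS.2.2

theorem eventually_abs_truncLog_div_le {a : ℕ → ℝ} (ha : SatoTateClass a) {c ε : ℝ} (hc : 0 < c)
    (hε : 0 < ε) :
    ∀ᶠ N : ℕ in atTop, ∀ p, p.Prime → |truncLog a N p / √(c * iterLog N)| ≤ ε := by
  have h := (tendsto_affine_log_div_sqrt 1 2).eventually_le_const
    (show 0 < ε * √c by positivity)
  filter_upwards [eventually_abs_truncLog_le ha, h, tendsto_iterLog.eventually_gt_atTop 0] with
    N hf hN hL p hp
  rw [abs_div, abs_of_nonneg (Real.sqrt_nonneg _), Real.sqrt_mul hc.le,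
    div_le_iff₀ (by positivity), ← mul_assoc]
  rw [div_le_iff₀ (by positivity)] at hN
  exact (hf p hp).trans hN

theorem tendsto_primeBound_pow_div (k : ℕ) :
    Tendsto (fun N : ℕ => (primeBound N : ℝ) ^ k / N) atTop (𝓝 0) := by
  have h0 : Tendsto (fun N : ℕ => ((N : ℝ) ^ (1 / 2 : ℝ))⁻¹) atTop (𝓝 0) :=
    ((tendsto_rpow_atTop (by norm_num)).comp tendsto_natCast_atTop_atTop).inv_tendsto_atTop
  refine squeeze_zero' (Eventually.of_forall fun N => by positivity) ?_ h0
  filter_upwards [tendsto_iterLog.eventually_ge_atTop (2 * k + 1), eventually_ge_atTop 1] with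
    N hL hN
  have hNR : (1 : ℝ) ≤ N := by exact_mod_cast hN
  have hL0 : 0 < iterLog N := by linarith [(Nat.cast_nonneg k : (0 : ℝ) ≤ k)]
  have hy : (primeBound N : ℝ) ≤ (N : ℝ) ^ (1 / iterLog N) := Nat.floor_le (by positivity)
  rw [div_le_iff₀ (by linarith), ← Real.rpow_neg (by linarith)]
  calc (primeBound N : ℝ) ^ k ≤ ((N : ℝ) ^ (1 / iterLog N)) ^ k := by gcongr
    _ = (N : ℝ) ^ (1 / iterLog N * k) := by
        rw [Real.rpow_mul (by linarith), Real.rpow_natCast]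
    _ ≤ (N : ℝ) ^ (-(1 / 2) + 1 : ℝ) := by
        apply Real.rpow_le_rpow_of_exponent_le hNR
        rw [one_div_mul_eq_div, div_le_iff₀ hL0]
        linarith
    _ = _ := by rw [Real.rpow_add (by linarith), Real.rpow_one]

theorem tendsto_sum_abs_truncLog_pow_div {a : ℕ → ℝ} (ha : SatoTateClass a) {c : ℝ} (hc : 0 < c)
    (m k : ℕ) :
    Tendsto (fun N : ℕ => (∑ p ∈ primesIoc m (primeBound N),
      |truncLog a N p / √(c * iterLog N)|) ^ k / N) atTop (𝓝 0) := by
  refine squeeze_zero' (Eventually.of_forall fun N => by positivity) ?_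
    (tendsto_primeBound_pow_div k)
  filter_upwards [eventually_abs_truncLog_div_le ha hc one_pos] with N hN
  gcongr
  calc _ ≤ ∑ p ∈ primesIoc m (primeBound N), (1 : ℝ) :=
        Finset.sum_le_sum fun p hp => hN p (mem_primesIoc.1 hp).2
    _ = (primesIoc m (primeBound N)).card := by simp
    _ ≤ _ := by
        have h : (primesIoc m (primeBound N)).card ≤ (Finset.Ioc m (primeBound N)).card :=
          Finset.card_filter_le _ _
        rw [Nat.card_Ioc] at h
        exact_mod_cast h.trans (Nat.sub_le _ _)

theorem tendsto_sum_sq_truncLog_div {a : ℕ → ℝ} (ha : SatoTateClass a) {m : ℕ} {t c : ℝ}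
    (hc : c = 1 / 2 + Real.pi ^ 2 / 12)
    (hd : ∀ N, m ≤ N → ∀ s ∈ Set.Icc (0 : ℝ) 2,
      |∑ p ∈ primesIoc m N, ((if |a p| ≤ s then (1 : ℝ) else 0) - smallMass s) / p| ≤ t) :
    Tendsto (fun N => ∑ p ∈ primesIoc m (primeBound N),
      (truncLog a N p / √(c * iterLog N)) ^ 2 / p) atTop (𝓝 1) := by
  have hc0 : 0 < c := by rw [hc]; positivity
  have h := (tendsto_sum_truncLog_sq ha hd).div_const c
  rw [← hc, div_self hc0.ne'] at h
  refine h.congr' ?_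
  filter_upwards [tendsto_iterLog.eventually_gt_atTop 0] with N hL
  rw [div_div, Finset.sum_div]
  refine Finset.sum_congr rfl fun p _ => ?_
  rw [div_pow, Real.sq_sqrt (by positivity)]
  ring

theorem eventually_sum_smallPrimes_le {a : ℕ → ℝ} {m : ℕ} {t ε : ℝ} (hε : 0 < ε)
    (hd : ∀ N, m ≤ N → ∀ s ∈ Set.Icc (0 : ℝ) 2,
      |∑ p ∈ primesIoc m N, ((if |a p| ≤ s then (1 : ℝ) else 0) - smallMass s) / p| ≤ t) :
    ∀ᶠ N : ℕ in atTop, ∑ p ∈ smallPrimes a m N (cutoff N), 1 / (p : ℝ) ≤ t + ε := by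
  obtain ⟨C, hC0, hC⟩ := exists_sum_inv_bounds m
  filter_upwards [hC, eventually_cutoff, eventually_ge_atTop m,
    tendsto_iterLog.eventually_ge_atTop (max 1 ((1 + C) / ε))] with N hS hcut hmN hL
  have hL1 : 1 ≤ iterLog N := (le_max_left _ _).trans hL
  have hL2 : (1 + C) / ε ≤ iterLog N := (le_max_right _ _).trans hL
  refine (sum_smallPrimes_le hcut.1.le (by linarith [hcut.2.1]) (hd N hmN)).trans ?_
  gcongr
  calc cutoff N * ∑ p ∈ primesIoc m N, 1 / (p : ℝ) ≤ cutoff N * (iterLog N + C * iterLog N) := by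
        have := hcut.1
        gcongr
        nlinarith [hS.2.1]
    _ = (1 + C) / iterLog N := by
        rw [cutoff]; field_simp
    _ ≤ ε := by
        rw [div_le_iff₀ hε] at hL2
        rw [div_le_iff₀ (by linarith)]
        linarith

theorem card_filter_lt_sum_le (N : ℕ) (T : Finset ℕ) {h : ℕ → ℝ} (hh : ∀ p ∈ T, 0 ≤ h p)
    (θ : ℝ) :
    θ * ((Finset.Icc 1 N).filter (fun n => θ < ∑ p ∈ T.filter (· ∣ n), h p)).card ≤
      N * ∑ p ∈ T, h p / p := by
  calc θ * ((Finset.Icc 1 N).filter (fun n => θ < ∑ p ∈ T.filter (· ∣ n), h p)).card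
      = ∑ n ∈ (Finset.Icc 1 N).filter (fun n => θ < ∑ p ∈ T.filter (· ∣ n), h p), θ := by
        rw [Finset.sum_const, nsmul_eq_mul, mul_comm]
    _ ≤ ∑ n ∈ (Finset.Icc 1 N).filter (fun n => θ < ∑ p ∈ T.filter (· ∣ n), h p),
          ∑ p ∈ T.filter (· ∣ n), h p :=
        Finset.sum_le_sum fun n hn => (Finset.mem_filter.1 hn).2.le
    _ ≤ ∑ n ∈ Finset.Icc 1 N, ∑ p ∈ T.filter (· ∣ n), h p :=
        Finset.sum_le_sum_of_subset_of_nonneg (Finset.filter_subset _ _) fun n _ _ =>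
          Finset.sum_nonneg fun p hp => hh p (Finset.mem_filter.1 hp).1
    _ = ∑ p ∈ T, ∑ n ∈ Finset.Icc 1 N, if p ∣ n then h p else 0 := by
        simp_rw [Finset.sum_filter]
        exact Finset.sum_comm
    _ ≤ ∑ p ∈ T, N * (h p / p) := by
        refine Finset.sum_le_sum fun p hp => ?_
        rw [← Finset.sum_filter, Finset.sum_const, nsmul_eq_mul]
        have h1 : ((Finset.Icc 1 N).filter (fun n => p ∣ n)).card = N / p :=
          Nat.Ioc_filter_dvd_card_eq_div N p
        rw [h1]
        calc ((N / p : ℕ) : ℝ) * h p ≤ (N : ℝ) / p * h p :=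
              mul_le_mul_of_nonneg_right Nat.cast_div_le (hh p hp)
          _ = _ := by ring
    _ = _ := by rw [Finset.mul_sum]

theorem card_filter_sq_le (N : ℕ) :
    ((Finset.Icc 1 N).filter (fun n => n ^ 2 ≤ N)).card ≤ N.sqrt := by
  calc _ ≤ (Finset.Icc 1 N.sqrt).card := by
        apply Finset.card_le_card
        intro n hn
        simp only [Finset.mem_filter, Finset.mem_Icc] at *
        exact ⟨hn.1.1, Nat.le_sqrt'.2 hn.2⟩
    _ = _ := by simp

/-- The integers up to `N` at which `log |a_n|` is not controlled by an additive function
over the primes in `(m, primeBound N]`. -/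
noncomputable def exceptionalSet (a : ℕ → ℝ) (m K : ℕ) (η : ℝ) (N : ℕ) : Finset ℕ :=
  (Finset.Icc 1 N).filter fun n =>
    (∃ p ∈ smallPrimes a m N (cutoff N), p ∣ n) ∨ (∃ p ∈ primesIoc m N, p ^ 2 ∣ n) ∨
    (∃ p ∈ primesIoc 0 m, p ^ (K + 1) ∣ n) ∨ n ^ 2 ≤ N ∨
    η * √(iterLog N) < ∑ p ∈ (primesIoc (primeBound N) N).filter (· ∣ n), |truncLog a N p|

theorem eventually_card_exceptionalSet_le {a : ℕ → ℝ} (ha : SatoTateClass a) {m : ℕ} {t ε η : ℝ}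
    (hε : 0 < ε) (hη : 0 < η) (K : ℕ) (hm : m ≠ 0)
    (hd : ∀ N, m ≤ N → ∀ s ∈ Set.Icc (0 : ℝ) 2,
      |∑ p ∈ primesIoc m N, ((if |a p| ≤ s then (1 : ℝ) else 0) - smallMass s) / p| ≤ t) :
    ∀ᶠ N : ℕ in atTop, ((exceptionalSet a m K η N).card : ℝ) ≤
      (t + 1 / m + ∑ p ∈ primesIoc 0 m, 1 / ((p ^ (K + 1) : ℕ) : ℝ) + 3 * ε) * N := by
  classical
  have hsqrt : Tendsto (fun N : ℕ => (N : ℝ) ^ (1 / 2 : ℝ)) atTop atTop :=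
    (tendsto_rpow_atTop (by norm_num)).comp tendsto_natCast_atTop_atTop
  filter_upwards [eventually_sum_smallPrimes_le hε hd, eventually_ge_atTop m,
    (tendsto_sum_abs_truncLog_tail ha).eventually_le_const (show 0 < ε * η by positivity),
    tendsto_iterLog.eventually_gt_atTop 0, hsqrt.eventually_ge_atTop (1 / ε)] with
    N h1 hmN h5 hL h4
  set B₁ := (Finset.Icc 1 N).filter fun n => ∃ p ∈ smallPrimes a m N (cutoff N), p ∣ n with hB₁
  set B₂ := (Finset.Icc 1 N).filter fun n => ∃ p ∈ primesIoc m N, p ^ 2 ∣ n with hB₂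
  set B₃ := (Finset.Icc 1 N).filter fun n => ∃ p ∈ primesIoc 0 m, p ^ (K + 1) ∣ n with hB₃
  set B₄ := (Finset.Icc 1 N).filter fun n => n ^ 2 ≤ N with hB₄
  set B₅ := (Finset.Icc 1 N).filter fun n => η * √(iterLog N) <
    ∑ p ∈ (primesIoc (primeBound N) N).filter (· ∣ n), |truncLog a N p| with hB₅
  have hN0 : (0 : ℝ) ≤ N := Nat.cast_nonneg N
  have c1 : (B₁.card : ℝ) ≤ N * (t + ε) :=
    (card_filter_exists_dvd_le N _ fun p => p).trans (mul_le_mul_of_nonneg_left h1 hN0)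
  have c2 : (B₂.card : ℝ) ≤ N * (1 / m) :=
    (card_filter_exists_dvd_le N _ fun p => p ^ 2).trans
      (mul_le_mul_of_nonneg_left (sum_primesIoc_inv_sq_le hm hmN) hN0)
  have c3 : (B₃.card : ℝ) ≤ N * ∑ p ∈ primesIoc 0 m, 1 / ((p ^ (K + 1) : ℕ) : ℝ) :=
    card_filter_exists_dvd_le N _ fun p => p ^ (K + 1)
  have c4 : (B₄.card : ℝ) ≤ ε * N := by
    have e1 : (B₄.card : ℝ) ≤ N.sqrt := by exact_mod_cast card_filter_sq_le N
    have e2 : (N.sqrt : ℝ) ≤ √N := Real.nat_sqrt_le_real_sqrt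
    rw [← Real.sqrt_eq_rpow, div_le_iff₀ hε] at h4
    have e3 : √(N : ℝ) * √N = N := Real.mul_self_sqrt hN0
    nlinarith [Real.sqrt_nonneg (N : ℝ)]
  have c5 : (B₅.card : ℝ) ≤ ε * N := by
    have e1 := card_filter_lt_sum_le N (primesIoc (primeBound N) N)
      (h := fun p => |truncLog a N p|) (fun p _ => abs_nonneg _) (η * √(iterLog N))
    have hs := Real.sqrt_pos.2 hL
    rw [div_le_iff₀ hs] at h5
    have e2 : η * √(iterLog N) * B₅.card ≤ η * √(iterLog N) * (ε * N) :=
      e1.trans ((mul_le_mul_of_nonneg_left h5 hN0).trans (le_of_eq (by ring)))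
    exact le_of_mul_le_mul_left e2 (by positivity)
  have hsub : exceptionalSet a m K η N ⊆ B₁ ∪ (B₂ ∪ (B₃ ∪ (B₄ ∪ B₅))) := by
    intro n hn
    rw [exceptionalSet, Finset.mem_filter] at hn
    simp only [Finset.mem_union, hB₁, hB₂, hB₃, hB₄, hB₅, Finset.mem_filter, ← and_or_left]
    exact hn
  have hcard : (exceptionalSet a m K η N).card ≤
      B₁.card + (B₂.card + (B₃.card + (B₄.card + B₅.card))) := by
    refine (Finset.card_le_card hsub).trans ((Finset.card_union_le _ _).trans ?_)
    gcongr
    refine (Finset.card_union_le _ _).trans ?_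
    gcongr
    refine (Finset.card_union_le _ _).trans ?_
    gcongr
    exact Finset.card_union_le _ _
  have hcard' : ((exceptionalSet a m K η N).card : ℝ) ≤
      B₁.card + (B₂.card + (B₃.card + (B₄.card + B₅.card))) := by exact_mod_cast hcard
  linarith

theorem map_ne_zero_iff_and_log_eq {a : ℕ → ℝ} (ha : SatoTateClass a) (h1 : a 1 = 1)
    {m K N n : ℕ} {η : ℝ} (hδ : 0 < cutoff N) (hm : m ≤ primeBound N) (hN : primeBound N ≤ N)
    (hn : n ∈ Finset.Icc 1 N) (hne : n ∉ exceptionalSet a m K η N) :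
    (a n ≠ 0 ↔ a (n.gcd (m.factorial ^ K)) ≠ 0) ∧
    (a n ≠ 0 → Real.log |a n| = Real.log |a (n.gcd (m.factorial ^ K))| +
      ∑ p ∈ (primesIoc m (primeBound N)).filter (· ∣ n), truncLog a N p +
      ∑ p ∈ (primesIoc (primeBound N) N).filter (· ∣ n), truncLog a N p) := by
  rw [exceptionalSet, Finset.mem_filter, not_and] at hne
  have hne' := hne hn
  push Not at hne'
  obtain ⟨hsmall, hsq, hK, -, -⟩ := hne'
  have hprod := map_eq_map_gcd_mul_prod ha h1 hn hsq hK
  have hlarge : ∀ p ∈ (primesIoc m N).filter (· ∣ n), cutoff N < |a p| := by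
    intro p hp
    rw [Finset.mem_filter] at hp
    by_contra! hle
    exact hsmall p (Finset.mem_filter.2 ⟨hp.1, hle⟩) hp.2
  have hne0 : ∀ p ∈ (primesIoc m N).filter (· ∣ n), a p ≠ 0 := fun p hp =>
    abs_pos.1 (hδ.trans (hlarge p hp))
  have hprod0 : ∏ p ∈ (primesIoc m N).filter (· ∣ n), a p ≠ 0 := Finset.prod_ne_zero_iff.2 hne0
  have hiff : a n ≠ 0 ↔ a (n.gcd (m.factorial ^ K)) ≠ 0 := by
    rw [hprod]
    exact ⟨left_ne_zero_of_mul, fun h => mul_ne_zero h hprod0⟩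
  refine ⟨hiff, fun h => ?_⟩
  have hg := hiff.1 h
  have hu := primesIoc_union hm hN (fun p => if p ∣ n then truncLog a N p else 0)
  simp only [← Finset.sum_filter] at hu
  rw [add_assoc, ← hu, hprod, abs_mul, Real.log_mul (abs_ne_zero.2 hg) (abs_ne_zero.2 hprod0),
    Finset.abs_prod, Real.log_prod fun p hp => abs_ne_zero.2 (hne0 p hp)]
  congr 1
  refine Finset.sum_congr rfl fun p hp => ?_
  rw [truncLog, max_eq_left (hlarge p hp).le]

theorem sqrt_mul_centredSum {P : Finset ℕ} {f : ℕ → ℝ} {D : ℝ} (hD : D ≠ 0) (n : ℕ) :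
    D * centredSum P (fun p => f p / D) (P.filter (· ∣ n)) =
      ∑ p ∈ P.filter (· ∣ n), f p - ∑ p ∈ P, f p / p := by
  rw [centredSum, mul_sub, Finset.mul_sum, Finset.mul_sum, Finset.sum_filter]
  congr 1
  · refine Finset.sum_congr rfl fun p hp => ?_
    simp only [Finset.mem_filter, hp, true_and]
    split_ifs
    · field_simp
    · simp
  · refine Finset.sum_congr rfl fun p _ => ?_
    field_simp

theorem abs_sqrt_sub_sqrt_le {x y : ℝ} (hx : 0 ≤ x) (hy : 1 ≤ y) : |√x - √y| ≤ |x - y| := by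
  have h1 : 1 ≤ √y := Real.one_le_sqrt.2 hy
  have h2 : x - y = (√x - √y) * (√x + √y) := by
    ring_nf
    rw [Real.sq_sqrt hx, Real.sq_sqrt (by linarith)]
  rw [h2, abs_mul]
  have h3 : 1 ≤ |√x + √y| := by
    rw [abs_of_nonneg (by positivity)]
    linarith [Real.sqrt_nonneg x]
  nlinarith [abs_nonneg (√x - √y)]

/-- `log₂ n` is within `1` of `log log N` when `√N < n ≤ N`. -/
theorem abs_log₂_sub_iterLog_le {N n : ℕ} (hL : 2 ≤ iterLog N) (hlog : 0 < Real.log N)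
    (hn : n ∈ Finset.Icc 1 N)
    (hsq : N < n ^ 2) : 1 ≤ log₂ n ∧ |log₂ n - iterLog N| ≤ 1 := by
  rw [Finset.mem_Icc] at hn
  have hn1 : (1 : ℝ) ≤ n := by exact_mod_cast hn.1
  have hN1 : (1 : ℝ) ≤ N := by exact_mod_cast hn.1.trans hn.2
  have h1 : Real.log N ≤ 2 * Real.log n := by
    have : Real.log N ≤ Real.log ((n : ℝ) ^ 2) :=
      Real.log_le_log (by linarith) (by exact_mod_cast hsq.le)
    rwa [Real.log_pow] at this
  have h2 : Real.log n ≤ Real.log N := Real.log_le_log (by linarith) (by exact_mod_cast hn.2)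
  have h3 : Real.log (Real.log N) ≤ Real.log 2 + Real.log (Real.log n) := by
    rw [← Real.log_mul two_ne_zero (by linarith)]
    exact Real.log_le_log hlog h1
  have h4 : Real.log (Real.log n) ≤ Real.log (Real.log N) := Real.log_le_log (by linarith) h2
  have e : Real.log (Real.log N) = iterLog N := rfl
  rw [e] at h3 h4
  have h5 := Real.log_two_lt_d9
  have h6 : 1 ≤ Real.log (Real.log n) := by linarith
  have h7 : 1 ≤ Real.log n := by
    have := Real.log_le_sub_one_of_pos (show 0 < Real.log n by linarith)
    linarith
  have h8 : log₂ n = Real.log (Real.log n) := by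
    rw [log₂, log₁, log₁, max_eq_left h7, max_eq_left h6]
  rw [h8]
  refine ⟨h6, abs_le.2 ⟨by linarith, by linarith⟩⟩

theorem le_div_of_le_and_le_of_le_div {D s v c H₀ η H R μ L ℓ G x : ℝ} (hD : 0 < D) (hs : 0 < s)
    (hsD : |s - D| ≤ c) (hH : |H| ≤ H₀) (hR : |R| ≤ η * D) (hℓ : |ℓ - L| ≤ 1)
    (hsum : |v| * c + H₀ + |μ + L / 2| + 1 / 2 ≤ η * D) (hx : x = H + (D * G + μ) + R) :
    (v + 2 * η ≤ G → v ≤ (x + 1 / 2 * ℓ) / s) ∧ (v ≤ (x + 1 / 2 * ℓ) / s → v - 2 * η ≤ G) := by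
  have h1 : |v * (s - D)| ≤ |v| * c := by
    rw [abs_mul]
    gcongr
  have h1' := abs_le.1 h1
  have hH' := abs_le.1 hH
  have hR' := abs_le.1 hR
  have hℓ' := abs_le.1 hℓ
  have hμ1 := neg_abs_le (μ + L / 2)
  have hμ2 := le_abs_self (μ + L / 2)
  rw [le_div_iff₀ hs, hx]
  constructor
  · intro h
    have := mul_le_mul_of_nonneg_left h hD.le
    linarith
  · intro h
    refine le_of_mul_le_mul_left ?_ hD
    linarith

theorem exceptionalSet_approximation {a : ℕ → ℝ} (ha : SatoTateClass a) (h1 : a 1 = 1) {m : ℕ}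
    {t c η : ℝ} (hc : 1 ≤ c) (hη : 0 < η) (K : ℕ) (v : ℝ)
    (hd : ∀ N, m ≤ N → ∀ s ∈ Set.Icc (0 : ℝ) 2,
      |∑ p ∈ primesIoc m N, ((if |a p| ≤ s then (1 : ℝ) else 0) - smallMass s) / p| ≤ t) :
    ∀ᶠ N : ℕ in atTop, ∀ n ∈ Finset.Icc 1 N, n ∉ exceptionalSet a m K η N →
      (a n ≠ 0 ↔ a (n.gcd (m.factorial ^ K)) ≠ 0) ∧ (a n ≠ 0 →
        (v + 2 * η ≤ centredSum (primesIoc m (primeBound N))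
            (fun p => truncLog a N p / √(c * iterLog N))
            ((primesIoc m (primeBound N)).filter (· ∣ n)) →
          v ≤ (Real.log |a n| + 1 / 2 * log₂ n) / √(c * log₂ n)) ∧
        (v ≤ (Real.log |a n| + 1 / 2 * log₂ n) / √(c * log₂ n) →
          v - 2 * η ≤ centredSum (primesIoc m (primeBound N))
            (fun p => truncLog a N p / √(c * iterLog N))
            ((primesIoc m (primeBound N)).filter (· ∣ n)))) := by
  set Q := m.factorial ^ K with hQ
  have hQ0 : Q ≠ 0 := pow_ne_zero _ m.factorial_ne_zero
  set H₀ := ∑ d ∈ Q.divisors, abs (Real.log |a d|)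
  have hlog : Tendsto (fun N : ℕ => Real.log N) atTop atTop :=
    Real.tendsto_log_atTop.comp tendsto_natCast_atTop_atTop
  have hlim : Tendsto (fun N => (|v| * c + H₀ + 1 / 2) / √(iterLog N) +
      |(∑ p ∈ primesIoc m (primeBound N), truncLog a N p / p + iterLog N / 2) / √(iterLog N)|)
      atTop (𝓝 0) := by
    simpa using (tendsto_affine_log_div_sqrt (|v| * c + H₀ + 1 / 2) 0).add
      (tendsto_sum_truncLog ha hd).abs
  filter_upwards [eventually_primeBound m, eventually_cutoff,
    tendsto_iterLog.eventually_ge_atTop 2, hlog.eventually_gt_atTop 0,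
    hlim.eventually_le_const hη] with N hy hcut hL hlogN hsmall n hn hne
  obtain ⟨hiff, heq⟩ := map_ne_zero_iff_and_log_eq ha h1 hcut.1 hy.2.1 hy.2.2.1 hn hne
  refine ⟨hiff, fun h0 => ?_⟩
  rw [exceptionalSet, Finset.mem_filter, not_and] at hne
  have hne' := hne hn
  push Not at hne'
  obtain ⟨-, -, -, hsq, htail⟩ := hne'
  obtain ⟨hℓ1, hℓ⟩ := abs_log₂_sub_iterLog_le hL hlogN hn hsq
  have hLpos : 0 < √(iterLog N) := Real.sqrt_pos.2 (by linarith)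
  have hLD : √(iterLog N) ≤ √(c * iterLog N) := Real.sqrt_le_sqrt (by nlinarith)
  have hD : 0 < √(c * iterLog N) := hLpos.trans_le hLD
  have hηD : η * √(iterLog N) ≤ η * √(c * iterLog N) := by gcongr
  refine le_div_of_le_and_le_of_le_div (c := c) (H₀ := H₀) (L := iterLog N)
    (H := Real.log |a (n.gcd Q)|)
    (R := ∑ p ∈ (primesIoc (primeBound N) N).filter (· ∣ n), truncLog a N p)
    (μ := ∑ p ∈ primesIoc m (primeBound N), truncLog a N p / p)
    hD (Real.sqrt_pos.2 (by nlinarith)) ?_ ?_ ?_ hℓ ?_ ?_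
  · refine (abs_sqrt_sub_sqrt_le (by nlinarith) (by nlinarith)).trans ?_
    rw [← mul_sub, abs_mul, abs_of_nonneg (by linarith)]
    nlinarith
  · exact Finset.single_le_sum (f := fun d => abs (Real.log |a d|)) (fun d _ => abs_nonneg _)
      (Nat.mem_divisors.2 ⟨Nat.gcd_dvd_right n Q, hQ0⟩)
  · exact (Finset.abs_sum_le_sum_abs _ _).trans (htail.trans hηD)
  · rw [abs_div, abs_of_pos hLpos, ← add_div, div_le_iff₀ hLpos] at hsmall
    linarith
  · rw [heq h0, sqrt_mul_centredSum hD.ne', sub_add_cancel]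

/-- The upper tail of the standard normal law. -/
noncomputable def normalTail (w : ℝ) : ℝ :=
  ∫ u in Set.Ioi w, Real.exp (-u ^ 2 / 2) / Real.sqrt (2 * Real.pi)

theorem gaussianPDFReal_zero_one :
    ProbabilityTheory.gaussianPDFReal 0 1 =
      fun u => Real.exp (-u ^ 2 / 2) / Real.sqrt (2 * Real.pi) := by
  funext u
  simp [ProbabilityTheory.gaussianPDFReal]
  ring

theorem integrable_normal_density :
    MeasureTheory.Integrable fun u : ℝ => Real.exp (-u ^ 2 / 2) / Real.sqrt (2 * Real.pi) := by
  rw [← gaussianPDFReal_zero_one]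
  exact ProbabilityTheory.integrable_gaussianPDFReal 0 1

theorem normalTail_nonneg (w : ℝ) : 0 ≤ normalTail w :=
  MeasureTheory.integral_nonneg fun _ => by positivity

theorem normalTail_le_one (w : ℝ) : normalTail w ≤ 1 := by
  have h : ∫ u : ℝ, Real.exp (-u ^ 2 / 2) / Real.sqrt (2 * Real.pi) = 1 := by
    rw [← gaussianPDFReal_zero_one]
    exact ProbabilityTheory.integral_gaussianPDFReal_eq_one 0 one_ne_zero
  rw [← h]
  exact MeasureTheory.setIntegral_le_integral integrable_normal_density
    (Eventually.of_forall fun _ => by positivity)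

theorem normalTail_sub_le {v w : ℝ} (h : v ≤ w) : normalTail v - normalTail w ≤ w - v := by
  have hi := integrable_normal_density
  have e : normalTail v = (∫ u in v..w, Real.exp (-u ^ 2 / 2) / Real.sqrt (2 * Real.pi)) +
      normalTail w := by
    rw [normalTail, normalTail, intervalIntegral.integral_of_le h,
      ← MeasureTheory.setIntegral_union Set.Ioc_disjoint_Ioi_same measurableSet_Ioi
        hi.integrableOn hi.integrableOn, Set.Ioc_union_Ioi_eq_Ioi h]
  have h1 := intervalIntegral.integral_mono_on h hi.intervalIntegrable
    (intervalIntegrable_const : IntervalIntegrable (fun _ => (1 : ℝ)) MeasureTheory.volume v w)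
    (fun u _ => by
      have h2 : Real.exp (-u ^ 2 / 2) ≤ 1 := Real.exp_le_one_iff.2 (by nlinarith [sq_nonneg u])
      have h3 : 1 ≤ Real.sqrt (2 * Real.pi) :=
        Real.one_le_sqrt.2 (by linarith [Real.pi_gt_three])
      rw [div_le_one (by positivity)]
      exact h2.trans h3)
  rw [intervalIntegral.integral_const, smul_eq_mul, mul_one] at h1
  linarith

theorem tendsto_card_filter_truncLog {a : ℕ → ℝ} (ha : SatoTateClass a) (h1 : a 1 = 1) {m : ℕ}
    {t c : ℝ} (hc : c = 1 / 2 + Real.pi ^ 2 / 12) (K : ℕ)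
    (hd : ∀ N, m ≤ N → ∀ s ∈ Set.Icc (0 : ℝ) 2,
      |∑ p ∈ primesIoc m N, ((if |a p| ≤ s then (1 : ℝ) else 0) - smallMass s) / p| ≤ t)
    [DecidablePred fun n : ℕ => a (n.gcd (m.factorial ^ K)) ≠ 0] (w : ℝ) :
    Tendsto (fun N : ℕ => (((Finset.Icc 1 N).filter (fun n => a (n.gcd (m.factorial ^ K)) ≠ 0 ∧
        w ≤ centredSum (primesIoc m (primeBound N))
            (fun p => truncLog a N p / √(c * iterLog N))
            ((primesIoc m (primeBound N)).filter (· ∣ n)))).card : ℝ) /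
        ((Finset.Icc 1 N).filter fun n => a (n.gcd (m.factorial ^ K)) ≠ 0).card) atTop
      (𝓝 (normalTail w)) := by
  have hc0 : 0 < c := by rw [hc]; positivity
  refine tendsto_card_filter_centredSum (m.factorial ^ K) (pow_pos m.factorial_pos K)
    (fun n => a (n.gcd (m.factorial ^ K)) ≠ 0) (periodic_map_gcd_ne_zero a _)
    ⟨1, by simp [h1]⟩ (fun N => primesIoc m (primeBound N))
    (fun N p => truncLog a N p / √(c * iterLog N)) ?_
    (tendsto_sum_abs_truncLog_pow_div ha hc0 m) ?_ (tendsto_sum_sq_truncLog_div ha hc hd) w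
  · intro N p hp
    rw [mem_primesIoc] at hp
    refine ⟨hp.2, Nat.Coprime.pow_right K ?_⟩
    exact (Nat.coprime_factorial_iff hp.2.one_lt.ne').2 (by rw [hp.2.minFac_eq]; exact hp.1.1)
  · intro ε hε
    filter_upwards [eventually_abs_truncLog_div_le ha hc0 hε] with N hN p hp
    exact hN p (mem_primesIoc.1 hp).2

theorem card_filter_le_card_filter_add {α : Type*} (s B : Finset α) (p q : α → Prop)
    [DecidablePred p] [DecidablePred q] (h : ∀ n ∈ s, n ∉ B → p n → q n) :
    ((s.filter p).card : ℝ) ≤ (s.filter q).card + B.card := by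
  classical
  have h1 : s.filter p ⊆ s.filter q ∪ B := by
    intro n hn
    rw [Finset.mem_filter] at hn
    rw [Finset.mem_union, Finset.mem_filter]
    by_cases hB : n ∈ B
    · exact Or.inr hB
    · exact Or.inl ⟨hn.1, h n hn.1 hB hn.2⟩
  exact_mod_cast (Finset.card_le_card h1).trans (Finset.card_union_le _ _)

theorem abs_card_sub_mul_card_le {N : ℕ} {B : Finset ℕ} {Z W T : ℕ → Prop} {G : ℕ → ℝ}
    [DecidablePred Z] [DecidablePred W] [DecidablePred T] {Φ v η ε θ : ℝ} (hΦ0 : 0 ≤ Φ)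
    (hΦ1 : Φ ≤ 1) (hε : 0 ≤ ε)
    (hB : (B.card : ℝ) ≤ θ * N)
    (hiff : ∀ n ∈ Finset.Icc 1 N, n ∉ B → (Z n ↔ W n) ∧
      (Z n → (v + 2 * η ≤ G n → T n) ∧ (T n → v - 2 * η ≤ G n)))
    (hlow : (Φ - ε) * ((Finset.Icc 1 N).filter W).card ≤
      ((Finset.Icc 1 N).filter fun n => W n ∧ v + 2 * η ≤ G n).card)
    (hupp : (((Finset.Icc 1 N).filter fun n => W n ∧ v - 2 * η ≤ G n).card : ℝ) ≤
      (Φ + ε) * ((Finset.Icc 1 N).filter W).card) :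
    |(((Finset.Icc 1 N).filter fun n => Z n ∧ T n).card : ℝ) -
      Φ * ((Finset.Icc 1 N).filter Z).card| ≤ (2 * θ + ε) * N := by
  have hX1 := card_filter_le_card_filter_add (Finset.Icc 1 N) B (fun n => Z n ∧ T n)
    (fun n => W n ∧ v - 2 * η ≤ G n)
    fun n hn hnB h => ⟨(hiff n hn hnB).1.1 h.1, ((hiff n hn hnB).2 h.1).2 h.2⟩
  have hX2 := card_filter_le_card_filter_add (Finset.Icc 1 N) B
    (fun n => W n ∧ v + 2 * η ≤ G n) (fun n => Z n ∧ T n)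
    fun n hn hnB h => ⟨(hiff n hn hnB).1.2 h.1,
      ((hiff n hn hnB).2 ((hiff n hn hnB).1.2 h.1)).1 h.2⟩
  have hY1 := card_filter_le_card_filter_add (Finset.Icc 1 N) B Z W
    fun n hn hnB => (hiff n hn hnB).1.1
  have hY2 := card_filter_le_card_filter_add (Finset.Icc 1 N) B W Z
    fun n hn hnB => (hiff n hn hnB).1.2
  have hWN : (((Finset.Icc 1 N).filter W).card : ℝ) ≤ N := by
    have := Finset.card_filter_le (Finset.Icc 1 N) W
    rw [Nat.card_Icc, Nat.add_sub_cancel] at this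
    exact_mod_cast this
  set w : ℝ := (((Finset.Icc 1 N).filter W).card : ℝ)
  set y : ℝ := (((Finset.Icc 1 N).filter Z).card : ℝ)
  have hεw : ε * w ≤ ε * N := by gcongr
  have hB0 : (0 : ℝ) ≤ B.card := Nat.cast_nonneg _
  have hΦB : Φ * B.card ≤ 1 * B.card := by gcongr
  have h1 : Φ * w ≤ Φ * (y + B.card) := by gcongr
  have h2 : Φ * y ≤ Φ * (w + B.card) := by gcongr
  rw [abs_le]
  constructor <;> linarith

theorem eventually_abs_card_sub_mul_card_le {a : ℕ → ℝ} (ha : SatoTateClass a)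
    (hA2 : AssumptionA2 a) {c : ℝ} (hc : c = 1 / 2 + Real.pi ^ 2 / 12) (v : ℝ) {ε : ℝ}
    (hε : 0 < ε) :
    ∀ᶠ N : ℕ in atTop, |(((nonvanishing a N).filter (fun n =>
      v ≤ (Real.log |a n| + 1 / 2 * log₂ (n : ℝ)) / √(c * log₂ (n : ℝ)))).card : ℝ) -
        normalTail v * (nonvanishing a N).card| ≤ 15 * ε * N := by
  classical
  have h1 := ha.map_one hA2
  have hc1 : 1 ≤ c := by
    rw [hc]; nlinarith [Real.pi_gt_three]
  obtain ⟨τ, hτ, m₀, hd⟩ := exists_discrepancy ha hA2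
  have hinv : Tendsto (fun m : ℕ => 1 / (m : ℝ)) atTop (𝓝 0) :=
    tendsto_one_div_atTop_nhds_zero_nat
  obtain ⟨m, hm1, hm2, hm3, hm4⟩ := ((hτ.eventually_le_const hε).and
    ((eventually_ge_atTop m₀).and ((hinv.eventually_le_const hε).and
      (eventually_ge_atTop 1)))).exists
  have hd' : ∀ N, m ≤ N → ∀ s ∈ Set.Icc (0 : ℝ) 2,
      |∑ p ∈ primesIoc m N, ((if |a p| ≤ s then (1 : ℝ) else 0) - smallMass s) / p| ≤ τ m :=
    fun N hN => hd m N hm2 hN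
  have hpow : Tendsto (fun K : ℕ => ∑ p ∈ primesIoc 0 m, 1 / ((p ^ (K + 1) : ℕ) : ℝ)) atTop
      (𝓝 0) := by
    have hterm : ∀ p ∈ primesIoc 0 m,
        Tendsto (fun K : ℕ => 1 / ((p ^ (K + 1) : ℕ) : ℝ)) atTop (𝓝 0) := by
      intro p hp
      have hp1 : (1 : ℝ) < p := by exact_mod_cast (mem_primesIoc.1 hp).2.one_lt
      have := (tendsto_pow_atTop_nhds_zero_of_lt_one (inv_nonneg.2 (by linarith : (0 : ℝ) ≤ p))
        (inv_lt_one_of_one_lt₀ hp1)).comp (tendsto_add_atTop_nat 1)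
      refine this.congr fun K => ?_
      simp [Function.comp]
    simpa only [Finset.sum_const_zero] using tendsto_finsetSum _ hterm
  obtain ⟨K, hK⟩ := (hpow.eventually_le_const hε).exists
  have hlow := (tendsto_card_filter_truncLog ha h1 hc K hd' (v + 2 * ε)).eventually_const_lt
    (show normalTail v - 3 * ε < normalTail (v + 2 * ε) by
      linarith [normalTail_sub_le (show v ≤ v + 2 * ε by linarith)])
  have hupp := (tendsto_card_filter_truncLog ha h1 hc K hd' (v - 2 * ε)).eventually_lt_const
    (show normalTail (v - 2 * ε) < normalTail v + 3 * ε by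
      linarith [normalTail_sub_le (show v - 2 * ε ≤ v by linarith)])
  filter_upwards [hlow, hupp, exceptionalSet_approximation ha h1 hc1 hε K v hd',
    eventually_card_exceptionalSet_le ha hε hε K (by omega) hd', eventually_ge_atTop 1] with
    N hlow hupp happ hcard hN
  have hN0 : (0 : ℝ) ≤ N := Nat.cast_nonneg N
  have hpos : (0 : ℝ) <
      ((Finset.Icc 1 N).filter fun n => a (n.gcd (m.factorial ^ K)) ≠ 0).card := by
    rw [Nat.cast_pos, Finset.card_pos]
    exact ⟨1, by simp [h1, hN]⟩
  rw [lt_div_iff₀ hpos] at hlow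
  rw [div_lt_iff₀ hpos] at hupp
  have hmain := abs_card_sub_mul_card_le (θ := 6 * ε) (normalTail_nonneg v) (normalTail_le_one v)
    (by positivity : 0 ≤ 3 * ε) (hcard.trans (by gcongr; linarith)) happ hlow.le hupp.le
  have e : 2 * (6 * ε) + 3 * ε = 15 * ε := by ring
  rw [e] at hmain
  rw [nonvanishing, Nat.floor_natCast, Finset.filter_filter]
  exact hmain

theorem theorem3 (a : ℕ → ℝ) (ha : SatoTateClass a) (hA1 : AssumptionA1 a)
    (hA2 : AssumptionA2 a) (c : ℝ) (hc : c = 1 / 2 + Real.pi ^ 2 / 12) (v : ℝ) :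
    Tendsto
      (fun x : ℝ =>
        1 / ((nonvanishing a x).card : ℝ) *
          (((nonvanishing a x).filter (fun n =>
            v ≤ (Real.log |a n| + 1 / 2 * log₂ (n : ℝ)) / Real.sqrt (c * log₂ (n : ℝ)))).card : ℝ))
      atTop
      (𝓝 (∫ u in Set.Ioi v, Real.exp (-u ^ 2 / 2) / Real.sqrt (2 * Real.pi))) := by
  obtain ⟨κ, hκ, hdens⟩ := exists_le_card_nonvanishing ha hA2
  suffices h : Tendsto (fun N : ℕ => 1 / ((nonvanishing a N).card : ℝ) *
      (((nonvanishing a N).filter (fun n =>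
        v ≤ (Real.log |a n| + 1 / 2 * log₂ (n : ℝ)) / √(c * log₂ (n : ℝ)))).card : ℝ)) atTop
      (𝓝 (normalTail v)) by
    refine (h.comp tendsto_nat_floor_atTop).congr fun x => ?_
    simp only [Function.comp, nonvanishing, Nat.floor_natCast]
  rw [Metric.tendsto_atTop']
  intro ε hε
  have hε' : 0 < ε * κ / 16 := by positivity
  obtain ⟨N₀, hN₀⟩ := eventually_atTop.1 ((eventually_abs_card_sub_mul_card_le ha hA2 hc v hε').and
    (hdens.and (eventually_gt_atTop 0)))
  refine ⟨N₀, fun N hN => ?_⟩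
  obtain ⟨h1, h2, h3⟩ := hN₀ N hN.le
  have hN0 : (0 : ℝ) < N := by exact_mod_cast h3
  have hY : (0 : ℝ) < (nonvanishing a N).card := lt_of_lt_of_le (by positivity) h2
  rw [Real.dist_eq, one_div_mul_eq_div, div_sub' hY.ne', abs_div, abs_of_pos hY,
    div_lt_iff₀ hY, mul_comm ((nonvanishing a N).card : ℝ)]
  refine h1.trans_lt ?_
  have : ε * (κ * N) ≤ ε * (nonvanishing a N).card := by gcongr
  have : 0 < ε * (κ * N) := by positivity
  linarith
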